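/- Let $X$ be a compact, oriented, smooth Riemannian 4-manifold with metric $g$, and let $\omega$ be a self-dual harmonic 2-form on $X$ which vanishes transversely (as a section of the bundle $\Lambda_+$ of self-dual 2-forms). Let $Z=\omega^{-1}(0)$, and let $N\to Z$ be its normal bundle, the orthogonal complement of $TZ$ in $TX|_Z$. The covariant derivative $\nabla\omega$ identifies $N$ with $\Lambda_+|_Z$; orient $N$ so that this isomorphism is orientation reversing, where $\Lambda_+$ has the orientation induced by that of $X$ (for an oriented orthonormal coframe $e^0,\dots,e^3$, the basis $e^0\wedge e^1+e^2\wedge e^3,\ e^0\wedge e^2-e^1\wedge e^3,\ e^0\wedge e^3+e^1\wedge e^2$ is positive). On $X\setminus Z$ let $J=\sqrt2\,g^{-1}\omega/|\omega|$, where $g^{-1}\omega$ is the endomorphism with $g(g^{-1}\omega\, v,w)=\omega(v,w)$ and $|\omega|^2=\sum_{i<j}\omega(e_i,e_j)^2$ in an orthonormal basis; let $T^{1,0}=\{\alpha\in T^*X\otimes\mathbb C:\alpha\circ J=i\alpha\}$, and let $K=\Lambda^2T^{1,0}$ be the canonical line bundle of $J$. Lemma 2.1. Let $\sigma\colon N\to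 X$ be the exponential map of the metric, and let $N^0\subset N$ be an open ball neighbourhood of the zero section, $N^0=\{v\in N_z: z\in Z,\ |v|<\varepsilon(z)\}$ with $\varepsilon\colon Z\to(0,\infty)$ continuous, which is embedded in $X$ by $\sigma$. Let $p\in Z$ and let $S\subset N^0|_p$ be a round 2-sphere with centre $0$, oriented in the standard way as $S^2\subset\mathbb R^3\cong N_p$, with $\mathbb R^3\cong N_p$ an orientation-preserving linear isometry. Then $\sigma(S)\subset X\setminus Z$, and the restriction of $K$ to $S$ (that is, $\sigma^*K|_S$) is a complex line bundle with first Chern class $\langle c_1(K|_S),[S]\rangle=2$; so $K|_S$ is non-trivial. In particular $J$ does not extend over $Z$: for no $p\in Z$ and no neighbourhood $U$ of $p$ in $X$ is there a continuous almost complex structure on $U$ that equals $J$ on $U\setminus Z$. -/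

import Mathlib

open Bundle Set
open scoped Manifold ContDiff Topology Bundle

noncomputable section

namespace NearSymplectic

/-- The model space of a 4-manifold. -/
abbrev E4 : Type := EuclideanSpace ℝ (Fin 4)

/-- The unit sphere `S² ⊂ ℝ³`. -/
abbrev S2 : Type := Metric.sphere (0 : EuclideanSpace ℝ (Fin 3)) 1

/-! ### Complex line bundles over `S²` and their first Chern number -/

section ChernNumber

variable {B : Type*} (F : Type*) [NormedAddCommGroup F]
  {V : B → Type*} [∀ b, AddCommGroup (V b)] [∀ b, Module ℂ (V b)]
  [TopologicalSpace (TotalSpace F V)]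

/-- Let `L b ⊂ V b` be complex subspaces of the fibres of a vector bundle `V → B`, and
`f : S² → B` a map. `IsFrameOn F f L A s` says that over `A ⊂ S²` the map `s` is a continuous
nowhere zero section of `f^* V` whose value at each point `y` spans `L (f y)`. In other words,
over `A` the family `f^* L` is a complex line bundle, trivialized by `s`. -/
structure IsFrameOn (f : S2 → B) (L : ∀ b, Submodule ℂ (V b)) (A : Set S2)
    (s : ∀ y, V (f y)) : Prop where
  continuousOn : ContinuousOn (fun y => (⟨f y, s y⟩ : TotalSpace F V)) A
  ne_zero : ∀ y ∈ A, s y ≠ 0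
  span_eq : ∀ y ∈ A, Submodule.span ℂ {s y} = L (f y)

/-- The closed northern hemisphere of `S²`. -/
def northHemisphere : Set S2 := {y | 0 ≤ (y : EuclideanSpace ℝ (Fin 3)) 2}

/-- The closed southern hemisphere of `S²`. -/
def southHemisphere : Set S2 := {y | (y : EuclideanSpace ℝ (Fin 3)) 2 ≤ 0}

/-- The equator of `S²`, run through counterclockwise as seen from the north pole (this is the
boundary orientation of the northern hemisphere for the standard orientation of `S²`). -/
def equator (t : ℝ) : S2 :=
  ⟨!₂[Real.cos t, Real.sin t, 0], by
    simp [EuclideanSpace.norm_eq, Fin.sum_univ_three]⟩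

/-- The complex line bundle `f^* L` over `S²`, with its standard orientation as the boundary of
the unit ball of `ℝ³`, has first Chern number `⟨c₁(f^* L), [S²]⟩ = c`.

`f^* L` has frames `s₊` and `s₋` over the two closed hemispheres, and whenever `s₊`, `s₋` are such
frames, then the transition function `s₋ = exp (h) s₊` along the equator has winding number `c`.
The sign is the usual one: a line bundle with a section whose zeros are nondegenerate has as first
Chern number the sum of the degrees of these zeros, and the tangent bundle of the Riemann sphere
has first Chern number `2`. -/
def HasFirstChernNumber (f : S2 → B) (L : ∀ b, Submodule ℂ (V b)) (c : ℤ) : Prop :=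
  (∃ sp sm : ∀ y, V (f y),
    IsFrameOn F f L northHemisphere sp ∧ IsFrameOn F f L southHemisphere sm) ∧
  ∀ sp sm : ∀ y, V (f y),
    IsFrameOn F f L northHemisphere sp → IsFrameOn F f L southHemisphere sm →
    ∃ h : ℝ → ℂ, ContinuousOn h (Icc 0 (2 * Real.pi)) ∧
      (∀ t ∈ Icc 0 (2 * Real.pi), sm (equator t) = Complex.exp (h t) • sp (equator t)) ∧
      h (2 * Real.pi) - h 0 = 2 * Real.pi * Complex.I * c

/-- The complex line bundle `f^* L` over `S²` is trivial. -/
def IsTrivialLineBundle (f : S2 → B) (L : ∀ b, Submodule ℂ (V b)) : Prop :=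
  ∃ s : ∀ y, V (f y), IsFrameOn F f L univ s

end ChernNumber

/-! ### Riemannian metrics, orientations and 2-forms on 4-manifolds -/

section Manifold

variable {X : Type*} [TopologicalSpace X] [ChartedSpace E4 X] [IsManifold (𝓡 4) ∞ X]

instance (x : X) : FiniteDimensional ℝ (TangentSpace (𝓡 4) x) :=
  inferInstanceAs (FiniteDimensional ℝ E4)

instance (x : X) : T2Space (TangentSpace (𝓡 4) x) :=
  inferInstanceAs (T2Space E4)

variable (X) in
/-- A smooth Riemannian metric on `X`. -/
abbrev Metric4 : Type _ :=
  ContMDiffRiemannianMetric (𝓡 4) ∞ E4 (fun x : X => TangentSpace (𝓡 4) x)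

variable (X) in
/-- A real 2-form on `X` (smoothness is required separately). -/
abbrev TwoForm : Type _ := ∀ x : X, TangentSpace (𝓡 4) x [⋀^Fin 2]→L[ℝ] ℝ

/-- `coordFrame x₀ x : ℝ⁴ → T_x X` takes the standard basis to the coordinate vector fields at `x`
of the chart around `x₀`. -/
def coordFrame (x₀ x : X) : E4 →L[ℝ] TangentSpace (𝓡 4) x :=
  (trivializationAt E4 (TangentSpace (𝓡 4) : X → Type _) x₀).symmL ℝ x

variable (X) in
/-- An orientation of `X`: orientations of the tangent spaces which, read in charts, are locally
constant. -/
structure Orientation4 where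
  at_ : ∀ x : X, Orientation ℝ (TangentSpace (𝓡 4) x) (Fin 4)
  locallyConstant : ∀ x₀ : X, ∃ o₀ : Orientation ℝ E4 (Fin 4), ∀ᶠ x in 𝓝 x₀,
    ∀ hx : x ∈ (trivializationAt E4 (TangentSpace (𝓡 4) : X → Type _) x₀).baseSet,
      Orientation.map (Fin 4)
        ((trivializationAt E4 (TangentSpace (𝓡 4) : X → Type _) x₀).continuousLinearEquivAt
          ℝ x hx).toLinearEquiv (at_ x) = o₀

/-- `e` is an orthonormal basis of `T_x X`, positively oriented. -/
def IsOrientedONB (g : Metric4 X) (o : Orientation4 X) (x : X)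
    (e : Module.Basis (Fin 4) ℝ (TangentSpace (𝓡 4) x)) : Prop :=
  (∀ i j, g.inner x (e i) (e j) = if i = j then 1 else 0) ∧ e.orientation = o.at_ x

/-- `β = ⋆α` for 2-forms at the point `x`, where `⋆` is the Hodge star of the metric and the
orientation: `⋆(e⁰ ∧ e¹) = e² ∧ e³` for every oriented orthonormal coframe. -/
def IsHodgeStar (g : Metric4 X) (o : Orientation4 X) (x : X)
    (α β : TangentSpace (𝓡 4) x [⋀^Fin 2]→L[ℝ] ℝ) : Prop :=
  ∀ e, IsOrientedONB g o x e → β ![e 2, e 3] = α ![e 0, e 1]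

/-- `α ∈ Λ₊` at the point `x`, that is, `⋆α = α`. -/
def IsSelfDualAt (g : Metric4 X) (o : Orientation4 X) (x : X)
    (α : TangentSpace (𝓡 4) x [⋀^Fin 2]→L[ℝ] ℝ) : Prop :=
  IsHodgeStar g o x α α

/-- The coordinate expression of a 2-form in the chart around `x₀`. -/
def formInChart (Ω : TwoForm X) (x₀ : X) (y : E4) : E4 [⋀^Fin 2]→L[ℝ] ℝ :=
  (Ω ((extChartAt (𝓡 4) x₀).symm y)).compContinuousLinearMap
    (coordFrame x₀ ((extChartAt (𝓡 4) x₀).symm y))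

/-- `Ω` is a smooth 2-form. -/
def IsSmoothForm (Ω : TwoForm X) : Prop :=
  ∀ x₀ : X, ContDiffOn ℝ ∞ (formInChart Ω x₀) (extChartAt (𝓡 4) x₀).target

/-- `dΩ = 0`. -/
def IsClosedForm (Ω : TwoForm X) : Prop :=
  ∀ x₀ : X, ∀ y ∈ (extChartAt (𝓡 4) x₀).target, extDeriv (formInChart Ω x₀) y = 0

/-- `Ω` is a smooth harmonic 2-form: `dΩ = 0` and `d ⋆Ω = 0`. -/
def IsHarmonicForm (g : Metric4 X) (o : Orientation4 X) (Ω : TwoForm X) : Prop :=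
  IsSmoothForm Ω ∧ IsClosedForm Ω ∧
    ∃ η : TwoForm X, (∀ x, IsHodgeStar g o x (Ω x) (η x)) ∧ IsSmoothForm η ∧ IsClosedForm η

/-- `Ω` is self-dual. -/
def IsSelfDualForm (g : Metric4 X) (o : Orientation4 X) (Ω : TwoForm X) : Prop :=
  ∀ x, IsSelfDualAt g o x (Ω x)

/-- The zero set `Z` of `Ω`. -/
def zeroSet (Ω : TwoForm X) : Set X := {x | Ω x = 0}

/-- The covariant derivative `v ↦ ∇_v Ω` at a zero `p` of `Ω`. As `Ω` vanishes at `p`, this does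
not depend on the connection: it is the derivative at `p` of the components of `Ω` in the
chart around `p`, which identifies `T_p X` with `ℝ⁴`. (Used only at zeros of `Ω`.) -/
def nablaAtZero (Ω : TwoForm X) (p : X) :
    TangentSpace (𝓡 4) p → TangentSpace (𝓡 4) p [⋀^Fin 2]→L[ℝ] ℝ :=
  fun v => fderiv ℝ (formInChart Ω p) (extChartAt (𝓡 4) p p) v

/-- The self-dual 2-form `Ω` vanishes transversely, as a section of `Λ₊`: at each zero,
`∇Ω : T_p X → Λ₊` is onto. -/
def VanishesTransversely (g : Metric4 X) (o : Orientation4 X) (Ω : TwoForm X) : Prop :=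
  ∀ p ∈ zeroSet Ω, ∀ α, IsSelfDualAt g o p α → ∃ v, nablaAtZero Ω p v = α

/-- The curve `γ` passes at time `t` through `x`, with velocity `v ∈ T_x X` (which is computed in
the chart around `x`). -/
def HasVelocityAt (γ : ℝ → X) (t : ℝ) (x : X) (v : TangentSpace (𝓡 4) x) : Prop :=
  γ t = x ∧ ContinuousAt γ t ∧ HasDerivAt (fun s => (extChartAt (𝓡 4) x (γ s) : E4)) v t

/-- `v` is tangent at `p` to the subset `Z` of `X`: it is the velocity of a curve in `Z`. -/
def IsTangentTo (Z : Set X) (p : X) (v : TangentSpace (𝓡 4) p) : Prop :=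
  ∃ γ : ℝ → X, (∀ t, γ t ∈ Z) ∧ HasVelocityAt γ 0 p v

/-- The fibre at `p` of the normal bundle `N` of `Z`, as the orthogonal complement of `T_p Z`. -/
def normalSpace (g : Metric4 X) (Z : Set X) (p : X) : Set (TangentSpace (𝓡 4) p) :=
  {n | ∀ v, IsTangentTo Z p v → g.inner p n v = 0}

/-- `n` is an oriented orthonormal basis of the normal space `N_p` to the zero set of `Ω`. Here
`Λ₊` has its standard orientation, in which `α₁, α₂, α₃` is positive if the matrix
`αᵢ(e₀, eⱼ)`, `i, j = 1, 2, 3`, has positive determinant for an oriented orthonormal basis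
`e₀, e₁, e₂, e₃` of `T_p X`; and `N` is so oriented that `∇Ω : N → Λ₊` reverses orientation. -/
structure IsOrientedNormalONB (g : Metric4 X) (o : Orientation4 X) (Ω : TwoForm X) (p : X)
    (n : Fin 3 → TangentSpace (𝓡 4) p) : Prop where
  mem : ∀ i, n i ∈ normalSpace g (zeroSet Ω) p
  orthonormal : ∀ i j, g.inner p (n i) (n j) = if i = j then 1 else 0
  reversing : ∀ e, IsOrientedONB g o p e →
    Matrix.det (Matrix.of fun i j : Fin 3 => nablaAtZero Ω p (n i) ![e 0, e j.succ]) < 0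

/-! ### Geodesics and the exponential map -/

/-- The metric in the coordinates of the chart around `x₀`, that is, the matrix of the products
of the coordinate vector fields. -/
def metricInChart (g : Metric4 X) (x₀ : X) (y : E4) : E4 →L[ℝ] E4 →L[ℝ] ℝ :=
  let A := coordFrame x₀ ((extChartAt (𝓡 4) x₀).symm y)
  (ContinuousLinearMap.precomp ℝ A).comp ((g.inner ((extChartAt (𝓡 4) x₀).symm y)).comp A)

/-- `γ` is a geodesic on the open set `T` of times: it is `C²`, and it satisfies in each chart the
geodesic equation `∇_{c'} c' = 0` of the Levi-Civita connection, that is, with `G` the metric in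
the chart,
`⟨∇_{c'} c', w⟩ = G(c'', w) + (D_{c'} G)(c', w) - (1/2) (D_w G)(c', c') = 0` for all `w`. -/
def IsGeodesicOn (g : Metric4 X) (γ : ℝ → X) (T : Set ℝ) : Prop :=
  ∀ t ∈ T, ContinuousAt γ t ∧ ∀ x₀ : X, γ t ∈ (extChartAt (𝓡 4) x₀).source →
    let c : ℝ → E4 := fun s => extChartAt (𝓡 4) x₀ (γ s)
    let G := metricInChart g x₀
    ContDiffAt ℝ 2 c t ∧ ∀ w : E4,
      G (c t) (deriv (deriv c) t) w + fderiv ℝ G (c t) (deriv c t) (deriv c t) w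
        - 1 / 2 * fderiv ℝ G (c t) w (deriv c t) (deriv c t) = 0

/-- `q` is the point at time `1` of a geodesic which starts at `p` with velocity `v`. -/
def IsExp (g : Metric4 X) (p : X) (v : TangentSpace (𝓡 4) p) (q : X) : Prop :=
  ∃ γ : ℝ → X, ∃ δ > 0, IsGeodesicOn g γ (Ioo (-δ) (1 + δ)) ∧ HasVelocityAt γ 0 p v ∧ γ 1 = q

open Classical in
/-- The exponential map of the metric. (Outside its domain of definition, which is all of `TX`
if `X` is compact, the value is the base point.) -/
def riemExp (g : Metric4 X) (u : TangentBundle (𝓡 4) X) : X :=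
  if h : ∃ q, IsExp g u.1 u.2 q then h.choose else u.1

/-- The open ball neighbourhood of radius `ε` of the zero section in the normal bundle `N` of `Z`,
where the radius may vary along `Z`. -/
def normalBall (g : Metric4 X) (Z : Set X) (ε : X → ℝ) : Set (TangentBundle (𝓡 4) X) :=
  {u | u.1 ∈ Z ∧ u.2 ∈ normalSpace g Z u.1 ∧ Real.sqrt (g.inner u.1 u.2 u.2) < ε u.1}

/-- The exponential map is defined on the subset `N₀` of `TX`, and embeds it in `X`. -/
def ExpEmbeds (g : Metric4 X) (N₀ : Set (TangentBundle (𝓡 4) X)) : Prop :=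
  (∀ u ∈ N₀, ∃ q, IsExp g u.1 u.2 q) ∧
    Topology.IsEmbedding (fun u : N₀ => riemExp g u.1)

/-- The sphere of radius `r` with centre zero in the span of `n 0, n 1, n 2` in `T_p X`,
parametrized by the unit sphere of `ℝ³`, and mapped to `X` by the exponential map. -/
def normalSphere (g : Metric4 X) (p : X) (n : Fin 3 → TangentSpace (𝓡 4) p) (r : ℝ) (y : S2) : X :=
  riemExp g ⟨p, r • ∑ i, (y : EuclideanSpace ℝ (Fin 3)) i • n i⟩

/-! ### The almost complex structure and its canonical bundle -/

/-- The metric at `x` as a bilinear form. -/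
def metricForm (g : Metric4 X) (x : X) : LinearMap.BilinForm ℝ (TangentSpace (𝓡 4) x) :=
  LinearMap.mk₂ ℝ (fun v w => g.inner x v w) (by simp) (by simp) (by simp) (by simp)

theorem metricForm_nondegenerate (g : Metric4 X) (x : X) : (metricForm g x).Nondegenerate := by
  constructor
  · intro v hv
    by_contra h
    exact (g.pos x v h).ne' (hv v)
  · intro v hv
    by_contra h
    exact (g.pos x v h).ne' (hv v)

theorem update_vec2_zero {V : Type*} (v w u : V) :
    Function.update ![v, w] 0 u = ![u, w] := by
  ext i; fin_cases i <;> rfl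

theorem update_vec2_one {V : Type*} (v w u : V) :
    Function.update ![v, w] 1 u = ![v, u] := by
  ext i; fin_cases i <;> rfl

/-- `α` as a skew homomorphism `T_x X → T_x^* X`, `v ↦ α(v, ·)`. -/
def formHom {x : X} (α : TangentSpace (𝓡 4) x [⋀^Fin 2]→L[ℝ] ℝ) :
    TangentSpace (𝓡 4) x →ₗ[ℝ] Module.Dual ℝ (TangentSpace (𝓡 4) x) :=
  LinearMap.mk₂ ℝ (fun v w => α ![v, w])
    (fun v v' w => by
      have h := α.map_update_add ![v, w] 0 v v'
      simpa only [update_vec2_zero] using h)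
    (fun c v w => by
      have h := α.map_update_smul ![v, w] 0 c v
      simpa only [update_vec2_zero] using h)
    (fun v w w' => by
      have h := α.map_update_add ![v, w] 1 w w'
      simpa only [update_vec2_one] using h)
    (fun c v w => by
      have h := α.map_update_smul ![v, w] 1 c w
      simpa only [update_vec2_one] using h)

/-- The endomorphism `g⁻¹α` of `T_x X`; so `g(g⁻¹α v, w) = α(v, w)`. -/
def gInv (g : Metric4 X) (x : X) (α : TangentSpace (𝓡 4) x [⋀^Fin 2]→L[ℝ] ℝ) :
    TangentSpace (𝓡 4) x →ₗ[ℝ] TangentSpace (𝓡 4) x :=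
  ((metricForm g x).toDual (metricForm_nondegenerate g x)).symm.toLinearMap ∘ₗ formHom α

theorem inner_gInv (g : Metric4 X) (x : X) (α : TangentSpace (𝓡 4) x [⋀^Fin 2]→L[ℝ] ℝ)
    (v w : TangentSpace (𝓡 4) x) : g.inner x (gInv g x α v) w = α ![v, w] := by
  have h := LinearMap.BilinForm.apply_toDual_symm_apply
    (hB := metricForm_nondegenerate g x) (formHom α v) w
  exact h

/-- The norm of a 2-form at `x`, for which the `eⁱ ∧ eʲ` with `i < j` are orthonormal when the `eⁱ`
are; that is, `|α|² = ∑_{i<j} α(eᵢ, eⱼ)² = - (1/2) tr ((g⁻¹α)²)`. -/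
def formNorm (g : Metric4 X) (x : X) (α : TangentSpace (𝓡 4) x [⋀^Fin 2]→L[ℝ] ℝ) : ℝ :=
  Real.sqrt (-(1 / 2) * LinearMap.trace ℝ (TangentSpace (𝓡 4) x) (gInv g x α ∘ₗ gInv g x α))

/-- The almost complex structure `J = √2 g⁻¹Ω / |Ω|` off the zero set of `Ω`. -/
def acs (g : Metric4 X) (Ω : TwoForm X) (x : X) :
    TangentSpace (𝓡 4) x →L[ℝ] TangentSpace (𝓡 4) x :=
  (Real.sqrt 2 / formNorm g x (Ω x)) • LinearMap.toContinuousLinearMap (gInv g x (Ω x))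

/-- The space `T^{1,0}` of complex 1-forms at `x` of type `(1,0)`: `α ∘ J = i α`. -/
def T10 {x : X} (J : TangentSpace (𝓡 4) x →L[ℝ] TangentSpace (𝓡 4) x) :
    Submodule ℂ (TangentSpace (𝓡 4) x →L[ℝ] ℂ) where
  carrier := {α | ∀ v, α (J v) = Complex.I * α v}
  add_mem' := fun {a b} ha hb v => by
    have h1 := ha v
    have h2 := hb v
    simp [h1, h2, mul_add]
  zero_mem' := fun v => by simp
  smul_mem' := fun c a ha v => by
    have h1 := ha v
    simp [h1]
    ring

/-- The fibre at `x` of the canonical bundle `K = Λ² T^{1,0}` of `J = √2 g⁻¹Ω / |Ω|`, in the space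
of complex 2-forms at `x`: it is spanned by the wedge products of forms in `T^{1,0}`. -/
def canonicalBundle (g : Metric4 X) (Ω : TwoForm X) (x : X) :
    Submodule ℂ (TangentSpace (𝓡 4) x [⋀^Fin 2]→L[ℝ] (Bundle.Trivial X ℂ x)) :=
  Submodule.span ℂ {θ | ∃ α ∈ T10 (acs g Ω x), ∃ β ∈ T10 (acs g Ω x),
    ∀ v w, θ ![v, w] = α v * β w - α w * β v}

/-- The model fibre of the bundle of complex 2-forms. -/
abbrev ComplexForms : Type := E4 [⋀^Fin 2]→L[ℝ] ℂ

/-- The almost complex structure `J` extends, as a continuous almost complex structure, over the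
set `U`. -/
def ExtendsOver (g : Metric4 X) (Ω : TwoForm X) (U : Set X) : Prop :=
  ∃ J : ∀ x : X, TangentSpace (𝓡 4) x →L[ℝ] TangentSpace (𝓡 4) x,
    ContinuousOn (fun x => (⟨x, J x⟩ : TotalSpace (E4 →L[ℝ] E4)
      (fun x : X => TangentSpace (𝓡 4) x →L[ℝ] TangentSpace (𝓡 4) x))) U ∧
    (∀ x ∈ U, ∀ v, J x (J x v) = -v) ∧
    ∀ x ∈ U, x ∉ zeroSet Ω → J x = acs g Ω x

end Manifold

end NearSymplectic

end

open NearSymplectic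

/-!
At each point `K` is the line of 2-forms of type `(2,0)` with respect to `J`, so it depends
continuously on `J`. Shrink the normal sphere to `p` along geodesics. Since `Ω` vanishes at `p`,
it is to first order given by `∇Ω`, so at the point with direction `v` the endomorphism `J`
converges to the complex structure of the self-dual form `∇_v Ω` on `T_p X`. As `∇Ω` does not
vanish in the directions of the sphere, the limit is a complex structure on every fibre, and the
Chern number does not change. To compare fibres of `K` over different points of `X` along this
homotopy, `TX` is realized as a direct summand of a trivial bundle.

In an oriented orthonormal frame, the limit is the family of unit quaternions `M y / |M y|`, where
`y ∈ S²` and `M` is the matrix of `∇Ω` on the normal space. The orientation of `N` says that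
`det M < 0`, so `M` can be joined to `-1` in the invertible matrices. For the family `-y` explicit
frames over the two hemispheres have a transition function of winding number `2`.

Finally, `J` has opposite limits at `p` along `v` and along `-v`, so it does not extend over `p`.
-/

namespace NearSymplectic

/-! ### Line bundles over the sphere -/

section Logarithms

theorem exists_exp_eq_of_simplyConnected {A : Type*} [TopologicalSpace A] [SimplyConnectedSpace A]
    [LocallyPathConnectedSpace A] (u : C(A, ℂ)) (hu : ∀ a, u a ≠ 0) :
    ∃ k : C(A, ℂ), ∀ a, Complex.exp (k a) = u a := by
  obtain ⟨a₀⟩ := (inferInstance : Nonempty A)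
  obtain ⟨k, ⟨-, hk⟩, -⟩ := Complex.isCoveringMapOn_exp.existsUnique_continuousMap_lifts u
    (Complex.exp_log (hu a₀)) hu
  exact ⟨k, congrFun hk⟩

/-- The point of `S²` above (`σ = 1`) or below (`σ = -1`) the point `z` of the closed unit disc. -/
noncomputable def discLift (σ : ℤˣ) (z : Metric.closedBall (0 : ℂ) 1) : S2 :=
  ⟨!₂[z.1.re, z.1.im, (σ : ℤ) * √(1 - (z.1.re ^ 2 + z.1.im ^ 2))], by
    have hz : z.1.re ^ 2 + z.1.im ^ 2 ≤ 1 := by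
      rw [pow_two, pow_two, ← Complex.normSq_apply, Complex.normSq_eq_norm_sq]
      exact pow_le_one₀ (norm_nonneg _) (mem_closedBall_zero_iff.1 z.2)
    have hσ : (((σ : ℤ) : ℝ)) ^ 2 = 1 := by rcases Int.units_eq_one_or σ with rfl | rfl <;> simp
    simp [EuclideanSpace.norm_eq, Fin.sum_univ_three, mul_pow, hσ, Real.sq_sqrt (sub_nonneg.2 hz)]⟩

theorem continuous_discLift (σ : ℤˣ) : Continuous (discLift σ) := by
  refine Continuous.subtype_mk ((PiLp.continuous_toLp 2 _).comp (continuous_pi fun i => ?_)) _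
  fin_cases i
  · exact Complex.continuous_re.comp continuous_subtype_val
  · exact Complex.continuous_im.comp continuous_subtype_val
  · change Continuous fun z : Metric.closedBall (0 : ℂ) 1 =>
      ((σ : ℤ) : ℝ) * √(1 - (z.1.re ^ 2 + z.1.im ^ 2))
    fun_prop

theorem sum_sq_eq_one (y : S2) : y.1 0 ^ 2 + y.1 1 ^ 2 + y.1 2 ^ 2 = 1 := by
  have h := EuclideanSpace.norm_sq_eq y.1
  rw [norm_eq_of_mem_sphere y] at h
  simpa [Fin.sum_univ_three] using h.symm

theorem discLift_projection {σ : ℤˣ} {y : S2} (hy : 0 ≤ (σ : ℤ) * y.1 2)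
    (hz : (⟨y.1 0, y.1 1⟩ : ℂ) ∈ Metric.closedBall (0 : ℂ) 1) :
    discLift σ ⟨⟨y.1 0, y.1 1⟩, hz⟩ = y := by
  have h2 : 1 - (y.1 0 ^ 2 + y.1 1 ^ 2) = ((σ : ℤ) * y.1 2) ^ 2 := by
    rcases Int.units_eq_one_or σ with rfl | rfl <;>
      · simp only [Units.val_neg, Units.val_one, Int.cast_neg, Int.cast_one]
        linear_combination -sum_sq_eq_one y
  ext i
  fin_cases i
  · rfl
  · rfl
  · change ((σ : ℤ) : ℝ) * √(1 - (y.1 0 ^ 2 + y.1 1 ^ 2)) = y.1 2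
    rw [h2, Real.sqrt_sq hy]
    rcases Int.units_eq_one_or σ with rfl | rfl <;> simp

theorem mem_closedBall_projection (y : S2) :
    (⟨y.1 0, y.1 1⟩ : ℂ) ∈ Metric.closedBall (0 : ℂ) 1 := by
  rw [mem_closedBall_zero_iff, ← sq_le_one_iff₀ (norm_nonneg _), ← Complex.normSq_eq_norm_sq,
    Complex.normSq_mk]
  linarith [sum_sq_eq_one y, sq_nonneg (y.1 2)]

theorem exists_exp_eq_on_hemisphere (σ : ℤˣ) {u : S2 → ℂ}
    (hu : ContinuousOn u {y | 0 ≤ (σ : ℤ) * y.1 2})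
    (h0 : ∀ y ∈ {y : S2 | 0 ≤ (σ : ℤ) * y.1 2}, u y ≠ 0) :
    ∃ k : S2 → ℂ, Continuous k ∧
      ∀ y ∈ {y : S2 | 0 ≤ (σ : ℤ) * y.1 2}, Complex.exp (k y) = u y := by
  have hconv : Convex ℝ (Metric.closedBall (0 : ℂ) 1) := convex_closedBall 0 1
  have := hconv.contractibleSpace ⟨0, by simp⟩
  have := hconv.locallyPathConnectedSpace
  have hmem : ∀ z, discLift σ z ∈ {y : S2 | 0 ≤ (σ : ℤ) * y.1 2} := fun z => by
    change 0 ≤ ((σ : ℤ) : ℝ) * ((σ : ℤ) * √(1 - (z.1.re ^ 2 + z.1.im ^ 2)))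
    rcases Int.units_eq_one_or σ with rfl | rfl <;> simp
  obtain ⟨k, hk⟩ := exists_exp_eq_of_simplyConnected
    ⟨u ∘ discLift σ, hu.comp_continuous (continuous_discLift σ) hmem⟩ fun z => h0 _ (hmem z)
  refine ⟨fun y => k ⟨⟨y.1 0, y.1 1⟩, mem_closedBall_projection y⟩, ?_, fun y hy => ?_⟩
  · refine k.continuous.comp (Continuous.subtype_mk ?_ _)
    exact Complex.equivRealProdCLM.symm.continuous.comp
      (by fun_prop : Continuous fun y : S2 => (y.1 0, y.1 1))
  · rw [hk]
    exact congrArg u (discLift_projection hy _)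

theorem exists_exp_eq_on_northHemisphere {u : S2 → ℂ} (hu : ContinuousOn u northHemisphere)
    (h0 : ∀ y ∈ northHemisphere, u y ≠ 0) :
    ∃ k : S2 → ℂ, Continuous k ∧ ∀ y ∈ northHemisphere, Complex.exp (k y) = u y := by
  have h : northHemisphere = {y : S2 | 0 ≤ ((1 : ℤˣ) : ℤ) * y.1 2} := by
    simp [northHemisphere]
  rw [h] at hu h0 ⊢
  exact exists_exp_eq_on_hemisphere 1 hu h0

theorem exists_exp_eq_on_southHemisphere {u : S2 → ℂ} (hu : ContinuousOn u southHemisphere)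
    (h0 : ∀ y ∈ southHemisphere, u y ≠ 0) :
    ∃ k : S2 → ℂ, Continuous k ∧ ∀ y ∈ southHemisphere, Complex.exp (k y) = u y := by
  have h : southHemisphere = {y : S2 | 0 ≤ ((-1 : ℤˣ) : ℤ) * y.1 2} := by
    simp [southHemisphere]
  rw [h] at hu h0 ⊢
  exact exists_exp_eq_on_hemisphere (-1) hu h0

end Logarithms

section LineFrames

/-- Let `L y` be complex subspaces of a fixed space `W`. `IsLineFrame L A s` says that over `A` the
family `L` is a complex line bundle, trivialized by the continuous section `s`. This is
`IsFrameOn` for a trivial ambient bundle, without its total space. -/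
structure IsLineFrame {Y W : Type*} [TopologicalSpace Y] [AddCommGroup W] [Module ℂ W]
    [TopologicalSpace W] (L : Y → Submodule ℂ W) (A : Set Y) (s : Y → W) : Prop where
  continuousOn : ContinuousOn s A
  ne_zero : ∀ y ∈ A, s y ≠ 0
  span_eq : ∀ y ∈ A, Submodule.span ℂ {s y} = L y

variable {Y W W' : Type*} [TopologicalSpace Y] [AddCommGroup W] [Module ℂ W] [TopologicalSpace W]
  [AddCommGroup W'] [Module ℂ W'] [TopologicalSpace W']

theorem IsLineFrame.mem {L : Y → Submodule ℂ W} {A : Set Y} {s : Y → W} (hs : IsLineFrame L A s)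
    {y : Y} (hy : y ∈ A) : s y ∈ L y :=
  hs.span_eq y hy ▸ Submodule.mem_span_singleton_self _

theorem IsLineFrame.mono {L : Y → Submodule ℂ W} {A B : Set Y} {s : Y → W}
    (hs : IsLineFrame L A s) (h : B ⊆ A) : IsLineFrame L B s :=
  ⟨hs.continuousOn.mono h, fun y hy => hs.ne_zero y (h hy), fun y hy => hs.span_eq y (h hy)⟩

theorem IsLineFrame.congr {L : Y → Submodule ℂ W} {A : Set Y} {s s' : Y → W}
    (hs : IsLineFrame L A s) (h : ∀ y ∈ A, s' y = s y) : IsLineFrame L A s' :=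
  ⟨hs.continuousOn.congr h, fun y hy => h y hy ▸ hs.ne_zero y hy,
    fun y hy => h y hy ▸ hs.span_eq y hy⟩

theorem IsLineFrame.exists_transition [SeparatingDual ℂ W] {L : Y → Submodule ℂ W} {A : Set Y}
    {s s' : Y → W} (hs : IsLineFrame L A s) (hs' : IsLineFrame L A s') :
    ∃ u : Y → ℂ, ContinuousOn u A ∧ (∀ y ∈ A, u y ≠ 0) ∧ ∀ y ∈ A, s' y = u y • s y := by
  have hspan : ∀ y ∈ A, ∃ c : ℂ, c • s y = s' y := fun y hy =>
    Submodule.mem_span_singleton.1 (hs.span_eq y hy ▸ hs'.mem hy)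
  choose! u hu using hspan
  refine ⟨u, fun y hy => ?_, fun y hy h => ?_, fun y hy => (hu y hy).symm⟩
  · obtain ⟨φ, hφ⟩ := SeparatingDual.exists_ne_zero (R := ℂ) (hs.ne_zero y hy)
    have hcs : ContinuousWithinAt (fun x => φ (s x)) A y :=
      φ.continuous.continuousAt.comp_continuousWithinAt (hs.continuousOn y hy)
    have hcs' : ContinuousWithinAt (fun x => φ (s' x)) A y :=
      φ.continuous.continuousAt.comp_continuousWithinAt (hs'.continuousOn y hy)
    have hdiv : ∀ x ∈ A, φ (s x) ≠ 0 → u x = φ (s' x) / φ (s x) := fun x hxA hx => by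
      rw [← hu x hxA, map_smul, smul_eq_mul, mul_div_cancel_right₀ _ hx]
    refine (hcs'.div hcs hφ).congr_of_eventuallyEq ?_ (hdiv y hy hφ)
    filter_upwards [hcs.eventually_ne hφ, self_mem_nhdsWithin] with x hx hxA using hdiv x hxA hx
  · exact hs'.ne_zero y hy (by rw [← hu y hy, h, zero_smul])

theorem IsLineFrame.map {L : Y → Submodule ℂ W} {L' : Y → Submodule ℂ W'} {A : Set Y} {s : Y → W}
    (hs : IsLineFrame L A s) (T : Y → W →ₗ[ℂ] W') (hT : Continuous fun q : Y × W => T q.1 q.2)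
    (hmem : ∀ y, ∀ w ∈ L y, T y w ∈ L' y) (hinj : ∀ y, ∀ w ∈ L y, T y w = 0 → w = 0)
    (hline : ∀ y, ∀ w ∈ L' y, w ≠ 0 → Submodule.span ℂ {w} = L' y) :
    IsLineFrame L' A fun y => T y (s y) := by
  have hne : ∀ y ∈ A, T y (s y) ≠ 0 := fun y hy h0 => hs.ne_zero y hy (hinj y _ (hs.mem hy) h0)
  exact ⟨hT.comp_continuousOn (continuousOn_id.prodMk hs.continuousOn), hne,
    fun y hy => hline y _ (hmem y _ (hs.mem hy)) (hne y hy)⟩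

end LineFrames

section ClutchingNumber

variable {W W' : Type*} [AddCommGroup W] [Module ℂ W]
  [AddCommGroup W'] [Module ℂ W']

/-- The transition function from `sp` to `sm` along the equator has winding number `c`. -/
def HasWindingNumber (sp sm : S2 → W) (c : ℤ) : Prop :=
  ∃ h : ℝ → ℂ, ContinuousOn h (Icc 0 (2 * Real.pi)) ∧
    (∀ t ∈ Icc 0 (2 * Real.pi), sm (equator t) = Complex.exp (h t) • sp (equator t)) ∧
    h (2 * Real.pi) - h 0 = 2 * Real.pi * Complex.I * c

/-- The clutching description of a line bundle over `S²` with first Chern number `c`: some frames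
of `L` over the two hemispheres have a transition function with winding number `c`. -/
def HasClutchingNumber [TopologicalSpace W] (L : S2 → Submodule ℂ W) (c : ℤ) : Prop :=
  ∃ sp sm : S2 → W, IsLineFrame L northHemisphere sp ∧ IsLineFrame L southHemisphere sm ∧
    HasWindingNumber sp sm c

theorem continuous_equator : Continuous equator := by
  refine Continuous.subtype_mk ((PiLp.continuous_toLp 2 _).comp (continuous_pi fun i => ?_)) _
  fin_cases i
  exacts [Real.continuous_cos, Real.continuous_sin, continuous_const]

theorem equator_mem_northHemisphere (t : ℝ) : equator t ∈ northHemisphere := by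
  simp [equator, northHemisphere]

theorem equator_mem_southHemisphere (t : ℝ) : equator t ∈ southHemisphere := by
  simp [equator, southHemisphere]

theorem equator_two_pi : equator (2 * Real.pi) = equator 0 := by
  simp [equator]

theorem HasClutchingNumber.hasWindingNumber [TopologicalSpace W] [SeparatingDual ℂ W]
    {L : S2 → Submodule ℂ W} {c : ℤ} (hL : HasClutchingNumber L c) {sp sm : S2 → W}
    (hp : IsLineFrame L northHemisphere sp) (hm : IsLineFrame L southHemisphere sm) :
    HasWindingNumber sp sm c := by
  obtain ⟨sp₀, sm₀, hp₀, hm₀, h, hh, he, hc⟩ := hL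
  obtain ⟨u, hu, hu0, hus⟩ := hp.exists_transition hp₀
  obtain ⟨v, hv, hv0, hvs⟩ := hm₀.exists_transition hm
  obtain ⟨k, hk, hku⟩ := exists_exp_eq_on_northHemisphere hu hu0
  obtain ⟨l, hl, hlv⟩ := exists_exp_eq_on_southHemisphere hv hv0
  refine ⟨fun t => l (equator t) + h t + k (equator t), ?_, fun t ht => ?_, ?_⟩
  · exact ((hl.comp continuous_equator).continuousOn.add hh).add
      (hk.comp continuous_equator).continuousOn
  · have hN := equator_mem_northHemisphere t
    have hS := equator_mem_southHemisphere t
    rw [hvs _ hS, he t ht, hus _ hN, ← hlv _ hS, ← hku _ hN, smul_smul, smul_smul,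
      Complex.exp_add, Complex.exp_add]
  · simp only [equator_two_pi]
    linear_combination hc

theorem apply_eq_of_exp_eq_one {a b : ℝ} (hab : a ≤ b) {h : ℝ → ℂ} (hh : ContinuousOn h (Icc a b))
    (h1 : ∀ t ∈ Icc a b, Complex.exp (h t) = 1) : h a = h b := by
  have : PreconnectedSpace (Icc a b) := isPreconnected_iff_preconnectedSpace.1 isPreconnected_Icc
  exact Complex.isCoveringMap_exp.const_of_comp hh.domRestrict
    (fun t t' => Subtype.ext ((h1 t t.2).trans (h1 t' t'.2).symm))
    ⟨a, left_mem_Icc.2 hab⟩ ⟨b, right_mem_Icc.2 hab⟩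

theorem HasWindingNumber.eq_zero_of_self {s : S2 → W} {c : ℤ}
    (h : HasWindingNumber s s c) (h0 : ∀ t, s (equator t) ≠ 0) : c = 0 := by
  obtain ⟨h, hh, he, hc⟩ := h
  have hexp : ∀ t ∈ Icc 0 (2 * Real.pi), Complex.exp (h t) = 1 := fun t ht =>
    smul_left_injective ℂ (h0 t) ((he t ht).symm.trans (one_smul ℂ _).symm)
  rw [apply_eq_of_exp_eq_one Real.two_pi_pos.le hh hexp, sub_self] at hc
  exact_mod_cast (mul_eq_zero.1 hc.symm).resolve_left Complex.two_pi_I_ne_zero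

theorem HasClutchingNumber.map [TopologicalSpace W] [TopologicalSpace W']
    {L : S2 → Submodule ℂ W} {L' : S2 → Submodule ℂ W'} {c : ℤ} (hL : HasClutchingNumber L c)
    (T : S2 → W →ₗ[ℂ] W') (hT : Continuous fun q : S2 × W => T q.1 q.2)
    (hmem : ∀ y, ∀ w ∈ L y, T y w ∈ L' y) (hinj : ∀ y, ∀ w ∈ L y, T y w = 0 → w = 0)
    (hline : ∀ y, ∀ w ∈ L' y, w ≠ 0 → Submodule.span ℂ {w} = L' y) :
    HasClutchingNumber L' c := by
  obtain ⟨sp, sm, hp, hm, h, hh, he, hc⟩ := hL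
  exact ⟨_, _, hp.map T hT hmem hinj hline, hm.map T hT hmem hinj hline, h, hh,
    fun t ht => by simp only [he t ht, map_smul], hc⟩

end ClutchingNumber

section Homotopy

theorem exists_dist_lt_of_continuous {V Y : Type*} [SeminormedAddCommGroup V]
    [TopologicalSpace Y] [CompactSpace Y] {Q : Y × unitInterval → V} (hQ : Continuous Q)
    {ε : ℝ} (hε : 0 < ε) :
    ∃ δ > 0, ∀ y (t t' : unitInterval), dist t t' < δ → ‖Q (y, t) - Q (y, t')‖ < ε := by
  let G : C(unitInterval, C(Y, V)) := ContinuousMap.curry ⟨fun q => Q q.swap, by fun_prop⟩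
  obtain ⟨δ, hδ, h⟩ := Metric.uniformContinuous_iff.1
    (CompactSpace.uniformContinuous_of_continuous G.continuous) ε hε
  refine ⟨δ, hδ, fun y t t' htt => ?_⟩
  rw [← dist_eq_norm]
  exact (ContinuousMap.dist_apply_le_dist (f := G t) (g := G t') y).trans_lt (h htt)

/-- The fixed lines of idempotents which are close to each other are identified by either
idempotent, so the clutching number is locally constant along the homotopy. -/
theorem HasClutchingNumber.homotopy {W : Type*} [NormedAddCommGroup W] [NormedSpace ℝ W]
    [Module ℂ W] {Q : S2 × unitInterval → W →L[ℝ] W} (hQ : Continuous Q)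
    (hsmul : ∀ q (a : ℂ) w, Q q (a • w) = a • Q q w) (hid : ∀ q w, Q q (Q q w) = Q q w)
    {L : S2 × unitInterval → Submodule ℂ W} (hL : ∀ q w, w ∈ L q ↔ Q q w = w)
    (hline : ∀ q, ∀ w ∈ L q, w ≠ 0 → Submodule.span ℂ {w} = L q) {c : ℤ}
    (h : HasClutchingNumber (fun y => L (y, 0)) c) :
    HasClutchingNumber (fun y => L (y, 1)) c := by
  obtain ⟨δ, hδ, hclose⟩ := exists_dist_lt_of_continuous hQ one_pos
  have hstep : ∀ t t' : unitInterval, dist t t' < δ →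
      HasClutchingNumber (fun y => L (y, t)) c → HasClutchingNumber (fun y => L (y, t')) c := by
    intro t t' htt ht
    refine ht.map (fun y => { toFun := Q (y, t'), map_add' := map_add _, map_smul' := hsmul _ })
      ((hQ.comp (by fun_prop : Continuous fun q : S2 × W => (q.1, t'))).clm_apply continuous_snd)
      (fun y w _ => (hL _ _).2 (hid _ _)) (fun y w hw h0 => ?_) fun y => hline _
    have hw' : (Q (y, t) - Q (y, t')) w = w := by
      rw [sub_apply, (hL _ _).1 hw, show Q (y, t') w = 0 from h0, sub_zero]
    by_contra hne
    refine lt_irrefl ‖w‖ ?_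
    calc ‖w‖ = ‖(Q (y, t) - Q (y, t')) w‖ := by rw [hw']
      _ ≤ ‖Q (y, t) - Q (y, t')‖ * ‖w‖ := ContinuousLinearMap.le_opNorm _ _
      _ < 1 * ‖w‖ := mul_lt_mul_of_pos_right (hclose y t t' htt) (norm_pos_iff.2 hne)
      _ = ‖w‖ := one_mul _
  have hconst : IsLocallyConstant fun t : unitInterval =>
      HasClutchingNumber (fun y => L (y, t)) c :=
    IsLocallyConstant.iff_eventually_eq _ |>.2 fun t => by
      filter_upwards [Metric.ball_mem_nhds t hδ] with t' ht'
      exact propext ⟨hstep t' t ht', hstep t t' (dist_comm t t' ▸ ht')⟩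
  exact (hconst.apply_eq_of_preconnectedSpace 0 1).mp h

end Homotopy

/-! ### Forms of type (2,0) -/

section TwoForms

variable {T M : Type*} [AddCommGroup T] [Module ℝ T] [TopologicalSpace T]
  [AddCommGroup M] [Module ℝ M] [TopologicalSpace M]

theorem twoForm_add_left (θ : T [⋀^Fin 2]→L[ℝ] M) (u v w : T) :
    θ ![u + v, w] = θ ![u, w] + θ ![v, w] :=
  θ.vecCons_add _ u v

theorem twoForm_smul_left (θ : T [⋀^Fin 2]→L[ℝ] M) (a : ℝ) (u w : T) :
    θ ![a • u, w] = a • θ ![u, w] :=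
  θ.vecCons_smul _ a u

theorem twoForm_neg_left (θ : T [⋀^Fin 2]→L[ℝ] M) (u w : T) : θ ![-u, w] = -θ ![u, w] := by
  rw [← neg_one_smul ℝ u, twoForm_smul_left, neg_one_smul]

theorem twoForm_swap (θ : T [⋀^Fin 2]→L[ℝ] M) (u v : T) : θ ![u, v] = -θ ![v, u] := by
  have h := θ.toAlternatingMap.map_swap ![v, u] (i := 0) (j := 1) (by decide)
  have h2 : ![v, u] ∘ (Equiv.swap (0 : Fin 2) 1) = ![u, v] := by
    ext i; fin_cases i <;> rfl
  rwa [h2] at h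

theorem twoForm_self (θ : T [⋀^Fin 2]→L[ℝ] M) (u : T) : θ ![u, u] = 0 :=
  θ.map_eq_zero_of_eq ![u, u] (i := 0) (j := 1) rfl (by decide)

theorem twoForm_add_right (θ : T [⋀^Fin 2]→L[ℝ] M) (u v w : T) :
    θ ![w, u + v] = θ ![w, u] + θ ![w, v] := by
  simpa only [update_vec2_one] using θ.map_update_add ![w, u] 1 u v

theorem twoForm_smul_right (θ : T [⋀^Fin 2]→L[ℝ] M) (a : ℝ) (u w : T) :
    θ ![w, a • u] = a • θ ![w, u] := by
  simpa only [update_vec2_one] using θ.map_update_smul ![w, u] 1 a u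

theorem twoForm_neg_right (θ : T [⋀^Fin 2]→L[ℝ] M) (u w : T) : θ ![u, -w] = -θ ![u, w] := by
  rw [← neg_one_smul ℝ w, twoForm_smul_right, neg_one_smul]

theorem twoForm_ext {θ η : T [⋀^Fin 2]→L[ℝ] M} (h : ∀ u v, θ ![u, v] = η ![u, v]) : θ = η := by
  ext v
  have hv : v = ![v 0, v 1] := by
    ext i; fin_cases i <;> rfl
  rw [hv]
  exact h _ _

theorem twoForm_ext_basis {θ η : T [⋀^Fin 2]→L[ℝ] M} {ι : Type*} (b : Module.Basis ι ℝ T)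
    (h : ∀ i j, θ ![b i, b j] = η ![b i, b j]) : θ = η := by
  apply ContinuousAlternatingMap.toAlternatingMap_injective
  refine Module.Basis.ext_alternating b fun v _ => ?_
  have hv : (fun i => b (v i)) = ![b (v 0), b (v 1)] := by
    ext i; fin_cases i <;> rfl
  rw [hv]
  exact h _ _

theorem compContinuousLinearMap_apply_vec2 {T' : Type*} [AddCommGroup T'] [Module ℝ T']
    [TopologicalSpace T'] (θ : T' [⋀^Fin 2]→L[ℝ] M) (A : T →L[ℝ] T') (u v : T) :
    θ.compContinuousLinearMap A ![u, v] = θ ![A u, A v] := by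
  rw [ContinuousAlternatingMap.compContinuousLinearMap_apply]
  congr 1
  ext i; fin_cases i <;> rfl

/-- The wedge product `α ∧ β` of complex 1-forms. -/
noncomputable def wedge (α β : T →L[ℝ] ℂ) : T [⋀^Fin 2]→L[ℝ] ℂ where
  toFun v := α (v 0) * β (v 1) - α (v 1) * β (v 0)
  map_update_add' := by
    intro _ v i x y
    fin_cases i <;> simp <;> ring
  map_update_smul' := by
    intro _ v i a x
    fin_cases i <;> simp <;> ring
  cont := by fun_prop
  map_eq_zero_of_eq' := by
    intro v i j h hij
    have hv : v 0 = v 1 := by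
      fin_cases i <;> fin_cases j <;> simp_all
    simp [hv]

theorem wedge_apply (α β : T →L[ℝ] ℂ) (u v : T) :
    wedge α β ![u, v] = α u * β v - α v * β u := rfl

end TwoForms

section ComplexStructures

variable {T : Type*} [AddCommGroup T] [Module ℝ T]

theorem eq_zero_of_smul_add_smul_mem {J : T →ₗ[ℝ] T} (hJ : ∀ v, J (J v) = -v)
    {P : Submodule ℝ T} (hP : ∀ x ∈ P, J x ∈ P) {v : T} (hv : v ∉ P) {a b : ℝ}
    (h : a • v + b • J v ∈ P) : a = 0 ∧ b = 0 := by
  have hmem : (a ^ 2 + b ^ 2) • v ∈ P := by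
    have h' := P.sub_mem (P.smul_mem a h) (P.smul_mem b (hP _ h))
    simp only [map_add, map_smul, hJ] at h'
    convert h' using 1
    module
  have hab : a ^ 2 + b ^ 2 = 0 := by
    by_contra hne
    exact hv ((P.smul_mem_iff hne).1 hmem)
  constructor <;> nlinarith [sq_nonneg a, sq_nonneg b]

theorem exists_complex_basis (hd : Module.finrank ℝ T = 4) {J : T →ₗ[ℝ] T}
    (hJ : ∀ v, J (J v) = -v) :
    ∃ b : Module.Basis (Fin 4) ℝ T, b 1 = J (b 0) ∧ b 3 = J (b 2) := by
  have : Nontrivial T := Module.nontrivial_of_finrank_pos (R := ℝ) (by lia)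
  obtain ⟨u, hu⟩ := exists_ne (0 : T)
  have hlt : Submodule.span ℝ {u, J u} ≠ ⊤ := by
    classical
    intro h
    have hcard := finrank_span_finset_le_card (R := ℝ) ({u, J u} : Finset T)
    rw [Set.finrank, Finset.coe_pair, h, finrank_top, hd] at hcard
    have := Finset.card_le_two (a := u) (b := J u)
    lia
  obtain ⟨v, -, hv⟩ := SetLike.exists_of_lt hlt.lt_top
  have hinv : ∀ x ∈ Submodule.span ℝ {u, J u}, J x ∈ Submodule.span ℝ {u, J u} := by
    simp only [Submodule.mem_span_pair]
    rintro _ ⟨a, b, rfl⟩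
    exact ⟨-b, a, by simp only [map_add, map_smul, hJ]; module⟩
  have hli : LinearIndependent ℝ ![u, J u, v, J v] := by
    rw [Fintype.linearIndependent_iff]
    intro c hc
    simp only [Fin.sum_univ_four, Matrix.cons_val] at hc
    obtain ⟨h2, h3⟩ := eq_zero_of_smul_add_smul_mem hJ hinv hv (a := c 2) (b := c 3)
      (Submodule.mem_span_pair.2 ⟨-c 0, -c 1, by linear_combination (norm := module) -hc⟩)
    obtain ⟨h0, h1⟩ := eq_zero_of_smul_add_smul_mem hJ (P := ⊥) (by simp) (by simpa using hu)
      (a := c 0) (b := c 1) (by simpa [h2, h3] using hc)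
    intro i
    fin_cases i <;> assumption
  let b := basisOfLinearIndependentOfCardEqFinrank hli (by simp [hd])
  exact ⟨b, by simp [b], by simp [b]⟩

variable [TopologicalSpace T]

/-- The complex 2-forms of type `(2,0)` with respect to `J`. The endomorphism `J` is allowed to be
degenerate: if `J` is a complex structure on a direct summand and zero on the complement, these
are the `(2,0)`-forms of the summand, extended by zero. -/
def typeTwoZero (J : T → T) : Submodule ℂ (T [⋀^Fin 2]→L[ℝ] ℂ) where
  carrier := {θ | ∀ u v, θ ![J u, v] = Complex.I * θ ![u, v]}
  add_mem' {θ η} hθ hη u v := by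
    simp only [ContinuousAlternatingMap.add_apply, hθ u v, hη u v, mul_add]
  zero_mem' u v := by simp
  smul_mem' c θ hθ u v := by
    simp only [ContinuousAlternatingMap.smul_apply, hθ u v, smul_eq_mul, mul_left_comm]

theorem apply_right_of_mem_typeTwoZero {J : T → T} {θ : T [⋀^Fin 2]→L[ℝ] ℂ}
    (h : θ ∈ typeTwoZero J) (u v : T) : θ ![u, J v] = Complex.I * θ ![u, v] := by
  rw [twoForm_swap, h, twoForm_swap θ v u, mul_neg, neg_neg]

theorem comp_mem_typeTwoZero {T' : Type*} [AddCommGroup T'] [Module ℝ T'] [TopologicalSpace T']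
    {J : T → T} {J' : T' → T'} {A : T →L[ℝ] T'} (h : ∀ v, A (J v) = J' (A v))
    {θ : T' [⋀^Fin 2]→L[ℝ] ℂ} (hθ : θ ∈ typeTwoZero J') :
    θ.compContinuousLinearMap A ∈ typeTwoZero J := fun u v => by
  rw [compContinuousLinearMap_apply_vec2, compContinuousLinearMap_apply_vec2, h, hθ]

theorem eq_smul_of_mem_typeTwoZero {J : T → T} {b : Module.Basis (Fin 4) ℝ T}
    (h1 : b 1 = J (b 0)) (h3 : b 3 = J (b 2)) {θ η : T [⋀^Fin 2]→L[ℝ] ℂ}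
    (hθ : θ ∈ typeTwoZero J) (hη : η ∈ typeTwoZero J) {c : ℂ}
    (h : θ ![b 0, b 2] = c * η ![b 0, b 2]) : θ = c • η := by
  refine twoForm_ext_basis b fun i j => ?_
  have h' : θ ![b 2, b 0] = c * η ![b 2, b 0] := by
    rw [twoForm_swap, h, twoForm_swap η (b 2), mul_neg]
  fin_cases i <;> fin_cases j <;>
    simp [h1, h3, hθ _ _, hη _ _, apply_right_of_mem_typeTwoZero hθ,
      apply_right_of_mem_typeTwoZero hη, twoForm_self, h, h', mul_left_comm]

theorem span_eq_typeTwoZero (hd : Module.finrank ℝ T = 4) {J : T →ₗ[ℝ] T}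
    (hJ : ∀ v, J (J v) = -v) {θ : T [⋀^Fin 2]→L[ℝ] ℂ} (hθ : θ ∈ typeTwoZero J) (h0 : θ ≠ 0) :
    Submodule.span ℂ {θ} = typeTwoZero J := by
  obtain ⟨b, h1, h3⟩ := exists_complex_basis hd hJ
  have h02 : θ ![b 0, b 2] ≠ 0 := fun h => h0 <|
    (eq_smul_of_mem_typeTwoZero h1 h3 hθ hθ (c := 0) (by rw [h, mul_zero])).trans (zero_smul ℂ θ)
  refine le_antisymm ((Submodule.span_singleton_le_iff_mem _ _).2 hθ) fun η hη => ?_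
  exact Submodule.mem_span_singleton.2
    ⟨_, (eq_smul_of_mem_typeTwoZero h1 h3 hη hθ (div_mul_cancel₀ _ h02).symm).symm⟩

theorem exists_wedge_ne_zero [IsTopologicalAddGroup T] [ContinuousSMul ℝ T] [T2Space T]
    (hd : Module.finrank ℝ T = 4) {J : T →ₗ[ℝ] T} (hJ : ∀ v, J (J v) = -v) :
    ∃ α β : T →L[ℝ] ℂ, (∀ v, α (J v) = Complex.I * α v) ∧ (∀ v, β (J v) = Complex.I * β v) ∧
      wedge α β ≠ 0 := by
  have : FiniteDimensional ℝ T := Module.finite_of_finrank_pos (by lia)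
  obtain ⟨b, h1, h3⟩ := exists_complex_basis hd hJ
  have hpart : ∀ φ : T →ₗ[ℝ] ℝ, ∃ α : T →L[ℝ] ℂ, (∀ v, α v = φ v - Complex.I * φ (J v)) ∧
      ∀ v, α (J v) = Complex.I * α v := fun φ => by
    refine ⟨LinearMap.toContinuousLinearMap
      (Complex.ofRealCLM ∘ₗ φ - Complex.I • Complex.ofRealCLM ∘ₗ φ ∘ₗ J), fun v => rfl, fun v => ?_⟩
    change (φ (J v) : ℂ) - Complex.I * φ (J (J v)) = Complex.I * (φ v - Complex.I * φ (J v))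
    rw [hJ, map_neg]
    push_cast
    linear_combination (φ (J v) : ℂ) * Complex.I_sq
  obtain ⟨α, hα, hαJ⟩ := hpart (b.coord 0)
  obtain ⟨β, hβ, hβJ⟩ := hpart (b.coord 2)
  refine ⟨α, β, hαJ, hβJ, fun h => ?_⟩
  have h02 : wedge α β ![b 0, b 2] = 0 := by rw [h]; rfl
  simp [wedge_apply, hα, hβ, ← h1, ← h3] at h02

theorem span_wedge_eq_typeTwoZero [IsTopologicalAddGroup T] [ContinuousSMul ℝ T] [T2Space T]
    (hd : Module.finrank ℝ T = 4) {J : T →ₗ[ℝ] T} (hJ : ∀ v, J (J v) = -v) :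
    Submodule.span ℂ {θ : T [⋀^Fin 2]→L[ℝ] ℂ | ∃ α : T →L[ℝ] ℂ, (∀ v, α (J v) = Complex.I * α v) ∧
      ∃ β : T →L[ℝ] ℂ, (∀ v, β (J v) = Complex.I * β v) ∧
      ∀ v w, θ ![v, w] = α v * β w - α w * β v} = typeTwoZero J := by
  have hmem : ∀ θ : T [⋀^Fin 2]→L[ℝ] ℂ, (∃ α : T →L[ℝ] ℂ, (∀ v, α (J v) = Complex.I * α v) ∧
      ∃ β : T →L[ℝ] ℂ, (∀ v, β (J v) = Complex.I * β v) ∧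
      ∀ v w, θ ![v, w] = α v * β w - α w * β v) → θ ∈ typeTwoZero J := by
    rintro θ ⟨α, hα, β, hβ, h⟩ u v
    rw [h, h, hα, hβ]
    ring
  obtain ⟨α, β, hα, hβ, h0⟩ := exists_wedge_ne_zero hd hJ
  refine le_antisymm (Submodule.span_le.2 hmem) ?_
  rw [← span_eq_typeTwoZero hd hJ (hmem (wedge α β) ⟨α, hα, β, hβ, wedge_apply α β⟩) h0]
  exact Submodule.span_mono (singleton_subset_iff.2 ⟨α, hα, β, hβ, wedge_apply α β⟩)

section Summand

variable {V : Type*} [AddCommGroup V] [Module ℝ V] [TopologicalSpace V]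
  {ι : T →L[ℝ] V} {ρ : V →L[ℝ] T} {J : T →ₗ[ℝ] T}

theorem comp_comp_of_mem_typeTwoZero (hρι : ∀ v, ρ (ι v) = v)
    {θ : V [⋀^Fin 2]→L[ℝ] ℂ} (hθ : θ ∈ typeTwoZero fun v => ι (J (ρ v))) :
    (θ.compContinuousLinearMap ι).compContinuousLinearMap ρ = θ := by
  have hleft : ∀ u v, θ ![ι (ρ u), v] = θ ![u, v] := fun u v => by
    refine mul_left_cancel₀ Complex.I_ne_zero ?_
    simp only [← hθ _ _, hρι]
  refine twoForm_ext fun u v => ?_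
  rw [compContinuousLinearMap_apply_vec2, compContinuousLinearMap_apply_vec2, hleft,
    twoForm_swap, hleft, ← twoForm_swap]

theorem comp_ne_zero_of_mem_typeTwoZero (hρι : ∀ v, ρ (ι v) = v)
    {θ : V [⋀^Fin 2]→L[ℝ] ℂ} (hθ : θ ∈ typeTwoZero fun v => ι (J (ρ v))) (h0 : θ ≠ 0) :
    θ.compContinuousLinearMap ι ≠ 0 := fun h => h0 <| by
  rw [← comp_comp_of_mem_typeTwoZero hρι hθ, h]
  exact twoForm_ext fun u v => rfl

theorem span_eq_typeTwoZero_of_summand (hd : Module.finrank ℝ T = 4)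
    (hρι : ∀ v, ρ (ι v) = v) (hJ : ∀ v, J (J v) = -v)
    {θ : V [⋀^Fin 2]→L[ℝ] ℂ} (hθ : θ ∈ typeTwoZero fun v => ι (J (ρ v))) (h0 : θ ≠ 0) :
    Submodule.span ℂ {θ} = typeTwoZero fun v => ι (J (ρ v)) := by
  have hι : ∀ v, ι (J v) = (fun v => ι (J (ρ v))) (ι v) := fun v => by simp only [hρι]
  refine le_antisymm ((Submodule.span_singleton_le_iff_mem _ _).2 hθ) fun η hη => ?_
  have hspan := span_eq_typeTwoZero hd hJ (comp_mem_typeTwoZero hι hθ)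
    (comp_ne_zero_of_mem_typeTwoZero hρι hθ h0)
  obtain ⟨c, hc⟩ := Submodule.mem_span_singleton.1 (hspan ▸ comp_mem_typeTwoZero hι hη)
  refine Submodule.mem_span_singleton.2 ⟨c, ?_⟩
  rw [← comp_comp_of_mem_typeTwoZero hρι hη, ← hc]
  nth_rw 1 [← comp_comp_of_mem_typeTwoZero hρι hθ]
  exact twoForm_ext fun u v => rfl

end Summand

end ComplexStructures

section TwoZeroProjection

variable {V : Type*} [NormedAddCommGroup V] [NormedSpace ℝ V]

/-- For `J³ = -J`, the projection of the complex 2-forms to the forms of type `(2,0)`. With the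
projection `P = -J²` to the image of `J`, it takes `θ` to the form
`(u, v) ↦ (θ(Pu, Pv) - i (θ(Ju, Pv) + θ(Pu, Jv)) - θ(Ju, Jv)) / 4`, where the middle term is
expressed by pullbacks through polarization. -/
noncomputable def projTwoZero (J : V →L[ℝ] V) :
    (V [⋀^Fin 2]→L[ℝ] ℂ) →L[ℝ] (V [⋀^Fin 2]→L[ℝ] ℂ) :=
  (1 / 4 : ℝ) • (ContinuousAlternatingMap.compContinuousLinearMapCLM (-J.comp J) -
    Complex.I • (ContinuousAlternatingMap.compContinuousLinearMapCLM (-J.comp J + J) -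
      ContinuousAlternatingMap.compContinuousLinearMapCLM (-J.comp J) -
      ContinuousAlternatingMap.compContinuousLinearMapCLM J) -
    ContinuousAlternatingMap.compContinuousLinearMapCLM J)

theorem projTwoZero_apply (J : V →L[ℝ] V) (θ : V [⋀^Fin 2]→L[ℝ] ℂ) (u v : V) :
    projTwoZero J θ ![u, v] = 1 / 4 * (θ ![-J (J u), -J (J v)] -
      Complex.I * (θ ![J u, -J (J v)] + θ ![-J (J u), J v]) - θ ![J u, J v]) := by
  change ((1 / 4 : ℝ) : ℂ) * (θ.compContinuousLinearMap (-J.comp J) ![u, v] -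
    Complex.I * (θ.compContinuousLinearMap (-J.comp J + J) ![u, v] -
      θ.compContinuousLinearMap (-J.comp J) ![u, v] - θ.compContinuousLinearMap J ![u, v]) -
    θ.compContinuousLinearMap J ![u, v]) = _
  simp only [compContinuousLinearMap_apply_vec2, add_apply, neg_apply,
    ContinuousLinearMap.comp_apply, twoForm_add_left, twoForm_add_right]
  push_cast
  ring

theorem continuous_polarized_combination {E Y : Type*} [NormedAddCommGroup E] [NormedSpace ℝ E]
    [NormedSpace ℂ E] [TopologicalSpace Y] {A B C : Y → E →L[ℝ] E} [SMulCommClass ℝ ℂ E]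
    (hA : Continuous A) (hB : Continuous B) (hC : Continuous C) :
    Continuous fun y => (1 / 4 : ℝ) • (A y - Complex.I • (B y - A y - C y) - C y) := by
  fun_prop

theorem continuous_projTwoZero : Continuous (projTwoZero (V := V)) := by
  have hC : Continuous fun J : V →L[ℝ] V =>
      (ContinuousAlternatingMap.compContinuousLinearMapCLM J :
        (V [⋀^Fin 2]→L[ℝ] ℂ) →L[ℝ] (V [⋀^Fin 2]→L[ℝ] ℂ)) :=
    ContinuousAlternatingMap.continuous_compContinuousLinearMapCLM
  have hP : Continuous fun J : V →L[ℝ] V => -J.comp J := (continuous_id.clm_comp continuous_id).neg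
  exact continuous_polarized_combination (hC.comp hP) (hC.comp (hP.add continuous_id)) hC

theorem projTwoZero_smul (J : V →L[ℝ] V) (a : ℂ) (θ : V [⋀^Fin 2]→L[ℝ] ℂ) :
    projTwoZero J (a • θ) = a • projTwoZero J θ := by
  refine twoForm_ext fun u v => ?_
  rw [ContinuousAlternatingMap.smul_apply, projTwoZero_apply, projTwoZero_apply]
  simp only [ContinuousAlternatingMap.smul_apply, smul_eq_mul]
  ring

theorem projTwoZero_mem {J : V →L[ℝ] V} (hJ : ∀ v, J (J (J v)) = -J v)
    (θ : V [⋀^Fin 2]→L[ℝ] ℂ) : projTwoZero J θ ∈ typeTwoZero J := by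
  intro u v
  simp only [projTwoZero_apply, hJ, neg_neg, twoForm_neg_left, twoForm_neg_right]
  linear_combination -(1 / 4 : ℂ) * (θ ![J u, J (J v)] + θ ![J (J u), J v]) * Complex.I_sq

theorem projTwoZero_of_mem {J : V →L[ℝ] V} {θ : V [⋀^Fin 2]→L[ℝ] ℂ} (h : θ ∈ typeTwoZero J) :
    projTwoZero J θ = θ := by
  refine twoForm_ext fun u v => ?_
  simp only [projTwoZero_apply, twoForm_neg_left, twoForm_neg_right,
    apply_right_of_mem_typeTwoZero h, h _ _]
  linear_combination (1 / 4 : ℂ) * θ ![u, v] * (3 * Complex.I ^ 2 - 4) * Complex.I_sq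

theorem mem_typeTwoZero_iff_projTwoZero_eq {J : V →L[ℝ] V} (hJ : ∀ v, J (J (J v)) = -J v)
    {θ : V [⋀^Fin 2]→L[ℝ] ℂ} : θ ∈ typeTwoZero J ↔ projTwoZero J θ = θ :=
  ⟨projTwoZero_of_mem, fun h => h ▸ projTwoZero_mem hJ θ⟩

theorem HasClutchingNumber.homotopy_typeTwoZero {J : S2 × unitInterval → V →L[ℝ] V}
    (hJc : Continuous J) (hJ : ∀ q v, J q (J q (J q v)) = -J q v)
    (hline : ∀ q, ∀ θ ∈ typeTwoZero (J q), θ ≠ 0 → Submodule.span ℂ {θ} = typeTwoZero (J q))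
    {c : ℤ} (h : HasClutchingNumber (fun y => typeTwoZero (J (y, 0))) c) :
    HasClutchingNumber (fun y => typeTwoZero (J (y, 1))) c :=
  HasClutchingNumber.homotopy (L := fun q => typeTwoZero (J q))
    (continuous_projTwoZero.comp hJc) (fun _ => projTwoZero_smul _)
    (fun q w => projTwoZero_of_mem (projTwoZero_mem (hJ q) w))
    (fun q _ => mem_typeTwoZero_iff_projTwoZero_eq (hJ q)) hline h

end TwoZeroProjection

/-! ### Vector bundles as summands of trivial bundles -/

section DirectSummand

variable {B F : Type*} {E : B → Type*} [TopologicalSpace B]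
  [NormedAddCommGroup F] [NormedSpace ℝ F] [TopologicalSpace (TotalSpace F E)]
  [∀ b, TopologicalSpace (E b)] [∀ b, AddCommGroup (E b)] [∀ b, Module ℝ (E b)]
  [FiberBundle F E] [VectorBundle ℝ F E]

variable (F E) in
/-- A realization of the vector bundle `E` as a direct summand of the trivial bundle with fibre
`W`. Continuity of the two bundle maps is expressed in the preferred trivialization at each
point. -/
structure SummandOfTrivial (W : Type*) [NormedAddCommGroup W] [NormedSpace ℝ W] where
  incl : ∀ b, E b →L[ℝ] W
  proj : ∀ b, W →L[ℝ] E b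
  proj_incl : ∀ b v, proj b (incl b v) = v
  continuousAt_incl : ∀ b₀, ContinuousAt
    (fun b => (incl b).comp ((trivializationAt F E b₀).symmL ℝ b)) b₀
  continuousAt_proj : ∀ b₀, ContinuousAt
    (fun b => ((trivializationAt F E b₀).continuousLinearMapAt ℝ b).comp (proj b)) b₀

theorem continuousAt_smul_coordChange {w : B → ℝ} (hw : Continuous w)
    (e e' : Trivialization F (TotalSpace.proj : TotalSpace F E → B)) [MemTrivializationAtlas e]
    [MemTrivializationAtlas e'] {b₀ : B} (he : b₀ ∈ tsupport w → b₀ ∈ e.baseSet ∩ e'.baseSet) :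
    ContinuousAt (fun b => w b • (e'.continuousLinearMapAt ℝ b).comp (e.symmL ℝ b)) b₀ := by
  by_cases hb : b₀ ∈ tsupport w
  · have hnhds : e.baseSet ∩ e'.baseSet ∈ 𝓝 b₀ :=
      (e.open_baseSet.inter e'.open_baseSet).mem_nhds (he hb)
    refine (hw.continuousAt.smul ((continuousOn_coordChange ℝ e e').continuousAt hnhds)).congr ?_
    filter_upwards [hnhds] with b hbase
    ext v
    simp [e.coordChangeL_apply e' hbase, e'.coe_linearMapAt_of_mem hbase.2, e.symmL_apply hbase.1]
  · refine (continuousAt_const (y := (0 : F →L[ℝ] F))).congr ?_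
    filter_upwards [notMem_tsupport_iff_eventuallyEq.1 hb] with b hb0
    rw [hb0, Pi.zero_apply, zero_smul]

theorem exists_sq_partitionOfUnity [CompactSpace B] [T2Space B] {U : B → Set B}
    (hU : ∀ b, U b ∈ 𝓝 b) (hopen : ∀ b, IsOpen (U b)) :
    ∃ (t : Finset B) (w : t → B → ℝ), (∀ a, Continuous (w a)) ∧ (∀ a, tsupport (w a) ⊆ U a) ∧
      ∀ b, ∑ a, w a b * w a b = 1 := by
  obtain ⟨t, -, ht⟩ := isCompact_univ.elim_nhds_subcover U fun b _ => hU b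
  obtain ⟨f, hf⟩ := PartitionOfUnity.exists_isSubordinate isClosed_univ (fun a : t => U a)
    (fun a => hopen a) (by simpa only [iUnion_subtype] using ht)
  refine ⟨t, fun a b => √(f a b), fun a => (f a).continuous.sqrt, fun a => ?_, fun b => ?_⟩
  · exact (tsupport_comp_subset Real.sqrt_zero (f a)).trans (hf a)
  · simp only [Real.mul_self_sqrt (f.nonneg _ b), ← finsum_eq_sum_of_fintype]
    exact f.sum_eq_one (mem_univ b)

variable (F E) in
theorem exists_summandOfTrivial [CompactSpace B] [T2Space B] [∀ b, IsTopologicalAddGroup (E b)]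
    [∀ b, ContinuousSMul ℝ (E b)] : ∃ t : Finset B, Nonempty (SummandOfTrivial F E (t → F)) := by
  classical
  let e := trivializationAt F E
  obtain ⟨t, w, hw, hsupp, hsum⟩ := exists_sq_partitionOfUnity
    (fun b => (e b).open_baseSet.mem_nhds (mem_baseSet_trivializationAt F E b))
    fun b => (e b).open_baseSet
  have hbase : ∀ (a : t) b, b ∈ tsupport (w a) → b ∈ (e a).baseSet ∩ (e b).baseSet :=
    fun a b hb => ⟨hsupp a hb, mem_baseSet_trivializationAt F E b⟩
  refine ⟨t, ⟨{
    incl b := ∑ a, (ContinuousLinearMap.single ℝ (fun _ => F) a).comp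
      (w a b • (e a).continuousLinearMapAt ℝ b)
    proj b := ∑ a, (w a b • (e a).symmL ℝ b).comp (ContinuousLinearMap.proj a)
    proj_incl b v := ?_
    continuousAt_incl b₀ := ?_
    continuousAt_proj b₀ := ?_ }⟩⟩
  · have hterm : ∀ a, w a b • (e a).symmL ℝ b (w a b • (e a).continuousLinearMapAt ℝ b v) =
        (w a b * w a b) • v := fun a => by
      by_cases hb : w a b = 0
      · rw [hb, zero_smul, zero_mul, zero_smul]
      · rw [map_smul, smul_smul,
          (e a).symmL_continuousLinearMapAt (hsupp a (subset_tsupport _ hb))]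
    simp only [ContinuousLinearMap.comp_apply, sum_apply, smul_apply,
      ContinuousLinearMap.proj_apply, Finset.sum_apply, ContinuousLinearMap.single_apply,
      Finset.sum_pi_single, Finset.mem_univ, if_true, hterm, ← Finset.sum_smul, hsum, one_smul]
  · simp only [ContinuousLinearMap.finsetSum_comp, ContinuousLinearMap.comp_assoc,
      ContinuousLinearMap.smul_comp]
    exact tendsto_finsetSum _ fun a _ => continuousAt_const.clm_comp
      (continuousAt_smul_coordChange (hw a) (e b₀) (e a) fun h => (hbase a b₀ h).symm)
  · simp only [ContinuousLinearMap.comp_finsetSum, ← ContinuousLinearMap.comp_assoc,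
      ContinuousLinearMap.comp_smul]
    exact tendsto_finsetSum _ fun a _ =>
      (continuousAt_smul_coordChange (hw a) (e a) (e b₀) (hbase a b₀)).clm_comp continuousAt_const

theorem continuousWithinAt_compContinuousLinearMap {Y V W : Type*} [TopologicalSpace Y]
    [NormedAddCommGroup V] [NormedSpace ℝ V] [NormedAddCommGroup W] [NormedSpace ℝ W]
    {θ : Y → V [⋀^Fin 2]→L[ℝ] ℂ} {A : Y → W →L[ℝ] V} {D : Set Y} {q₀ : Y}
    (hθ : ContinuousWithinAt θ D q₀) (hA : ContinuousWithinAt A D q₀) :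
    ContinuousWithinAt (fun q => (θ q).compContinuousLinearMap (A q)) D q₀ :=
  (ContinuousAlternatingMap.continuous_compContinuousLinearMapCLM
    |>.continuousAt.comp_continuousWithinAt hA).clm_apply hθ

namespace SummandOfTrivial

variable {W : Type*} [NormedAddCommGroup W] [NormedSpace ℝ W] (S : SummandOfTrivial F E W)
  {Y : Type*} [TopologicalSpace Y] {f : Y → B} {q₀ : Y}

/-- The extension of an endomorphism of a fibre of `E` to the trivial bundle, by zero on the
complementary summand. -/
noncomputable def extendEnd (b : B) (A : E b →L[ℝ] E b) : W →L[ℝ] W :=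
  (S.incl b).comp (A.comp (S.proj b))

theorem extendEnd_incl (b : B) (A : E b →L[ℝ] E b) (v : E b) :
    S.extendEnd b A (S.incl b v) = S.incl b (A v) :=
  congrArg (fun u => S.incl b (A u)) (S.proj_incl b v)

theorem extendEnd_pow_three {b : B} {A : E b →L[ℝ] E b} (hA : ∀ v, A (A v) = -v) (w : W) :
    S.extendEnd b A (S.extendEnd b A (S.extendEnd b A w)) = -S.extendEnd b A w := by
  change S.extendEnd b A (S.extendEnd b A (S.incl b (A (S.proj b w)))) = -S.incl b (A (S.proj b w))
  rw [extendEnd_incl, extendEnd_incl, hA, map_neg]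

theorem tendsto_extendEnd {ι : Type*} {l : Filter ι} {f : ι → B} {b : B}
    (hf : Filter.Tendsto f l (𝓝 b)) {A : ∀ i, E (f i) →L[ℝ] E (f i)} {A₀ : E b →L[ℝ] E b}
    (hA : Filter.Tendsto (fun i => ((trivializationAt F E b).continuousLinearMapAt ℝ (f i)).comp
      ((A i).comp ((trivializationAt F E b).symmL ℝ (f i)))) l
      (𝓝 (((trivializationAt F E b).continuousLinearMapAt ℝ b).comp
        (A₀.comp ((trivializationAt F E b).symmL ℝ b))))) :
    Filter.Tendsto (fun i => S.extendEnd (f i) (A i)) l (𝓝 (S.extendEnd b A₀)) := by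
  have hcomp : ∀ {x : B} (T : E x →L[ℝ] E x), x ∈ (trivializationAt F E b).baseSet →
      ((S.incl x).comp ((trivializationAt F E b).symmL ℝ x)).comp
        ((((trivializationAt F E b).continuousLinearMapAt ℝ x).comp
          (T.comp ((trivializationAt F E b).symmL ℝ x))).comp
          (((trivializationAt F E b).continuousLinearMapAt ℝ x).comp (S.proj x))) =
      S.extendEnd x T := fun T hx => by
    ext v
    simp only [extendEnd, ContinuousLinearMap.comp_apply,
      Trivialization.symmL_continuousLinearMapAt _ hx]
  have hmul : Continuous fun q : (F →L[ℝ] W) × (F →L[ℝ] F) × (W →L[ℝ] F) =>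
      q.1.comp (q.2.1.comp q.2.2) := by fun_prop
  rw [← hcomp A₀ (mem_baseSet_trivializationAt F E b)]
  refine ((hmul.tendsto _).comp (((S.continuousAt_incl b).tendsto.comp hf).prodMk_nhds
    (hA.prodMk_nhds ((S.continuousAt_proj b).tendsto.comp hf)))).congr' ?_
  filter_upwards [hf.eventually_mem ((trivializationAt F E b).open_baseSet.mem_nhds
    (mem_baseSet_trivializationAt F E b))] with i hi
  exact hcomp (A i) hi

/-- The extension of a complex 2-form on a fibre of `E` to the trivial bundle, by zero on the
complementary summand. -/
noncomputable def extendForm (b : B) :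
    (E b [⋀^Fin 2]→L[ℝ] Bundle.Trivial B ℂ b) →ₗ[ℂ] (W [⋀^Fin 2]→L[ℝ] ℂ) where
  toFun θ := θ.compContinuousLinearMap (S.proj b)
  map_add' _ _ := rfl
  map_smul' _ _ := rfl

theorem extendForm_apply (b : B) (θ : E b [⋀^Fin 2]→L[ℝ] Bundle.Trivial B ℂ b) (u v : W) :
    S.extendForm b θ ![u, v] = θ ![S.proj b u, S.proj b v] :=
  compContinuousLinearMap_apply_vec2 θ (S.proj b) u v

theorem extendForm_injective (b : B) : Function.Injective (S.extendForm b) := fun θ η h =>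
  twoForm_ext fun u v => by
    rw [← S.proj_incl b u, ← S.proj_incl b v, ← extendForm_apply, ← extendForm_apply, h]

theorem continuousWithinAt_extendForm_iff {D : Set Y}
    {s : ∀ q, E (f q) [⋀^Fin 2]→L[ℝ] Bundle.Trivial B ℂ (f q)} (hf : ContinuousWithinAt f D q₀) :
    ContinuousWithinAt (fun q => S.extendForm (f q) (s q)) D q₀ ↔
      ContinuousWithinAt (fun q => (⟨f q, s q⟩ : TotalSpace (F [⋀^Fin 2]→L[ℝ] ℂ)
        fun b => E b [⋀^Fin 2]→L[ℝ] Bundle.Trivial B ℂ b)) D q₀ := by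
  rw [continuousWithinAt_continuousAlternatingMap_bundle, and_iff_right hf]
  let e := trivializationAt F E (f q₀)
  let θ : Y → F [⋀^Fin 2]→L[ℝ] ℂ := fun q => ContinuousAlternatingMap.inCoordinates F ℂ
    (f q₀) (f q) (f q₀) (f q) (s q)
  have hθ : ∀ q u v, θ q ![u, v] = s q ![e.symmL ℝ (f q) u, e.symmL ℝ (f q) v] := fun q u v => by
    simp only [θ, ContinuousAlternatingMap.inCoordinates, compContinuousLinearMap_apply_vec2]
    simp [e]
  change _ ↔ ContinuousWithinAt θ D q₀
  have hmem : f q₀ ∈ e.baseSet := mem_baseSet_trivializationAt F E (f q₀)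
  constructor <;> intro h
  · refine (continuousWithinAt_compContinuousLinearMap h
      ((S.continuousAt_incl (f q₀)).comp_continuousWithinAt hf)).congr (fun q _ => ?_) ?_ <;>
    exact twoForm_ext fun u v => by
      simp only [hθ, compContinuousLinearMap_apply_vec2, extendForm_apply, Function.comp_apply,
        ContinuousLinearMap.comp_apply, S.proj_incl, e]
  · have hchart : ∀ q, f q ∈ e.baseSet → S.extendForm (f q) (s q) = (θ q).compContinuousLinearMap
        ((e.continuousLinearMapAt ℝ (f q)).comp (S.proj (f q))) := fun q hq =>
      twoForm_ext fun u v => by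
        simp only [hθ, compContinuousLinearMap_apply_vec2, extendForm_apply,
          ContinuousLinearMap.comp_apply, e.symmL_continuousLinearMapAt hq]
    exact (continuousWithinAt_compContinuousLinearMap h
      ((S.continuousAt_proj (f q₀)).comp_continuousWithinAt hf)).congr_of_eventuallyEq
      ((hf.eventually_mem (e.open_baseSet.mem_nhds hmem)).mono hchart) (hchart q₀ hmem)

end SummandOfTrivial

end DirectSummand

section CanonicalBundle

variable {X : Type*} [TopologicalSpace X] [ChartedSpace E4 X] [IsManifold (𝓡 4) ∞ X]
  {g : Metric4 X} {Ω : TwoForm X} {W : Type*} [NormedAddCommGroup W] [NormedSpace ℝ W]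

omit [IsManifold (𝓡 4) ∞ X] in
theorem finrank_tangentSpace (x : X) : Module.finrank ℝ (TangentSpace (𝓡 4) x) = 4 :=
  (finrank_euclideanSpace_fin : Module.finrank ℝ E4 = 4)

theorem canonicalBundle_eq_typeTwoZero {x : X} (hJ : ∀ v, acs g Ω x (acs g Ω x v) = -v) :
    canonicalBundle g Ω x = typeTwoZero (acs g Ω x) :=
  span_wedge_eq_typeTwoZero (finrank_tangentSpace x) (J := (acs g Ω x).toLinearMap) hJ

variable (S : SummandOfTrivial E4 (TangentSpace (𝓡 4) : X → Type _) W)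

theorem span_eq_typeTwoZero_extendEnd {x : X}
    {J : TangentSpace (𝓡 4) x →L[ℝ] TangentSpace (𝓡 4) x} (hJ : ∀ v, J (J v) = -v)
    {θ : W [⋀^Fin 2]→L[ℝ] ℂ} (hθ : θ ∈ typeTwoZero (S.extendEnd x J)) (h0 : θ ≠ 0) :
    Submodule.span ℂ {θ} = typeTwoZero (S.extendEnd x J) :=
  span_eq_typeTwoZero_of_summand (finrank_tangentSpace x) (S.proj_incl x) (J := J.toLinearMap) hJ
    hθ h0

theorem extendForm_mem_typeTwoZero_iff {x : X}
    {J : TangentSpace (𝓡 4) x →L[ℝ] TangentSpace (𝓡 4) x}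
    {θ : TangentSpace (𝓡 4) x [⋀^Fin 2]→L[ℝ] Bundle.Trivial X ℂ x} :
    S.extendForm x θ ∈ typeTwoZero (S.extendEnd x J) ↔
      θ ∈ typeTwoZero (T := TangentSpace (𝓡 4) x) J := by
  refine ⟨fun h u v => ?_, comp_mem_typeTwoZero fun v => S.proj_incl x _⟩
  have huv := h (S.incl x u) (S.incl x v)
  rwa [S.extendForm_apply, S.extendForm_apply, S.extendEnd_incl, S.proj_incl, S.proj_incl,
    S.proj_incl] at huv

variable {f : S2 → X}

theorem isFrameOn_canonicalBundle_iff (hf : Continuous f)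
    (hJ : ∀ y v, acs g Ω (f y) (acs g Ω (f y) v) = -v) {D : Set S2}
    {s : ∀ y, TangentSpace (𝓡 4) (f y) [⋀^Fin 2]→L[ℝ] Bundle.Trivial X ℂ (f y)} :
    IsFrameOn ComplexForms f (canonicalBundle g Ω) D s ↔
      IsLineFrame (fun y => typeTwoZero (S.extendEnd (f y) (acs g Ω (f y)))) D
        fun y => S.extendForm (f y) (s y) := by
  have hcont : ∀ y, ContinuousWithinAt (fun y => S.extendForm (f y) (s y)) D y ↔
      ContinuousWithinAt (fun y => (⟨f y, s y⟩ : TotalSpace ComplexForms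
        fun x : X => TangentSpace (𝓡 4) x [⋀^Fin 2]→L[ℝ] Bundle.Trivial X ℂ x)) D y :=
    fun y => S.continuousWithinAt_extendForm_iff hf.continuousWithinAt
  have hzero : ∀ y, S.extendForm (f y) (s y) = 0 ↔ s y = 0 := fun y =>
    map_eq_zero_iff _ (S.extendForm_injective (f y))
  refine ⟨fun h => ⟨fun y hy => (hcont y).2 (h.continuousOn y hy),
      fun y hy => (hzero y).not.2 (h.ne_zero y hy), fun y hy => ?_⟩,
    fun h => ⟨fun y hy => (hcont y).1 (h.continuousOn y hy),
      fun y hy => (hzero y).not.1 (h.ne_zero y hy), fun y hy => ?_⟩⟩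
  · have hmem : s y ∈ typeTwoZero (T := TangentSpace (𝓡 4) (f y)) (acs g Ω (f y)) := by
      rw [← canonicalBundle_eq_typeTwoZero (hJ y), ← h.span_eq y hy]
      exact Submodule.mem_span_singleton_self _
    exact span_eq_typeTwoZero_extendEnd S (hJ y)
      ((extendForm_mem_typeTwoZero_iff S).2 hmem) ((hzero y).not.2 (h.ne_zero y hy))
  · rw [canonicalBundle_eq_typeTwoZero (hJ y)]
    exact span_eq_typeTwoZero (finrank_tangentSpace (f y)) (J := (acs g Ω (f y)).toLinearMap) (hJ y)
      ((extendForm_mem_typeTwoZero_iff S).1 (h.mem hy)) ((hzero y).not.1 (h.ne_zero y hy))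

theorem hasFirstChernNumber_of_hasClutchingNumber (hf : Continuous f)
    (hJ : ∀ y v, acs g Ω (f y) (acs g Ω (f y) v) = -v) {c : ℤ}
    (h : HasClutchingNumber
      (fun y => typeTwoZero (S.extendEnd (f y) (acs g Ω (f y)))) c) :
    HasFirstChernNumber ComplexForms f (canonicalBundle g Ω) c := by
  have hrestrict : ∀ {D : Set S2} {s : S2 → W [⋀^Fin 2]→L[ℝ] ℂ}, IsLineFrame (fun y =>
      typeTwoZero (S.extendEnd (f y) (acs g Ω (f y)))) D s →
      IsFrameOn ComplexForms f (canonicalBundle g Ω) D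
        fun y => (s y).compContinuousLinearMap (S.incl (f y)) := fun hs =>
    (isFrameOn_canonicalBundle_iff S hf hJ).2 <| hs.congr fun y hy =>
      comp_comp_of_mem_typeTwoZero (J := (acs g Ω (f y)).toLinearMap) (S.proj_incl (f y))
        (hs.mem hy)
  refine ⟨?_, fun sp sm hp hm => ?_⟩
  · obtain ⟨sp, sm, hp, hm, -⟩ := h
    exact ⟨_, _, hrestrict hp, hrestrict hm⟩
  · obtain ⟨k, hk, he, hc⟩ := h.hasWindingNumber
      ((isFrameOn_canonicalBundle_iff S hf hJ).1 hp) ((isFrameOn_canonicalBundle_iff S hf hJ).1 hm)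
    exact ⟨k, hk, fun t ht => S.extendForm_injective _ ((he t ht).trans (map_smul _ _ _).symm), hc⟩

theorem not_isTrivialLineBundle_of_hasClutchingNumber (hf : Continuous f)
    (hJ : ∀ y v, acs g Ω (f y) (acs g Ω (f y) v) = -v) {c : ℤ} (hc : c ≠ 0)
    (h : HasClutchingNumber
      (fun y => typeTwoZero (S.extendEnd (f y) (acs g Ω (f y)))) c) :
    ¬ IsTrivialLineBundle ComplexForms f (canonicalBundle g Ω) := by
  rintro ⟨s, hs⟩
  have hframe := (isFrameOn_canonicalBundle_iff S hf hJ).1 hs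
  exact hc <| (h.hasWindingNumber (hframe.mono (subset_univ _)) (hframe.mono (subset_univ _)))
    |>.eq_zero_of_self fun t => hframe.ne_zero _ trivial

end CanonicalBundle

/-! ### The linear model on `ℝ⁴` -/

section MatrixPaths

open Matrix

variable {ι : Type*} [Fintype ι] [DecidableEq ι]

theorem diag2n_eq_transvection_prod {F : Type*} [Field F] {i j : ι} (hij : i ≠ j) {c : F}
    (hc : c ≠ 0) : SpecialLinearGroup.diag2n hij c hc =
      .transvection hij c * .transvection hij.symm (-c⁻¹) * .transvection hij c *
        (.transvection hij (-1) * .transvection hij.symm 1 * .transvection hij (-1)) := by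
  refine Subtype.ext ?_
  change Matrix.diagonal _ = (1 + single i j c) * (1 + single j i (-c⁻¹)) * (1 + single i j c) *
    ((1 + single i j (-1)) * (1 + single j i (1 : F)) * (1 + single i j (-1)))
  simp only [mul_add, add_mul, mul_one, one_mul, add_zero, single_mul_single_same,
    single_mul_single_of_ne _ _ _ _ hij, single_mul_single_of_ne _ _ _ _ hij.symm]
  ext a b
  simp only [Matrix.add_apply, diagonal_apply, one_apply, single_apply]
  grind

theorem joinedIn_det_eq_one [Nontrivial ι] (A : SpecialLinearGroup ι ℝ) :
    JoinedIn {M : Matrix ι ι ℝ | M.det = 1} A 1 := by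
  have hmul : ∀ A B : SpecialLinearGroup ι ℝ, JoinedIn {M : Matrix ι ι ℝ | M.det = 1} A 1 →
      JoinedIn {M : Matrix ι ι ℝ | M.det = 1} B 1 →
      JoinedIn {M : Matrix ι ι ℝ | M.det = 1} ↑(A * B) 1 := fun A B hA hB => by
    have h := hA.mul hB
    rw [mul_one] at h
    exact h.mono (mul_subset_iff.2 fun M (hM : M.det = 1) N (hN : N.det = 1) =>
      (det_mul M N).trans (by rw [hM, hN, one_mul]))
  have htrans : ∀ (i j : ι) (hij : i ≠ j) (c : ℝ),
      JoinedIn {M : Matrix ι ι ℝ | M.det = 1} (SpecialLinearGroup.transvection hij c) 1 :=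
    fun i j hij c => by
      refine JoinedIn.ofLine (f := fun s => Matrix.transvection i j ((1 - s) * c)) ?_ ?_ ?_ ?_
      · refine (continuous_const.add
          (continuous_matrix fun a b => ?_)).continuousOn
        simp only [single_apply]
        split_ifs <;> fun_prop
      · simp [SpecialLinearGroup.transvection]
      · simp
      · rintro _ ⟨s, -, rfl⟩
        exact det_transvection_of_ne _ _ hij _
  refine SpecialLinearGroup.diagonal_transvection_induction' _ A (fun i j hij c hc => ?_) htrans
    hmul
  rw [diag2n_eq_transvection_prod]
  exact hmul _ _ (hmul _ _ (hmul _ _ (htrans _ _ _ _) (htrans _ _ _ _)) (htrans _ _ _ _))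
    (hmul _ _ (hmul _ _ (htrans _ _ _ _) (htrans _ _ _ _)) (htrans _ _ _ _))

theorem joinedIn_det_pos [Nontrivial ι] {M : Matrix ι ι ℝ} (hM : 0 < M.det) :
    JoinedIn {M : Matrix ι ι ℝ | 0 < M.det} M 1 := by
  let c := M.det ^ (Fintype.card ι : ℝ)⁻¹
  have hc : 0 < c := Real.rpow_pos_of_pos hM _
  have hcn : c ^ Fintype.card ι = M.det := Real.rpow_inv_natCast_pow hM.le Fintype.card_ne_zero
  have hdet : (c⁻¹ • M).det = 1 := by
    rw [det_smul, inv_pow, hcn, inv_mul_cancel₀ hM.ne']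
  have hscale : JoinedIn (Ioi (0 : ℝ)) c 1 :=
    ((convex_Ioi 0).isPathConnected ⟨c, hc⟩).joinedIn c hc 1 (one_pos : (0 : ℝ) < 1)
  have hcont : Continuous fun a : ℝ => a • (1 : Matrix ι ι ℝ) := by fun_prop
  have h := (joinedIn_det_eq_one ⟨_, hdet⟩).map (continuous_const_smul c)
  rw [smul_inv_smul₀ hc.ne'] at h
  refine (h.mono ?_).trans (((one_smul ℝ (1 : Matrix ι ι ℝ)) ▸ hscale.map hcont).mono ?_)
  · rintro _ ⟨N, hN : N.det = 1, rfl⟩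
    simp [hN, hcn, hM]
  · rintro _ ⟨a, ha : 0 < a, rfl⟩
    simp [ha]

theorem joinedIn_det_neg [Nontrivial ι] (hodd : Odd (Fintype.card ι)) {M : Matrix ι ι ℝ}
    (hM : M.det < 0) : JoinedIn {M : Matrix ι ι ℝ | M.det < 0} M (-1) := by
  have hneg : ∀ M : Matrix ι ι ℝ, (-M).det = -M.det := fun M => by
    rw [det_neg, hodd.neg_one_pow, neg_one_mul]
  have h := (joinedIn_det_pos (M := -M) (by rw [hneg]; linarith)).map continuous_neg
  rw [neg_neg] at h
  refine h.mono ?_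
  rintro _ ⟨N, hN : 0 < N.det, rfl⟩
  exact (hneg N).trans_lt (neg_lt_zero.2 hN)

end MatrixPaths

section LinearModel

/-- The endomorphism `w₀ I + w₁ J + w₂ K` of `ℝ⁴`, where `I, J, K` belong to the self-dual forms
`e⁰ ∧ e¹ + e² ∧ e³`, `e⁰ ∧ e² - e¹ ∧ e³`, `e⁰ ∧ e³ + e¹ ∧ e²`: the multiplication by an imaginary
quaternion. -/
noncomputable def quat : (Fin 3 → ℝ) →ₗ[ℝ] E4 →L[ℝ] E4 where
  toFun w := LinearMap.toContinuousLinearMap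
    { toFun := fun v => !₂[-(w 0 * v 1) - w 1 * v 2 - w 2 * v 3,
        w 0 * v 0 - w 2 * v 2 + w 1 * v 3, w 1 * v 0 + w 2 * v 1 - w 0 * v 3,
        w 2 * v 0 - w 1 * v 1 + w 0 * v 2]
      map_add' := fun u v => by
        ext i; fin_cases i <;> simp <;> ring
      map_smul' := fun a v => by
        ext i; fin_cases i <;> simp <;> ring }
  map_add' u v := by
    ext x i; fin_cases i <;> simp <;> ring
  map_smul' a v := by
    ext x i; fin_cases i <;> simp <;> ring

theorem quat_apply (w : Fin 3 → ℝ) (v : E4) :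
    quat w v = !₂[-(w 0 * v 1) - w 1 * v 2 - w 2 * v 3,
        w 0 * v 0 - w 2 * v 2 + w 1 * v 3, w 1 * v 0 + w 2 * v 1 - w 0 * v 3,
        w 2 * v 0 - w 1 * v 1 + w 0 * v 2] := rfl

theorem quat_quat (w : Fin 3 → ℝ) (v : E4) :
    quat w (quat w v) = -(w 0 ^ 2 + w 1 ^ 2 + w 2 ^ 2) • v := by
  ext i
  fin_cases i <;> simp [quat_apply] <;> ring

/-- The normalization of `quat w`, a complex structure on `ℝ⁴` if `w ≠ 0`. -/
noncomputable def unitQuat (w : Fin 3 → ℝ) : E4 →L[ℝ] E4 :=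
  (√(w 0 ^ 2 + w 1 ^ 2 + w 2 ^ 2))⁻¹ • quat w

theorem sum_sq_pos {w : Fin 3 → ℝ} (hw : w ≠ 0) : 0 < w 0 ^ 2 + w 1 ^ 2 + w 2 ^ 2 := by
  have h : 0 < ∑ i, w i ^ 2 := by
    obtain ⟨i, hi⟩ := Function.ne_iff.1 hw
    exact Finset.sum_pos' (fun i _ => sq_nonneg _) ⟨i, Finset.mem_univ i, sq_pos_of_ne_zero hi⟩
  rwa [Fin.sum_univ_three] at h

theorem unitQuat_unitQuat {w : Fin 3 → ℝ} (hw : w ≠ 0) (v : E4) :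
    unitQuat w (unitQuat w v) = -v := by
  have h := (sum_sq_pos hw).ne'
  rw [unitQuat, smul_apply, smul_apply, map_smul,
    quat_quat, smul_smul, smul_smul, ← mul_inv, Real.mul_self_sqrt (sum_sq_pos hw).le, mul_neg,
    inv_mul_cancel₀ h, neg_one_smul]

theorem continuousOn_unitQuat : ContinuousOn unitQuat {w | w ≠ 0} := by
  have h : Continuous fun w : Fin 3 → ℝ => √(w 0 ^ 2 + w 1 ^ 2 + w 2 ^ 2) := by fun_prop
  exact (h.continuousOn.inv₀ fun w hw => (Real.sqrt_pos.2 (sum_sq_pos hw)).ne').smul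
    quat.continuous_of_finiteDimensional.continuousOn

theorem unitQuat_neg_sphere (y : S2) : unitQuat (-y.1.ofLp) = quat (-y.1.ofLp) := by
  simp [unitQuat, sum_sq_eq_one y]

/-- The complex 1-form `eⁱ` on `ℝ⁴`. -/
noncomputable def coordForm (i : Fin 4) : E4 →L[ℝ] ℂ :=
  Complex.ofRealCLM.comp (EuclideanSpace.proj i)

/-- The complex self-dual 2-form on `ℝ⁴` with coefficients `a` in the basis
`e⁰ ∧ e¹ + e² ∧ e³`, `e⁰ ∧ e² - e¹ ∧ e³`, `e⁰ ∧ e³ + e¹ ∧ e²`. -/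
noncomputable def sdForm (a : Fin 3 → ℂ) : ComplexForms :=
  a 0 • (wedge (coordForm 0) (coordForm 1) + wedge (coordForm 2) (coordForm 3)) +
  a 1 • (wedge (coordForm 0) (coordForm 2) - wedge (coordForm 1) (coordForm 3)) +
  a 2 • (wedge (coordForm 0) (coordForm 3) + wedge (coordForm 1) (coordForm 2))

theorem continuous_sdForm : Continuous sdForm := by
  unfold sdForm
  fun_prop

theorem sdForm_apply (a : Fin 3 → ℂ) (u v : E4) :
    sdForm a ![u, v] = a 0 * (u 0 * v 1 - v 0 * u 1 + (u 2 * v 3 - v 2 * u 3)) +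
      a 1 * (u 0 * v 2 - v 0 * u 2 - (u 1 * v 3 - v 1 * u 3)) +
      a 2 * (u 0 * v 3 - v 0 * u 3 + (u 1 * v 2 - v 1 * u 2)) := by
  simp [sdForm, wedge_apply, coordForm]
  ring

theorem sdForm_smul (c : ℂ) (a : Fin 3 → ℂ) : sdForm (c • a) = c • sdForm a := by
  simp only [sdForm, Pi.smul_apply, smul_add, smul_assoc]

theorem sdForm_ne_zero {a : Fin 3 → ℂ} (ha : a ≠ 0) : sdForm a ≠ 0 := by
  intro h
  refine ha (funext fun i => ?_)
  have hi : sdForm a ![EuclideanSpace.single 0 1, EuclideanSpace.single i.succ 1] = 0 := by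
    rw [h]; rfl
  rw [sdForm_apply] at hi
  fin_cases i <;> simpa using hi

/-- The equations say that `a ∈ ℂ³` is an eigenvector of the cross product with `w`; the first one
follows from the others. -/
theorem sdForm_mem_typeTwoZero {a : Fin 3 → ℂ} {w : Fin 3 → ℝ}
    (h : a 0 * w 0 + a 1 * w 1 + a 2 * w 2 = 0)
    (h0 : a 1 * w 2 - a 2 * w 1 = Complex.I * a 0)
    (h1 : a 2 * w 0 - a 0 * w 2 = Complex.I * a 1)
    (h2 : a 0 * w 1 - a 1 * w 0 = Complex.I * a 2) :
    sdForm a ∈ typeTwoZero (quat w) := by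
  intro u v
  rw [sdForm_apply, sdForm_apply, quat_apply]
  simp
  linear_combination -(u 0 * v 0 + u 1 * v 1 + u 2 * v 2 + u 3 * v 3 : ℂ) * h +
    (u 0 * v 1 - v 0 * u 1 + (u 2 * v 3 - v 2 * u 3) : ℂ) * h0 +
    (u 0 * v 2 - v 0 * u 2 - (u 1 * v 3 - v 1 * u 3) : ℂ) * h1 +
    (u 0 * v 3 - v 0 * u 3 + (u 1 * v 2 - v 1 * u 2) : ℂ) * h2

/-- The coefficients of a form of type `(2,0)` for the complex structure `-y`, without zeros over
the northern hemisphere. -/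
noncomputable def northCoeff (y : S2) : Fin 3 → ℂ :=
  let z : ℂ := y.1 0 - Complex.I * y.1 1
  let d : ℂ := 1 + y.1 2
  ![d ^ 2 - z ^ 2, -(Complex.I * (d ^ 2 + z ^ 2)), -(2 * d * z)]

/-- The coefficients of a form of type `(2,0)` for the complex structure `-y`, without zeros over
the southern hemisphere. -/
noncomputable def southCoeff (y : S2) : Fin 3 → ℂ :=
  let z : ℂ := y.1 0 + Complex.I * y.1 1
  let d : ℂ := 1 - y.1 2
  ![z ^ 2 - d ^ 2, -(Complex.I * (z ^ 2 + d ^ 2)), -(2 * d * z)]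

theorem continuous_northCoeff : Continuous northCoeff := by
  refine continuous_pi fun i => ?_
  fin_cases i <;> { dsimp [northCoeff]; fun_prop }

theorem continuous_southCoeff : Continuous southCoeff := by
  refine continuous_pi fun i => ?_
  fin_cases i <;> { dsimp [southCoeff]; fun_prop }

theorem ofReal_sum_sq_eq_one (y : S2) :
    (y.1 0 : ℂ) ^ 2 + (y.1 1 : ℂ) ^ 2 + (y.1 2 : ℂ) ^ 2 = 1 := by
  simpa using congrArg Complex.ofReal (sum_sq_eq_one y)

theorem northCoeff_mem (y : S2) : sdForm (northCoeff y) ∈ typeTwoZero (quat (-y.1.ofLp)) := by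
  have hs := ofReal_sum_sq_eq_one y
  have hI := Complex.I_sq
  refine sdForm_mem_typeTwoZero ?_ ?_ ?_ ?_ <;> simp [northCoeff] <;> grind

theorem southCoeff_mem (y : S2) : sdForm (southCoeff y) ∈ typeTwoZero (quat (-y.1.ofLp)) := by
  have hs := ofReal_sum_sq_eq_one y
  have hI := Complex.I_sq
  refine sdForm_mem_typeTwoZero ?_ ?_ ?_ ?_ <;> simp [southCoeff] <;> grind

theorem northCoeff_ne_zero {y : S2} (hy : y ∈ northHemisphere) : northCoeff y ≠ 0 := fun h => by
  have h0 := congrFun h 0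
  have h1 := congrFun h 1
  have hd : (1 : ℂ) + y.1 2 = 0 := by
    simp [northCoeff] at h0 h1
    grind
  have hd' : 1 + y.1 2 = 0 := Complex.ofReal_injective (by push_cast; exact hd)
  linarith [show 0 ≤ y.1 2 from hy]

theorem southCoeff_ne_zero {y : S2} (hy : y ∈ southHemisphere) : southCoeff y ≠ 0 := fun h => by
  have h0 := congrFun h 0
  have h1 := congrFun h 1
  have hd : (1 : ℂ) - y.1 2 = 0 := by
    simp [southCoeff] at h0 h1
    grind
  have hd' : 1 - y.1 2 = 0 := Complex.ofReal_injective (by push_cast; exact hd)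
  linarith [show y.1 2 ≤ 0 from hy]

theorem southCoeff_equator (t : ℝ) : southCoeff (equator t) =
    Complex.exp (2 * (t * Complex.I)) • northCoeff (equator t) := by
  have he : Complex.exp (2 * (t * Complex.I)) =
      (Complex.cos t + Complex.sin t * Complex.I) ^ 2 := by
    rw [← Complex.exp_mul_I, ← Complex.exp_nat_mul, Nat.cast_ofNat]
  have hcs := Complex.sin_sq_add_cos_sq (t : ℂ)
  have hI := Complex.I_sq
  rw [he]
  ext i
  fin_cases i <;> simp [northCoeff, southCoeff, equator] <;> grind

theorem coe_sphere_ne_zero (y : S2) : y.1.ofLp ≠ 0 := fun h => by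
  have hy := sum_sq_eq_one y
  simp [h] at hy

theorem span_eq_typeTwoZero_unitQuat {w : Fin 3 → ℝ} (hw : w ≠ 0) {θ : ComplexForms}
    (hθ : θ ∈ typeTwoZero (unitQuat w)) (h0 : θ ≠ 0) :
    Submodule.span ℂ {θ} = typeTwoZero (unitQuat w) :=
  span_eq_typeTwoZero finrank_euclideanSpace_fin (J := (unitQuat w).toLinearMap)
    (unitQuat_unitQuat hw) hθ h0

theorem hasClutchingNumber_unitQuat_neg :
    HasClutchingNumber (fun y : S2 => typeTwoZero (unitQuat (-y.1.ofLp))) 2 := by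
  have hframe : ∀ {a : S2 → Fin 3 → ℂ} {A : Set S2}, Continuous a →
      (∀ y, sdForm (a y) ∈ typeTwoZero (quat (-y.1.ofLp))) → (∀ y ∈ A, a y ≠ 0) →
      IsLineFrame (fun y : S2 => typeTwoZero (unitQuat (-y.1.ofLp))) A fun y => sdForm (a y) :=
    fun ha hmem h0 => ⟨(continuous_sdForm.comp ha).continuousOn,
      fun y hy => sdForm_ne_zero (h0 y hy), fun y hy =>
        span_eq_typeTwoZero_unitQuat (neg_ne_zero.2 (coe_sphere_ne_zero y))
          (unitQuat_neg_sphere y ▸ hmem y) (sdForm_ne_zero (h0 y hy))⟩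
  refine ⟨_, _, hframe continuous_northCoeff northCoeff_mem fun y => northCoeff_ne_zero,
    hframe continuous_southCoeff southCoeff_mem fun y => southCoeff_ne_zero,
    fun t => 2 * (t * Complex.I), by fun_prop, fun t _ => ?_, ?_⟩
  · rw [← sdForm_smul, ← southCoeff_equator]
  · push_cast
    ring

theorem hasClutchingNumber_unitQuat_mulVec {M : Matrix (Fin 3) (Fin 3) ℝ} (hM : M.det < 0) :
    HasClutchingNumber (fun y : S2 => typeTwoZero (unitQuat (M.mulVec y.1.ofLp))) 2 := by
  obtain ⟨γ, hγ⟩ := (joinedIn_det_neg (by decide) hM).symm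
  have hne : ∀ q : S2 × unitInterval, (γ q.2).mulVec q.1.1.ofLp ≠ 0 := fun q h =>
    (hγ q.2).ne (Matrix.exists_mulVec_eq_zero_iff.1 ⟨_, coe_sphere_ne_zero q.1, h⟩)
  have hcont : Continuous fun q : S2 × unitInterval => unitQuat ((γ q.2).mulVec q.1.1.ofLp) :=
    continuousOn_unitQuat.comp_continuous
      (Continuous.matrix_mulVec (γ.continuous.comp continuous_snd) (by fun_prop)) hne
  simpa only [γ.target] using HasClutchingNumber.homotopy_typeTwoZero hcont
    (fun q v => unitQuat_unitQuat (hne q) _)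
    (fun q _ => span_eq_typeTwoZero_unitQuat (hne q))
    (by simpa only [γ.source, Matrix.neg_mulVec, Matrix.one_mulVec] using
      hasClutchingNumber_unitQuat_neg)

end LinearModel

section Normalization

/-- The trace of the square of an endomorphism of `ℝ⁴`. -/
noncomputable def trSq (R : E4 →L[ℝ] E4) : ℝ :=
  LinearMap.trace ℝ E4 (R.toLinearMap ∘ₗ R.toLinearMap)

/-- The multiple `√2 R / |R|` of `R`, where `|R|² = -(1/2) tr R²`. It is the almost complex
structure of a 2-form `α` if `R` is the expression of `g⁻¹α` in a frame. -/
noncomputable def normalized (R : E4 →L[ℝ] E4) : E4 →L[ℝ] E4 :=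
  (√2 / √(-(1 / 2) * trSq R)) • R

theorem continuous_trSq : Continuous trSq := by
  let τ : (E4 →L[ℝ] E4) →ₗ[ℝ] ℝ :=
    LinearMap.trace ℝ E4 ∘ₗ (LinearMap.toContinuousLinearMap.symm.toLinearMap :
      (E4 →L[ℝ] E4) →ₗ[ℝ] E4 →ₗ[ℝ] E4)
  exact τ.continuous_of_finiteDimensional.comp
    (g := τ) (f := fun R : E4 →L[ℝ] E4 => R.comp R) (by fun_prop)

theorem continuousAt_normalized {R : E4 →L[ℝ] E4} (hR : trSq R < 0) :
    ContinuousAt normalized R := by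
  have h : ContinuousAt (fun R => √(-(1 / 2) * trSq R)) R :=
    (continuous_trSq.continuousAt.const_mul _).sqrt
  exact (continuousAt_const.div₀ h (Real.sqrt_pos.2 (by linarith)).ne').smul continuousAt_id

theorem trSq_quat (w : Fin 3 → ℝ) : trSq (quat w) = -4 * (w 0 ^ 2 + w 1 ^ 2 + w 2 ^ 2) := by
  have h : (quat w).toLinearMap ∘ₗ (quat w).toLinearMap =
      (-(w 0 ^ 2 + w 1 ^ 2 + w 2 ^ 2)) • LinearMap.id :=
    LinearMap.ext (quat_quat w)
  rw [trSq, h, map_smul, LinearMap.trace_id, finrank_euclideanSpace_fin, smul_eq_mul]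
  push_cast
  ring

theorem normalized_quat (w : Fin 3 → ℝ) : normalized (quat w) = unitQuat w := by
  have h : -(1 / 2) * (-4 * (w 0 ^ 2 + w 1 ^ 2 + w 2 ^ 2)) =
    2 * (w 0 ^ 2 + w 1 ^ 2 + w 2 ^ 2) := by ring
  rw [normalized, unitQuat, trSq_quat, h, Real.sqrt_mul zero_le_two, div_mul_eq_div_div,
    div_self (by simp), one_div]

end Normalization

section Pointwise

variable {X : Type*} [TopologicalSpace X] [ChartedSpace E4 X] [IsManifold (𝓡 4) ∞ X]
  {g : Metric4 X} {o : Orientation4 X} {x : X}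
  {α β : TangentSpace (𝓡 4) x [⋀^Fin 2]→L[ℝ] ℝ}

theorem ext_inner {u v : TangentSpace (𝓡 4) x} (h : ∀ w, g.inner x u w = g.inner x v w) :
    u = v := by
  by_contra hne
  have hpos := g.pos x (u - v) (sub_ne_zero.2 hne)
  rw [(g.inner x).map_sub, sub_apply, h, sub_self] at hpos
  exact lt_irrefl _ hpos

variable (g x) in
/-- The endomorphism `√2 g⁻¹α / |α|` of `T_x X` for a 2-form `α` at `x`; so the almost complex
structure of a 2-form `Ω` is `x ↦ acsAt g x (Ω x)`. -/
noncomputable def acsAt (α : TangentSpace (𝓡 4) x [⋀^Fin 2]→L[ℝ] ℝ) :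
    TangentSpace (𝓡 4) x →L[ℝ] TangentSpace (𝓡 4) x :=
  (√2 / formNorm g x α) • LinearMap.toContinuousLinearMap (gInv g x α)

theorem gInv_smul (c : ℝ) : gInv g x (c • α) = c • gInv g x α :=
  LinearMap.ext fun v => ext_inner fun w => by
    have h : (c • α) ![v, w] = c * α ![v, w] := rfl
    rw [inner_gInv, h, ← inner_gInv g, LinearMap.smul_apply, map_smul]
    rfl

theorem formNorm_smul (c : ℝ) : formNorm g x (c • α) = |c| * formNorm g x α := by
  rw [formNorm, formNorm, gInv_smul, LinearMap.smul_comp, LinearMap.comp_smul, map_smul, map_smul,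
    ← Real.sqrt_sq_eq_abs, ← Real.sqrt_mul (sq_nonneg c)]
  congr 1
  simp only [smul_eq_mul]
  ring

theorem acsAt_smul {c : ℝ} (hc : 0 < c) : acsAt g x (c • α) = acsAt g x α := by
  have h := hc.ne'
  rw [acsAt, acsAt, gInv_smul, formNorm_smul, abs_of_pos hc, map_smul, smul_smul]
  congr 1
  field_simp

theorem acsAt_neg : acsAt g x (-α) = -acsAt g x α := by
  rw [acsAt, acsAt, ← neg_one_smul ℝ α, gInv_smul, formNorm_smul, abs_neg, abs_one, one_mul,
    map_smul, neg_one_smul, smul_neg]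

section Frame

variable {A : E4 ≃L[ℝ] TangentSpace (𝓡 4) x} {R : E4 →L[ℝ] E4}
  (hR : ∀ u v, g.inner x (A (R u)) (A v) = α ![A u, A v])

include hR

theorem gInv_apply_frame (u : E4) : gInv g x α (A u) = A (R u) :=
  ext_inner fun w => by
    obtain ⟨v, rfl⟩ := A.surjective w
    rw [inner_gInv, hR]

theorem trace_gInv_sq : LinearMap.trace ℝ (TangentSpace (𝓡 4) x) (gInv g x α ∘ₗ gInv g x α) =
    trSq R := by
  rw [trSq, ← LinearMap.trace_conj' _ A.toLinearEquiv]
  congr 1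
  ext w
  obtain ⟨u, rfl⟩ := A.surjective w
  have h : A.toLinearEquiv.symm (A u) = u := A.symm_apply_apply u
  rw [LinearEquiv.conj_apply_apply, h, LinearMap.comp_apply, gInv_apply_frame hR,
    gInv_apply_frame hR]
  rfl

theorem acsAt_apply_frame (u : E4) : acsAt g x α (A u) = A (normalized R u) := by
  rw [acsAt, formNorm, trace_gInv_sq hR, normalized, smul_apply, smul_apply, map_smul]
  exact congrArg _ (gInv_apply_frame hR u)

end Frame

variable (g x α) in
/-- The square of `g⁻¹α` is a homothety. The forms with this property are the self-dual and the
anti-self-dual ones. -/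
def HasScalarSquare : Prop := ∃ c : ℝ, ∀ v, gInv g x α (gInv g x α v) = c • v

theorem hasScalarSquare_iff {A : E4 ≃L[ℝ] TangentSpace (𝓡 4) x} {R : E4 →L[ℝ] E4}
    (hR : ∀ u v, g.inner x (A (R u)) (A v) = α ![A u, A v]) :
    HasScalarSquare g x α ↔ R * R ∈ Submodule.span ℝ {(1 : E4 →L[ℝ] E4)} := by
  rw [Submodule.mem_span_singleton, HasScalarSquare]
  refine exists_congr fun c => ?_
  simp only [A.surjective.forall, gInv_apply_frame hR, ← map_smul, A.injective.eq_iff]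
  exact ⟨fun h => ContinuousLinearMap.ext fun u => (h u).symm, fun h u =>
    (DFunLike.congr_fun h u).symm⟩

/-! ### Self-dual forms at a point -/

section Basis

variable {e : Module.Basis (Fin 4) ℝ (TangentSpace (𝓡 4) x)}

variable (e) in
/-- The isomorphism of `ℝ⁴` with `T_x X` which takes the standard basis to `e`. -/
noncomputable def basisFrame : E4 ≃L[ℝ] TangentSpace (𝓡 4) x :=
  ((WithLp.linearEquiv 2 ℝ (Fin 4 → ℝ)).trans e.equivFun.symm).toContinuousLinearEquiv

omit [IsManifold (𝓡 4) ∞ X] in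
variable (e) in
theorem basisFrame_apply (u : E4) : basisFrame e u = ∑ i, u i • e i :=
  e.equivFun_symm_apply u.ofLp

omit [IsManifold (𝓡 4) ∞ X] in
variable (e) in
theorem basisFrame_single (i : Fin 4) : basisFrame e (EuclideanSpace.single i 1) = e i := by
  simp [basisFrame_apply]

/-- The coefficients `α(e₀, eⱼ)` of `α`, where `j = 1, 2, 3`. -/
noncomputable def sdCoeff (e : Module.Basis (Fin 4) ℝ (TangentSpace (𝓡 4) x))
    (α : TangentSpace (𝓡 4) x [⋀^Fin 2]→L[ℝ] ℝ) (j : Fin 3) : ℝ := α ![e 0, e j.succ]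

/-- The coefficients `α(e₂, e₃)`, `α(e₃, e₁)`, `α(e₁, e₂)` of `α`. -/
noncomputable def dualCoeff (e : Module.Basis (Fin 4) ℝ (TangentSpace (𝓡 4) x))
    (α : TangentSpace (𝓡 4) x [⋀^Fin 2]→L[ℝ] ℝ) (j : Fin 3) : ℝ :=
  α ![e (j + 1).succ, e (j + 2).succ]

omit [IsManifold (𝓡 4) ∞ X] in
theorem apply_basisFrame (u v : E4) : α ![basisFrame e u, basisFrame e v] =
    (u 0 * v 1 - u 1 * v 0) * sdCoeff e α 0 + (u 0 * v 2 - u 2 * v 0) * sdCoeff e α 1 +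
    (u 0 * v 3 - u 3 * v 0) * sdCoeff e α 2 + (u 2 * v 3 - u 3 * v 2) * dualCoeff e α 0 +
    (u 3 * v 1 - u 1 * v 3) * dualCoeff e α 1 + (u 1 * v 2 - u 2 * v 1) * dualCoeff e α 2 := by
  have h10 := twoForm_swap α (e 1) (e 0)
  have h20 := twoForm_swap α (e 2) (e 0)
  have h30 := twoForm_swap α (e 3) (e 0)
  have h21 := twoForm_swap α (e 2) (e 1)
  have h13 := twoForm_swap α (e 1) (e 3)
  have h32 := twoForm_swap α (e 3) (e 2)
  simp only [basisFrame_apply, Fin.sum_univ_four, twoForm_add_left, twoForm_add_right,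
    twoForm_smul_left, twoForm_smul_right, twoForm_self, smul_eq_mul, h10, h20, h30, h21, h13, h32]
  dsimp [sdCoeff, dualCoeff]
  ring

section Orthonormal

variable (he : ∀ i j, g.inner x (e i) (e j) = if i = j then 1 else 0)

include he

theorem inner_basisFrame (u v : E4) : g.inner x (basisFrame e u) (basisFrame e v) =
    u 0 * v 0 + u 1 * v 1 + u 2 * v 2 + u 3 * v 3 := by
  simp only [basisFrame_apply, Fin.sum_univ_four, map_add, map_smul, add_apply, smul_apply, he,
    smul_eq_mul]
  simp
  ring

theorem sum_inner_mul_inner (v w : TangentSpace (𝓡 4) x) :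
    ∑ k, g.inner x v (e k) * g.inner x w (e k) = g.inner x v w := by
  obtain ⟨u, rfl⟩ := (basisFrame e).surjective v
  obtain ⟨u', rfl⟩ := (basisFrame e).surjective w
  simp only [← basisFrame_single e, inner_basisFrame he, Fin.sum_univ_four]
  simp

theorem HasScalarSquare.sum_mul (h : HasScalarSquare g x α) :
    ∃ c, ∀ i j, ∑ k, α ![e i, e k] * α ![e j, e k] = if i = j then c else 0 := by
  obtain ⟨c, hc⟩ := h
  refine ⟨-c, fun i j => ?_⟩
  simp only [← inner_gInv g]
  rw [sum_inner_mul_inner he, inner_gInv, twoForm_swap, ← inner_gInv g, hc, map_smul, smul_apply,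
    he]
  split_ifs <;> simp_all

theorem HasScalarSquare.dualCoeff_eq_or (h : HasScalarSquare g x α) :
    dualCoeff e α = sdCoeff e α ∨ dualCoeff e α = -sdCoeff e α := by
  obtain ⟨c, hc⟩ := h.sum_mul he
  simp only [← basisFrame_single e, apply_basisFrame, Fin.sum_univ_four] at hc
  set a := sdCoeff e α
  set b := dualCoeff e α
  have h00 : a 0 * a 0 + a 1 * a 1 + a 2 * a 2 = c := by simpa using hc 0 0
  have h11 : a 0 * a 0 + b 2 * b 2 + b 1 * b 1 = c := by simpa using hc 1 1
  have h22 : a 1 * a 1 + b 2 * b 2 + b 0 * b 0 = c := by simpa using hc 2 2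
  have h33 : a 2 * a 2 + b 1 * b 1 + b 0 * b 0 = c := by simpa using hc 3 3
  have h01 : a 1 * b 2 + -(a 2 * b 1) = 0 := by simpa using hc 0 1
  have h02 : -(a 0 * b 2) + a 2 * b 0 = 0 := by simpa using hc 0 2
  have h03 : a 0 * b 1 + -(a 1 * b 0) = 0 := by simpa using hc 0 3
  have h12 : a 0 * a 1 + -(b 1 * b 0) = 0 := by simpa using hc 1 2
  have h13 : a 0 * a 2 + -(b 2 * b 0) = 0 := by simpa using hc 1 3
  have h23 : a 1 * a 2 + -(b 2 * b 1) = 0 := by simpa using hc 2 3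
  have hmul : ∀ i j, (b i + a i) * (b j - a j) = 0 := by
    intro i j
    fin_cases i <;> fin_cases j <;> dsimp <;> linarith
  by_cases h : b = a
  · exact Or.inl h
  · obtain ⟨j, hj⟩ := Function.ne_iff.1 h
    exact Or.inr (funext fun i => eq_neg_of_add_eq_zero_left
      ((mul_eq_zero.1 (hmul i j)).resolve_right (sub_ne_zero.2 hj)))

end Orthonormal

end Basis

end Pointwise

section SelfDual

variable {X : Type*} [TopologicalSpace X] [ChartedSpace E4 X] [IsManifold (𝓡 4) ∞ X]
  {g : Metric4 X} {o : Orientation4 X} {x : X}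
  {α β : TangentSpace (𝓡 4) x [⋀^Fin 2]→L[ℝ] ℝ}
  {e f : Module.Basis (Fin 4) ℝ (TangentSpace (𝓡 4) x)}

variable (g o x) in
theorem exists_isOrientedONB : ∃ e, IsOrientedONB g o x e := by
  let core : InnerProductSpace.Core ℝ (TangentSpace (𝓡 4) x) := g.toRiemannianMetric.toCore x
  let : NormedAddCommGroup (TangentSpace (𝓡 4) x) := core.toNormedAddCommGroup
  let : InnerProductSpace ℝ (TangentSpace (𝓡 4) x) := InnerProductSpace.ofCore core.toCore
  let b := (stdOrthonormalBasis ℝ (TangentSpace (𝓡 4) x)).reindex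
    (finCongr (finrank_tangentSpace x))
  let b' := b.adjustToOrientation (o.at_ x)
  refine ⟨b'.toBasis, fun i j => ?_, b.orientation_adjustToOrientation (o.at_ x)⟩
  have h := orthonormal_iff_ite.1 b'.orthonormal i j
  simp only [OrthonormalBasis.coe_toBasis]
  exact h

theorem IsOrientedONB.reindex (he : IsOrientedONB g o x e) (σ : Equiv.Perm (Fin 4))
    (hσ : Equiv.Perm.sign σ = 1) : IsOrientedONB g o x (e.reindex σ.symm) := by
  refine ⟨fun i j => by simp [he.1], ?_⟩
  have h : ⇑(e.reindex σ.symm) = e ∘ σ := by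
    ext i; simp
  rw [← he.2, eq_comm, Module.Basis.orientation_eq_iff_det_pos, h, AlternatingMap.map_perm, hσ,
    Module.Basis.det_self]
  simp

theorem IsSelfDualAt.dualCoeff_eq (hα : IsSelfDualAt g o x α) (he : IsOrientedONB g o x e) :
    dualCoeff e α = sdCoeff e α := by
  have h1 : α ![e 3, e 1] = α ![e 0, e 2] := by
    have h := hα _ (he.reindex (Equiv.swap 1 2 * Equiv.swap 2 3) (by decide))
    simp only [Module.Basis.reindex_apply, Equiv.symm_symm] at h
    exact h
  have h2 : α ![e 1, e 2] = α ![e 0, e 3] := by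
    have h := hα _ (he.reindex (Equiv.swap 1 3 * Equiv.swap 3 2) (by decide))
    simp only [Module.Basis.reindex_apply, Equiv.symm_symm] at h
    exact h
  exact funext (Fin.forall_fin_succ.2 ⟨hα e he, Fin.forall_fin_two.2 ⟨h1, h2⟩⟩)

omit [IsManifold (𝓡 4) ∞ X] in
theorem sdCoeff_ne_zero (hα : dualCoeff e α = sdCoeff e α) (h0 : α ≠ 0) : sdCoeff e α ≠ 0 := by
  intro h
  refine h0 (twoForm_ext fun u v => ?_)
  obtain ⟨u, rfl⟩ := (basisFrame e).surjective u
  obtain ⟨v, rfl⟩ := (basisFrame e).surjective v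
  rw [apply_basisFrame, hα, h]
  simp

theorem inner_basisFrame_quat (he : ∀ i j, g.inner x (e i) (e j) = if i = j then 1 else 0)
    (hα : dualCoeff e α = sdCoeff e α) (u v : E4) :
    g.inner x (basisFrame e (quat (sdCoeff e α) u)) (basisFrame e v) =
      α ![basisFrame e u, basisFrame e v] := by
  rw [inner_basisFrame he, apply_basisFrame, hα, quat_apply]
  dsimp
  ring

theorem acsAt_basisFrame (he : ∀ i j, g.inner x (e i) (e j) = if i = j then 1 else 0)
    (hα : dualCoeff e α = sdCoeff e α) (u : E4) :
    acsAt g x α (basisFrame e u) = basisFrame e (unitQuat (sdCoeff e α) u) := by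
  rw [acsAt_apply_frame (inner_basisFrame_quat he hα), normalized_quat]

theorem IsSelfDualAt.acsAt_acsAt (hα : IsSelfDualAt g o x α) (h0 : α ≠ 0)
    (v : TangentSpace (𝓡 4) x) : acsAt g x α (acsAt g x α v) = -v := by
  obtain ⟨e, he⟩ := exists_isOrientedONB g o x
  obtain ⟨u, rfl⟩ := (basisFrame e).surjective v
  have hα := hα.dualCoeff_eq he
  rw [acsAt_basisFrame he.1 hα, acsAt_basisFrame he.1 hα,
    unitQuat_unitQuat (sdCoeff_ne_zero hα h0), map_neg]

theorem hasScalarSquare_of_dualCoeff_eq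
    (he : ∀ i j, g.inner x (e i) (e j) = if i = j then 1 else 0)
    (hα : dualCoeff e α = sdCoeff e α) : HasScalarSquare g x α := by
  refine (hasScalarSquare_iff (inner_basisFrame_quat he hα)).2
    (Submodule.mem_span_singleton.2 ⟨_, ContinuousLinearMap.ext fun v => (quat_quat _ v).symm⟩)

theorem trSq_neg {A : E4 ≃L[ℝ] TangentSpace (𝓡 4) x} {R : E4 →L[ℝ] E4}
    (hR : ∀ u v, g.inner x (A (R u)) (A v) = α ![A u, A v])
    (he : ∀ i j, g.inner x (e i) (e j) = if i = j then 1 else 0)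
    (hα : dualCoeff e α = sdCoeff e α) (h0 : α ≠ 0) : trSq R < 0 := by
  rw [← trace_gInv_sq hR, trace_gInv_sq (inner_basisFrame_quat he hα), trSq_quat]
  linarith [sum_sq_pos (sdCoeff_ne_zero hα h0)]

/-- If `α` were not self-dual, it would be anti-self-dual, and the sum of a nonzero self-dual and
a nonzero anti-self-dual form is neither. -/
theorem HasScalarSquare.dualCoeff_eq_of_add (hα : HasScalarSquare g x α)
    (hαβ : HasScalarSquare g x (α + β))
    (he : ∀ i j, g.inner x (e i) (e j) = if i = j then 1 else 0)
    (hβ : dualCoeff e β = sdCoeff e β) (h0 : β ≠ 0) : dualCoeff e α = sdCoeff e α := by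
  have hd : dualCoeff e (α + β) = dualCoeff e α + dualCoeff e β := rfl
  have hs : sdCoeff e (α + β) = sdCoeff e α + sdCoeff e β := rfl
  refine (hα.dualCoeff_eq_or he).elim id fun hneg => ?_
  rcases hαβ.dualCoeff_eq_or he with h | h <;> rw [hd, hs, hneg, hβ] at h
  · rw [hneg]
    exact add_right_cancel h
  · refine absurd (funext fun i => ?_) (sdCoeff_ne_zero hβ h0)
    have hi := congrFun h i
    simp only [Pi.add_apply, Pi.neg_apply] at hi
    rw [Pi.zero_apply]
    linarith

omit [IsManifold (𝓡 4) ∞ X] in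
/-- The left side is the Pfaffian of `α` in the basis `f`; it is `1` in the basis `e`. -/
theorem sum_sdCoeff_mul_dualCoeff (he : sdCoeff e α = ![1, 0, 0]) (he' : dualCoeff e α = ![1, 0, 0])
    (f : Module.Basis (Fin 4) ℝ (TangentSpace (𝓡 4) x)) :
    ∑ j, sdCoeff f α j * dualCoeff f α j = e.det f := by
  have hα : ∀ i j, α ![f i, f j] = e.toMatrix f 0 i * e.toMatrix f 1 j -
      e.toMatrix f 1 i * e.toMatrix f 0 j + (e.toMatrix f 2 i * e.toMatrix f 3 j -
      e.toMatrix f 3 i * e.toMatrix f 2 j) := fun i j => by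
    have h : ∀ i, f i = basisFrame e (WithLp.toLp 2 fun k => e.toMatrix f k i) := fun i => by
      rw [basisFrame_apply]
      exact (e.sum_toMatrix_smul_self f i).symm
    rw [h i, h j, apply_basisFrame, he, he']
    simp
  rw [Module.Basis.det_apply, Matrix.det_succ_row_zero]
  simp only [sdCoeff, dualCoeff, hα, Fin.sum_univ_succ, Matrix.det_fin_three]
  simp [Fin.succAbove]
  ring

/-- The self-dual form of `ℝ⁴` with coefficients `(1, 0, 0)`, transported by an oriented orthonormal
frame, is self-dual for every other one: it cannot be anti-self-dual, as its Pfaffian is positive.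
-/
theorem exists_isSelfDualAt (g : Metric4 X) (o : Orientation4 X) (x : X) :
    ∃ α, IsSelfDualAt g o x α ∧ α ≠ 0 := by
  obtain ⟨e, he⟩ := exists_isOrientedONB g o x
  let η : E4 [⋀^Fin 2]→L[ℝ] ℝ := Complex.reCLM.compContinuousAlternatingMap (sdForm ![1, 0, 0])
  let α := η.compContinuousLinearMap
    ((basisFrame e).symm : TangentSpace (𝓡 4) x →L[ℝ] E4)
  have hα : ∀ u v, α ![basisFrame e u, basisFrame e v] =
      (sdForm ![1, 0, 0] ![u, v]).re := fun u v => by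
    rw [compContinuousLinearMap_apply_vec2]
    simp [η]
  have hs : sdCoeff e α = ![1, 0, 0] := by
    ext j
    rw [sdCoeff, ← basisFrame_single e, ← basisFrame_single e, hα, sdForm_apply]
    fin_cases j <;> simp
  have hd : dualCoeff e α = ![1, 0, 0] := by
    ext j
    rw [dualCoeff, ← basisFrame_single e, ← basisFrame_single e, hα, sdForm_apply]
    fin_cases j <;> simp
  have hα0 : α ≠ 0 := fun h => one_ne_zero (α := ℝ) <| by
    have h0 := congrFun hs 0
    rw [h] at h0
    exact h0.symm
  refine ⟨α, fun f hf => ?_, hα0⟩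
  have hdet : 0 < e.det f :=
    (e.orientation_eq_iff_det_pos f).1 (he.2.trans hf.2.symm)
  rw [← sum_sdCoeff_mul_dualCoeff hs hd] at hdet
  rcases (hasScalarSquare_of_dualCoeff_eq he.1 (hd.trans hs.symm)).dualCoeff_eq_or hf.1 with h | h
  · exact congrFun h 0
  · refine absurd hdet (not_lt.2 ?_)
    rw [h]
    exact Finset.sum_nonpos fun j _ => by
      rw [Pi.neg_apply, mul_neg]
      exact neg_nonpos.2 (mul_self_nonneg _)

end SelfDual

/-! ### Convergence of almost complex structures -/

section IndexRaising

/-- A 2-form on `ℝ⁴` as a map to the dual space, `u ↦ a(u, ·)`. -/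
noncomputable def curryForm (a : E4 [⋀^Fin 2]→L[ℝ] ℝ) : E4 →L[ℝ] E4 →L[ℝ] ℝ :=
  LinearMap.toContinuousLinearMap
    { toFun := fun u => LinearMap.toContinuousLinearMap
        { toFun := fun v => a ![u, v]
          map_add' := fun v w => twoForm_add_right a v w u
          map_smul' := fun c v => twoForm_smul_right a c v u }
      map_add' := fun u v => by
        ext w; exact twoForm_add_left a u v w
      map_smul' := fun c u => by
        ext w; exact twoForm_smul_left a c u w }

theorem curryForm_apply (a : E4 [⋀^Fin 2]→L[ℝ] ℝ) (u v : E4) : curryForm a u v = a ![u, v] := rfl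

theorem continuous_curryForm : Continuous curryForm := by
  refine continuous_clm_apply.2 fun u => continuous_clm_apply.2 fun v => ?_
  simp only [curryForm_apply]
  fun_prop

/-- The endomorphism `G⁻¹a` for a metric `G` and a 2-form `a` on `ℝ⁴`. -/
noncomputable def raise (G : E4 →L[ℝ] E4 →L[ℝ] ℝ) (a : E4 [⋀^Fin 2]→L[ℝ] ℝ) : E4 →L[ℝ] E4 :=
  G.inverse.comp (curryForm a)

variable {G : E4 →L[ℝ] E4 →L[ℝ] ℝ} (hG : ∀ u, u ≠ 0 → 0 < G u u)

include hG

theorem exists_continuousLinearEquiv_of_pos :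
    ∃ e : E4 ≃L[ℝ] E4 →L[ℝ] ℝ, (e : E4 →L[ℝ] E4 →L[ℝ] ℝ) = G := by
  have hinj : Function.Injective G.toLinearMap := by
    rw [← LinearMap.ker_eq_bot, LinearMap.ker_eq_bot']
    refine fun u (hu : G u = 0) => by_contra fun h => ?_
    have hpos := hG u h
    rw [hu] at hpos
    exact lt_irrefl _ hpos
  have hd : Module.finrank ℝ E4 = Module.finrank ℝ (E4 →L[ℝ] ℝ) := by
    rw [← (LinearMap.toContinuousLinearMap (𝕜 := ℝ) (E := E4) (F' := ℝ)).finrank_eq]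
    simp
  exact ⟨(LinearEquiv.ofInjectiveOfFinrankEq _ hinj hd).toContinuousLinearEquiv, rfl⟩

theorem apply_raise (a : E4 [⋀^Fin 2]→L[ℝ] ℝ) (u v : E4) : G (raise G a u) v = a ![u, v] := by
  obtain ⟨e, rfl⟩ := exists_continuousLinearEquiv_of_pos hG
  simp [raise, curryForm_apply]

theorem tendsto_raise {ι : Type*} {l : Filter ι} {H : ι → E4 →L[ℝ] E4 →L[ℝ] ℝ}
    {a : ι → E4 [⋀^Fin 2]→L[ℝ] ℝ} {b : E4 [⋀^Fin 2]→L[ℝ] ℝ} (hH : Filter.Tendsto H l (𝓝 G))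
    (ha : Filter.Tendsto a l (𝓝 b)) :
    Filter.Tendsto (fun i => raise (H i) (a i)) l (𝓝 (raise G b)) := by
  obtain ⟨e, rfl⟩ := exists_continuousLinearEquiv_of_pos hG
  exact ((continuous_fst.clm_comp continuous_snd).tendsto (_, curryForm b)).comp
    (((contDiffAt_map_inverse (n := 0) e).continuousAt.tendsto.comp hH).prodMk_nhds
      ((continuous_curryForm.tendsto b).comp ha))

end IndexRaising

section Charts

variable {X : Type*} [TopologicalSpace X] [ChartedSpace E4 X] [IsManifold (𝓡 4) ∞ X]
  {g : Metric4 X} {Ω : TwoForm X} {p x : X}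

/-- The coordinates of a tangent vector in the chart around `p`. -/
noncomputable def coordMap (p x : X) : TangentSpace (𝓡 4) x →L[ℝ] E4 :=
  (trivializationAt E4 (TangentSpace (𝓡 4) : X → Type _) p).continuousLinearMapAt ℝ x

theorem coordFrame_coordMap (hx : x ∈ (chartAt E4 p).source) (v : TangentSpace (𝓡 4) x) :
    coordFrame p x (coordMap p x v) = v :=
  Bundle.Trivialization.symmL_continuousLinearMapAt _ (by simpa using hx) v

theorem coordMap_coordFrame (hx : x ∈ (chartAt E4 p).source) (v : E4) :
    coordMap p x (coordFrame p x v) = v :=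
  Bundle.Trivialization.continuousLinearMapAt_symmL _ (by simpa using hx) v

/-- The coordinate frame `coordFrame p x` as an isomorphism. -/
noncomputable def coordEquiv (hx : x ∈ (chartAt E4 p).source) :
    E4 ≃L[ℝ] TangentSpace (𝓡 4) x :=
  ContinuousLinearEquiv.equivOfInverse (coordFrame p x) (coordMap p x)
    (coordMap_coordFrame hx) (coordFrame_coordMap hx)

theorem coordFrame_self (p : X) (v : E4) : coordFrame p p v = v := by
  have h := TangentBundle.symmL_trivializationAt_eq_core (I := 𝓡 4) (b₀ := p) (b := p)
    (mem_chart_source E4 p)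
  rw [tangentBundleCore_coordChange_achart] at h
  have hv : tangentCoordChange (𝓡 4) p p p v = v :=
    tangentCoordChange_self (mem_extChartAt_source p)
  exact (DFunLike.congr_fun h v).trans hv

theorem coordMap_self (p : X) (v : TangentSpace (𝓡 4) p) : coordMap p p v = v := by
  have h := coordFrame_coordMap (mem_chart_source E4 p) v
  rwa [coordFrame_self] at h

theorem metricInChart_extChartAt_apply (hx : x ∈ (chartAt E4 p).source) (u v : E4) :
    metricInChart g p (extChartAt (𝓡 4) p x) u v =
      g.inner x (coordFrame p x u) (coordFrame p x v) := by
  have h : (extChartAt (𝓡 4) p).symm (extChartAt (𝓡 4) p x) = x :=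
    (extChartAt (𝓡 4) p).left_inv (by simpa using hx)
  change g.inner ((extChartAt (𝓡 4) p).symm (extChartAt (𝓡 4) p x))
    (coordFrame p ((extChartAt (𝓡 4) p).symm (extChartAt (𝓡 4) p x)) u)
    (coordFrame p ((extChartAt (𝓡 4) p).symm (extChartAt (𝓡 4) p x)) v) = _
  rw [h]

theorem metricInChart_extChartAt_pos (hx : x ∈ (chartAt E4 p).source) (u : E4) (hu : u ≠ 0) :
    0 < metricInChart g p (extChartAt (𝓡 4) p x) u u := by
  rw [metricInChart_extChartAt_apply hx]
  exact g.pos x _ ((coordEquiv hx).map_ne_zero_iff.2 hu)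

theorem contDiffAt_metricInChart (g : Metric4 X) (p : X) :
    ContDiffAt ℝ ∞ (metricInChart g p) (extChartAt (𝓡 4) p p) := by
  have hsymm : ContMDiffAt 𝓘(ℝ, E4) (𝓡 4) ∞ (extChartAt (𝓡 4) p).symm (extChartAt (𝓡 4) p p) :=
    (contMDiffWithinAt_extChartAt_symm_target p (mem_extChartAt_target p)).contMDiffAt
      (extChartAt_target_mem_nhds p)
  refine (contMDiffAt_iff_contDiffAt.1 (ContMDiffAt.comp_of_eq (x := extChartAt (𝓡 4) p p)
    ((contMDiffAt_hom_bundle _).1 (g.contMDiff p)).2 hsymm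
    (extChartAt_to_inv p))).congr_of_eventuallyEq ?_
  filter_upwards [extChartAt_target_mem_nhds (I := 𝓡 4) p] with y hy
  have hy : (extChartAt (𝓡 4) p).symm y ∈ (chartAt E4 p).source := by
    simpa using (extChartAt (𝓡 4) p).map_target hy
  ext u v
  refine Eq.trans ?_ (inCoordinates_apply_eq₂ (𝕜 := ℝ) (F₁ := E4) (F₂ := E4) (F₃ := ℝ)
    (E₁ := fun x : X => TangentSpace (𝓡 4) x) (E₂ := fun x : X => TangentSpace (𝓡 4) x)
    (E₃ := fun _ : X => ℝ) (x₀ := p) (ϕ := g.inner ((extChartAt (𝓡 4) p).symm y)) (v := u) (w := v)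
    (by simpa using hy) (by simpa using hy) (by simp)).symm
  rw [Bundle.Trivialization.coe_linearMapAt_of_mem _ (by simp),
    ← Bundle.Trivialization.symmL_apply (R := ℝ) _ (by simpa using hy),
    ← Bundle.Trivialization.symmL_apply (R := ℝ) _ (by simpa using hy)]
  rfl

theorem formInChart_extChartAt (hx : x ∈ (chartAt E4 p).source) :
    formInChart Ω p (extChartAt (𝓡 4) p x) = (Ω x).compContinuousLinearMap (coordFrame p x) := by
  have h : (extChartAt (𝓡 4) p).symm (extChartAt (𝓡 4) p x) = x :=
    (extChartAt (𝓡 4) p).left_inv (by simpa using hx)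
  rw [formInChart, h]

theorem formInChart_eq_zero (hp : p ∈ zeroSet Ω) :
    formInChart Ω p (extChartAt (𝓡 4) p p) = 0 := by
  rw [formInChart_extChartAt (mem_chart_source E4 p), show Ω p = 0 from hp]
  rfl

theorem IsSmoothForm.contDiffAt (hΩ : IsSmoothForm Ω) (p : X) :
    ContDiffAt ℝ ∞ (formInChart Ω p) (extChartAt (𝓡 4) p p) :=
  (hΩ p).contDiffAt (extChartAt_target_mem_nhds p)

theorem compContinuousLinearMap_coordFrame_self (α : TangentSpace (𝓡 4) p [⋀^Fin 2]→L[ℝ] ℝ) :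
    α.compContinuousLinearMap (coordFrame p p) = α :=
  twoForm_ext fun u v => by
    rw [compContinuousLinearMap_apply_vec2, coordFrame_self, coordFrame_self]
    rfl

end Charts

section Convergence

variable {X : Type*} [TopologicalSpace X] [ChartedSpace E4 X] [IsManifold (𝓡 4) ∞ X]
  {g : Metric4 X} {o : Orientation4 X} {Ω : TwoForm X} {p x : X}
  {β : TangentSpace (𝓡 4) p [⋀^Fin 2]→L[ℝ] ℝ}

variable (g p x) in
/-- The matrix of `g⁻¹α` in the chart around `p`, for a 2-form `α` at `x`. -/
noncomputable def gInvInChart (α : TangentSpace (𝓡 4) x [⋀^Fin 2]→L[ℝ] ℝ) : E4 →L[ℝ] E4 :=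
  raise (metricInChart g p (extChartAt (𝓡 4) p x)) (α.compContinuousLinearMap (coordFrame p x))

variable (g p x) in
/-- The matrix of `acsAt g x α` in the chart around `p`, for a 2-form `α` at `x`. -/
noncomputable def acsInChart (α : TangentSpace (𝓡 4) x [⋀^Fin 2]→L[ℝ] ℝ) : E4 →L[ℝ] E4 :=
  (coordMap p x).comp ((acsAt g x α).comp (coordFrame p x))

theorem acsInChart_self_apply (α : TangentSpace (𝓡 4) p [⋀^Fin 2]→L[ℝ] ℝ) (u : E4) :
    acsInChart g p p α u = acsAt g p α u :=
  (coordMap_self p _).trans (congrArg (acsAt g p α) (coordFrame_self p u))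

theorem acsInChart_neg (α : TangentSpace (𝓡 4) x [⋀^Fin 2]→L[ℝ] ℝ) :
    acsInChart g p x (-α) = -acsInChart g p x α := by
  rw [acsInChart, acsAt_neg, ContinuousLinearMap.neg_comp, ContinuousLinearMap.comp_neg]
  rfl

theorem inner_gInvInChart (hx : x ∈ (chartAt E4 p).source)
    (α : TangentSpace (𝓡 4) x [⋀^Fin 2]→L[ℝ] ℝ) (u v : E4) :
    g.inner x (coordEquiv hx (gInvInChart g p x α u)) (coordEquiv hx v) =
      α ![coordEquiv hx u, coordEquiv hx v] := by
  have h := apply_raise (metricInChart_extChartAt_pos (g := g) hx)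
    (α.compContinuousLinearMap (coordFrame p x)) u v
  rwa [metricInChart_extChartAt_apply hx, compContinuousLinearMap_apply_vec2] at h

theorem acsInChart_eq_normalized (hx : x ∈ (chartAt E4 p).source)
    (α : TangentSpace (𝓡 4) x [⋀^Fin 2]→L[ℝ] ℝ) :
    acsInChart g p x α = normalized (gInvInChart g p x α) :=
  ContinuousLinearMap.ext fun u => (congrArg (coordMap p x)
    (acsAt_apply_frame (inner_gInvInChart hx α) u)).trans (coordMap_coordFrame hx _)

section Tendsto

variable {ι : Type*} {l : Filter ι} {f : ι → X} {τ : ι → ℝ}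
  {α : ∀ i, TangentSpace (𝓡 4) (f i) [⋀^Fin 2]→L[ℝ] ℝ} {v : E4}

omit [IsManifold (𝓡 4) ∞ X] in
theorem eventually_mem_chart_source (hf : Filter.Tendsto f l (𝓝 p)) :
    ∀ᶠ i in l, f i ∈ (chartAt E4 p).source :=
  hf.eventually_mem ((chartAt E4 p).open_source.mem_nhds (mem_chart_source E4 p))

theorem tendsto_gInvInChart (hf : Filter.Tendsto f l (𝓝 p))
    (hα : Filter.Tendsto (fun i => (α i).compContinuousLinearMap (coordFrame p (f i))) l (𝓝 β)) :
    Filter.Tendsto (fun i => gInvInChart g p (f i) (α i)) l (𝓝 (gInvInChart g p p β)) := by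
  rw [← compContinuousLinearMap_coordFrame_self β] at hα
  exact tendsto_raise (metricInChart_extChartAt_pos (mem_chart_source E4 p))
    ((contDiffAt_metricInChart g p).continuousAt.tendsto.comp
      ((continuousAt_extChartAt p).tendsto.comp hf)) hα

theorem tendsto_acsInChart (hf : Filter.Tendsto f l (𝓝 p))
    (hα : Filter.Tendsto (fun i => (α i).compContinuousLinearMap (coordFrame p (f i))) l (𝓝 β))
    (hβ : IsSelfDualAt g o p β) (h0 : β ≠ 0) :
    Filter.Tendsto (fun i => acsInChart g p (f i) (α i)) l (𝓝 (acsInChart g p p β)) := by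
  obtain ⟨e, he⟩ := exists_isOrientedONB g o p
  have hp := mem_chart_source E4 p
  have hneg := trSq_neg (inner_gInvInChart (g := g) hp β) he.1 (hβ.dualCoeff_eq he) h0
  rw [acsInChart_eq_normalized hp]
  refine ((continuousAt_normalized hneg).tendsto.comp (tendsto_gInvInChart hf hα)).congr' ?_
  filter_upwards [eventually_mem_chart_source hf] with i hi
  exact (acsInChart_eq_normalized hi (α i)).symm

theorem HasScalarSquare.of_tendsto [l.NeBot] (hf : Filter.Tendsto f l (𝓝 p))
    (hα : Filter.Tendsto (fun i => (α i).compContinuousLinearMap (coordFrame p (f i))) l (𝓝 β))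
    (h : ∀ i, HasScalarSquare g (f i) (α i)) : HasScalarSquare g p β := by
  rw [hasScalarSquare_iff (inner_gInvInChart (mem_chart_source E4 p) β)]
  have hlim := tendsto_gInvInChart (g := g) hf hα
  refine (Submodule.closed_of_finiteDimensional _).mem_of_tendsto (hlim.mul hlim) ?_
  filter_upwards [eventually_mem_chart_source hf] with i hi
  exact (hasScalarSquare_iff (inner_gInvInChart hi (α i))).1 (h i)

theorem IsSmoothForm.tendsto_blowUp (hΩ : IsSmoothForm Ω) (hp : p ∈ zeroSet Ω)
    (hf : Filter.Tendsto f l (𝓝 p))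
    (hv : Filter.Tendsto (fun i => (τ i)⁻¹ • (extChartAt (𝓡 4) p (f i) - extChartAt (𝓡 4) p p)) l
      (𝓝 v)) :
    Filter.Tendsto (fun i => ((τ i)⁻¹ • Ω (f i)).compContinuousLinearMap (coordFrame p (f i))) l
      (𝓝 (nablaAtZero Ω p v)) := by
  have hd := ((hΩ.contDiffAt p).differentiableAt (by simp)).hasFDerivAt
  have hlim := (hasFDerivWithinAt_univ.2 hd).lim (c := fun i => (τ i)⁻¹)
    (d := fun i => extChartAt (𝓡 4) p (f i) - extChartAt (𝓡 4) p p)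
    (tendsto_sub_nhds_zero_iff.2 ((continuousAt_extChartAt p).tendsto.comp hf))
    (Filter.Eventually.of_forall fun _ => mem_univ _) hv
  refine hlim.congr' ?_
  filter_upwards [eventually_mem_chart_source hf] with i hi
  rw [add_sub_cancel, formInChart_eq_zero hp, sub_zero, formInChart_extChartAt hi]
  rfl

end Tendsto

section NablaAtZero

/-- The point with coordinates `φ(p) + s v` in the chart `φ` around `p`. -/
noncomputable def chartLine (p : X) (v : E4) (s : ℝ) : X :=
  (extChartAt (𝓡 4) p).symm (extChartAt (𝓡 4) p p + s • v)

omit [IsManifold (𝓡 4) ∞ X] in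
theorem tendsto_chartLine_coord (p : X) (v : E4) :
    Filter.Tendsto (fun s : ℝ => extChartAt (𝓡 4) p p + s • v) (𝓝[>] 0)
      (𝓝 (extChartAt (𝓡 4) p p)) := by
  have h : Continuous fun s : ℝ => extChartAt (𝓡 4) p p + s • v := by fun_prop
  simpa using (h.tendsto 0).mono_left nhdsWithin_le_nhds

omit [IsManifold (𝓡 4) ∞ X] in
theorem tendsto_chartLine (p : X) (v : E4) : Filter.Tendsto (chartLine p v) (𝓝[>] 0) (𝓝 p) := by
  have h := (continuousAt_extChartAt_symm (I := 𝓡 4) p).tendsto.comp (tendsto_chartLine_coord p v)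
  rwa [extChartAt_to_inv] at h

omit [IsManifold (𝓡 4) ∞ X] in
theorem tendsto_chartLine_sub (p : X) (v : E4) :
    Filter.Tendsto (fun s : ℝ => s⁻¹ • (extChartAt (𝓡 4) p (chartLine p v s) -
      extChartAt (𝓡 4) p p)) (𝓝[>] 0) (𝓝 v) := by
  refine tendsto_const_nhds.congr' ?_
  filter_upwards [(tendsto_chartLine_coord p v).eventually (extChartAt_target_mem_nhds p),
    self_mem_nhdsWithin] with s hs hs0
  rw [chartLine, (extChartAt (𝓡 4) p).right_inv hs, add_sub_cancel_left,
    inv_smul_smul₀ (ne_of_gt hs0)]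

variable (hsd : IsSelfDualForm g o Ω) (hΩ : IsSmoothForm Ω) (hp : p ∈ zeroSet Ω)

include hsd hΩ hp

theorem hasScalarSquare_nablaAtZero (v : TangentSpace (𝓡 4) p) :
    HasScalarSquare g p (nablaAtZero Ω p v) := by
  refine HasScalarSquare.of_tendsto (tendsto_chartLine p v) (hΩ.tendsto_blowUp hp
    (tendsto_chartLine p v) (tendsto_chartLine_sub p v)) fun s => ?_
  obtain ⟨e, he⟩ := exists_isOrientedONB g o (chartLine p v s)
  have h : dualCoeff e (s⁻¹ • Ω (chartLine p v s)) = sdCoeff e (s⁻¹ • Ω (chartLine p v s)) :=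
    congrArg (s⁻¹ • ·) ((hsd _).dualCoeff_eq he)
  exact hasScalarSquare_of_dualCoeff_eq he.1 h

omit hsd in
theorem eventually_chartLine_notMem_zeroSet {v : E4} (h0 : nablaAtZero Ω p v ≠ 0) :
    ∀ᶠ s in 𝓝[>] 0, chartLine p v s ∉ zeroSet Ω := by
  filter_upwards [(hΩ.tendsto_blowUp hp (tendsto_chartLine p v)
    (tendsto_chartLine_sub p v)).eventually_ne h0] with s hs h
  refine hs (twoForm_ext fun u w => ?_)
  rw [show Ω (chartLine p v s) = 0 from h, smul_zero]
  rfl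

variable (htrans : VanishesTransversely g o Ω)

include htrans

theorem isSelfDualAt_nablaAtZero (v : TangentSpace (𝓡 4) p) :
    IsSelfDualAt g o p (nablaAtZero Ω p v) := by
  intro e he
  obtain ⟨β, hβ, h0⟩ := exists_isSelfDualAt g o p
  obtain ⟨u, rfl⟩ := htrans p hp β hβ
  have hadd : nablaAtZero Ω p (v + u) = nablaAtZero Ω p v + nablaAtZero Ω p u :=
    (fderiv ℝ (formInChart Ω p) (extChartAt (𝓡 4) p p)).map_add v u
  exact congrFun ((hasScalarSquare_nablaAtZero hsd hΩ hp v).dualCoeff_eq_of_add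
    (hadd ▸ hasScalarSquare_nablaAtZero hsd hΩ hp (v + u)) he.1 (hβ.dualCoeff_eq he) h0) 0

theorem tendsto_acsInChart_blowUp {ι : Type*} {l : Filter ι} {f : ι → X} {τ : ι → ℝ}
    (hf : Filter.Tendsto f l (𝓝 p)) (hτ : ∀ᶠ i in l, 0 < τ i) {v : E4}
    (hv : Filter.Tendsto (fun i => (τ i)⁻¹ • (extChartAt (𝓡 4) p (f i) - extChartAt (𝓡 4) p p)) l
      (𝓝 v)) (h0 : nablaAtZero Ω p v ≠ 0) :
    Filter.Tendsto (fun i => acsInChart g p (f i) (Ω (f i))) l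
      (𝓝 (acsInChart g p p (nablaAtZero Ω p v))) := by
  refine (tendsto_acsInChart hf (hΩ.tendsto_blowUp hp hf hv)
    (isSelfDualAt_nablaAtZero hsd hΩ hp htrans v) h0).congr' ?_
  filter_upwards [hτ] with i hi
  rw [acsInChart, acsInChart, acsAt_smul (inv_pos.2 hi)]

/-- The limits of `J` at `p` along `v` and `-v` are opposite. -/
theorem not_extendsOver {U : Set X} (hU : U ∈ 𝓝 p) : ¬ ExtendsOver g Ω U := by
  rintro ⟨J, hJc, -, hJΩ⟩
  have hJp := ((continuousAt_hom_bundle (RingHom.id ℝ) _).1 (hJc.continuousAt hU)).2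
  have hlim : ∀ v : E4, nablaAtZero Ω p v ≠ 0 → (coordMap p p).comp ((J p).comp (coordFrame p p)) =
      acsInChart g p p (nablaAtZero Ω p v) := fun v hv => by
    refine tendsto_nhds_unique (hJp.tendsto.comp (tendsto_chartLine p v))
      ((tendsto_acsInChart_blowUp hsd hΩ hp htrans (tendsto_chartLine p v) self_mem_nhdsWithin
        (tendsto_chartLine_sub p v) hv).congr' ?_)
    filter_upwards [eventually_chartLine_notMem_zeroSet hΩ hp hv,
      (tendsto_chartLine p v).eventually_mem hU] with s hs hsU
    exact congrArg (fun A => (coordMap p _).comp (A.comp (coordFrame p _))) (hJΩ _ hsU hs).symm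
  obtain ⟨β, hβ, h0⟩ := exists_isSelfDualAt g o p
  obtain ⟨v, rfl⟩ := htrans p hp β hβ
  have hneg : nablaAtZero Ω p (-v) = -nablaAtZero Ω p v :=
    (fderiv ℝ (formInChart Ω p) (extChartAt (𝓡 4) p p)).map_neg v
  have h := (hlim v h0).symm.trans (hlim (-v) (by rwa [hneg, neg_ne_zero]))
  rw [hneg, acsInChart_neg] at h
  obtain ⟨w, hw⟩ := exists_ne (0 : E4)
  have hzero : acsInChart g p p (nablaAtZero Ω p v) (acsInChart g p p (nablaAtZero Ω p v) w) = 0 :=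
    (smul_eq_zero_iff_right (two_ne_zero' ℝ)).1
      ((two_smul ℝ _).trans (eq_neg_iff_add_eq_zero.1 (DFunLike.congr_fun h _)))
  rw [acsInChart_self_apply, acsInChart_self_apply] at hzero
  exact hw (neg_eq_zero.1 ((hβ.acsAt_acsAt h0 w).symm.trans hzero))

end NablaAtZero

end Convergence

/-! ### Short geodesics -/

section GeodesicEstimate

set_option maxSynthPendingDepth 3

variable {E : Type*} [NormedAddCommGroup E] [NormedSpace ℝ E]

theorem exists_forall_mul_sq_norm_le [FiniteDimensional ℝ E] [Nontrivial E]
    {G : E → E →L[ℝ] E →L[ℝ] ℝ} {K : Set E} (hK : IsCompact K) (hne : K.Nonempty)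
    (hG : ContinuousOn G K) (hpos : ∀ y ∈ K, ∀ u, u ≠ 0 → 0 < G y u u) :
    ∃ m > 0, ∀ y ∈ K, ∀ u, m * ‖u‖ ^ 2 ≤ G y u u := by
  have hc : ContinuousOn (fun q : E × E => G q.1 q.2 q.2) (K ×ˢ Metric.sphere 0 1) :=
    ((hG.comp continuousOn_fst fun _ h => h.1).clm_apply continuousOn_snd).clm_apply
      continuousOn_snd
  obtain ⟨q, hq, hmin⟩ := (hK.prod (isCompact_sphere (0 : E) 1)).exists_isMinOn
    (hne.prod (NormedSpace.sphere_nonempty.2 zero_le_one)) hc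
  have hq2 : q.2 ≠ 0 := ne_zero_of_mem_unit_sphere ⟨q.2, hq.2⟩
  refine ⟨G q.1 q.2 q.2, hpos _ hq.1 _ hq2, fun y hy u => ?_⟩
  rcases eq_or_ne u 0 with rfl | hu
  · simp
  have hu' := norm_pos_iff.2 hu
  have h : G q.1 q.2 q.2 ≤ G y (‖u‖⁻¹ • u) (‖u‖⁻¹ • u) :=
    hmin (show (y, ‖u‖⁻¹ • u) ∈ K ×ˢ Metric.sphere (0 : E) 1 from
      ⟨hy, by simp [norm_smul, hu'.ne']⟩)
  simp only [map_smul, smul_apply, smul_eq_mul] at h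
  calc G q.1 q.2 q.2 * ‖u‖ ^ 2 ≤ ‖u‖⁻¹ * (‖u‖⁻¹ * G y u u) * ‖u‖ ^ 2 := by gcongr
    _ = G y u u := by field_simp

theorem exists_metric_bounds [FiniteDimensional ℝ E] [Nontrivial E] {G : E → E →L[ℝ] E →L[ℝ] ℝ}
    {x : E} {U : Set E} (hU : U ∈ 𝓝 x) (hG : ContDiffAt ℝ 1 G x)
    (hpos : ∀ y ∈ U, ∀ u, u ≠ 0 → 0 < G y u u) :
    ∃ R > 0, ∃ m > 0, ∃ L > 0, ∃ M > 0, Metric.closedBall x R ⊆ U ∧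
      ∀ y ∈ Metric.closedBall x R, DifferentiableAt ℝ G y ∧ ‖fderiv ℝ G y‖ ≤ M ∧ ‖G y‖ ≤ L ∧
        ∀ u, m * ‖u‖ ^ 2 ≤ G y u u := by
  have hdiff : ∀ᶠ y in 𝓝 x, DifferentiableAt ℝ G y :=
    (hG.eventually (by simp)).mono fun y hy => hy.differentiableAt one_ne_zero
  have hfderiv : ∀ᶠ y in 𝓝 x, ‖fderiv ℝ G y‖ < ‖fderiv ℝ G x‖ + 1 :=
    (hG.fderiv_right (m := 0) (by simp)).continuousAt.norm.eventually_lt continuousAt_const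
      (lt_add_one _)
  have hnorm : ∀ᶠ y in 𝓝 x, ‖G y‖ < ‖G x‖ + 1 :=
    hG.continuousAt.norm.eventually_lt continuousAt_const (lt_add_one _)
  obtain ⟨R, hR, hball⟩ := Metric.nhds_basis_closedBall.eventually_iff.1
    ((hdiff.and (hfderiv.and hnorm)).and hU)
  obtain ⟨m, hm, hmG⟩ := exists_forall_mul_sq_norm_le (isCompact_closedBall x R)
    (Metric.nonempty_closedBall.2 hR.le)
    (fun y hy => (hball hy).1.1.continuousAt.continuousWithinAt) fun y hy => hpos y (hball hy).2
  exact ⟨R, hR, m, hm, ‖G x‖ + 1, by positivity, ‖fderiv ℝ G x‖ + 1, by positivity,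
    fun y hy => (hball hy).2, fun y hy =>
      ⟨(hball hy).1.1, (hball hy).1.2.1.le, (hball hy).1.2.2.le, hmG y hy⟩⟩

theorem hasDerivAt_deriv_of_contDiffAt_two {c : ℝ → E} {t : ℝ} (h : ContDiffAt ℝ 2 c t) :
    HasDerivAt (deriv c) (deriv (deriv c) t) t := by
  have hd : DifferentiableAt ℝ (fun s => fderiv ℝ c s 1) t :=
    ((h.fderiv_right (m := 1) (by norm_num)).differentiableAt one_ne_zero).clm_apply
      (differentiableAt_const _)
  rw [show (fun s => fderiv ℝ c s 1) = deriv c from funext fun _ => fderiv_apply_one_eq_deriv] at hd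
  exact hd.hasDerivAt

/-- The geodesic equation, tested against the velocity, says that the energy is constant. -/
theorem hasDerivAt_energy {G : E → E →L[ℝ] E →L[ℝ] ℝ} {c : ℝ → E} {t : ℝ}
    (hG : DifferentiableAt ℝ G (c t)) (hsymm : ∀ u w, G (c t) u w = G (c t) w u)
    (hc : ContDiffAt ℝ 2 c t)
    (hgeo : G (c t) (deriv (deriv c) t) (deriv c t) +
      fderiv ℝ G (c t) (deriv c t) (deriv c t) (deriv c t)
        - 1 / 2 * fderiv ℝ G (c t) (deriv c t) (deriv c t) (deriv c t) = 0) :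
    HasDerivAt (fun t => G (c t) (deriv c t) (deriv c t)) 0 t := by
  have hc1 := (hc.differentiableAt two_ne_zero).hasDerivAt
  have hc2 := hasDerivAt_deriv_of_contDiffAt_two hc
  have hGc : HasDerivAt (fun t => G (c t)) (fderiv ℝ G (c t) (deriv c t)) t :=
    hG.hasFDerivAt.comp_hasDerivAt t hc1
  refine ((hGc.clm_apply hc2).clm_apply hc2).congr_deriv ?_
  have h := hsymm (deriv c t) (deriv (deriv c) t)
  simp only [add_apply]
  linarith

theorem sq_norm_le_of_apply_self_eq {B B' : E →L[ℝ] E →L[ℝ] ℝ} {m L : ℝ} (hm : 0 < m)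
    (hB : ∀ u, m * ‖u‖ ^ 2 ≤ B u u) (hB' : ‖B'‖ ≤ L) {u v : E} (h : B u u = B' v v) :
    ‖u‖ ^ 2 ≤ L / m * ‖v‖ ^ 2 := by
  rw [div_mul_eq_mul_div, le_div_iff₀ hm, mul_comm]
  calc m * ‖u‖ ^ 2 ≤ B' v v := (hB u).trans_eq h
    _ ≤ ‖B'‖ * ‖v‖ * ‖v‖ := (Real.le_norm_self _).trans (B'.le_opNorm₂ v v)
    _ ≤ L * ‖v‖ * ‖v‖ := by gcongr
    _ = L * ‖v‖ ^ 2 := by ring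

theorem norm_acceleration_le {B : E →L[ℝ] E →L[ℝ] ℝ} {D : E →L[ℝ] E →L[ℝ] E →L[ℝ] ℝ} {m M : ℝ}
    (hm : 0 < m) (hB : ∀ u, m * ‖u‖ ^ 2 ≤ B u u) (hD : ‖D‖ ≤ M) {a b : E}
    (h : B a a + D b b a - 1 / 2 * D a b b = 0) : ‖a‖ ≤ 3 / 2 * M / m * ‖b‖ ^ 2 := by
  have hM : 0 ≤ M := (norm_nonneg D).trans hD
  rcases eq_or_ne a 0 with rfl | ha
  · rw [norm_zero]; positivity
  have hbound : ∀ x y z, |D x y z| ≤ M * ‖x‖ * ‖y‖ * ‖z‖ := fun x y z =>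
    ((D x).le_opNorm₂ y z).trans (by gcongr; exact D.le_of_opNorm_le hD x)
  have hmul : m * ‖a‖ * ‖a‖ ≤ 3 / 2 * M * ‖b‖ ^ 2 * ‖a‖ := by
    linarith [hB a, abs_le.1 (hbound b b a), abs_le.1 (hbound a b b)]
  have h' := le_of_mul_le_mul_right hmul (norm_pos_iff.2 ha)
  rw [div_mul_eq_mul_div, le_div_iff₀ hm]
  linarith

theorem norm_sub_sub_smul_le {c : ℝ → E} {v : E} {T K : ℝ} (hT : 0 ≤ T) (hT1 : T ≤ 1)
    (hK : 0 ≤ K) (hv : deriv c 0 = v)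
    (hc : ∀ t ∈ Icc 0 T, ContDiffAt ℝ 2 c t ∧ ‖deriv (deriv c) t‖ ≤ K) :
    ‖c T - c 0 - T • v‖ ≤ K := by
  have hvel : ∀ t ∈ Icc 0 T, ‖deriv c t - v‖ ≤ K := by
    intro t ht
    have h := norm_image_sub_le_of_norm_deriv_le_segment' (f := deriv c)
      (fun t ht => (hasDerivAt_deriv_of_contDiffAt_two (hc t ht).1).hasDerivWithinAt)
      (fun t ht => (hc t ⟨ht.1, ht.2.le⟩).2) t ht
    rw [hv] at h
    exact h.trans (mul_le_of_le_one_right hK (by linarith [ht.2]))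
  have h := norm_image_sub_le_of_norm_deriv_le_segment' (f := fun t => c t - t • v)
    (f' := fun t => deriv c t - v) (fun t ht =>
      ((((hc t ht).1.differentiableAt two_ne_zero).hasDerivAt.sub
        ((hasDerivAt_id t).smul_const v)).congr_deriv (by rw [one_smul])).hasDerivWithinAt)
    (fun t ht => hvel t ⟨ht.1, ht.2.le⟩) T ⟨hT, le_rfl⟩
  rw [zero_smul, sub_zero, sub_right_comm] at h
  exact h.trans (mul_le_of_le_one_right hK (by linarith))

/-- Energy conservation bounds the speed of a geodesic of the metric `G` by its initial speed, and
the geodesic equation then bounds its acceleration quadratically. -/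
theorem norm_geodesic_sub_le {G : E → E →L[ℝ] E →L[ℝ] ℝ} {S : Set E} {m L M : ℝ} (hm : 0 < m)
    (hL : 0 < L) (hM : 0 < M) (hsymm : ∀ y u w, G y u w = G y w u)
    (hG : ∀ y ∈ S, DifferentiableAt ℝ G y ∧ ‖fderiv ℝ G y‖ ≤ M ∧ ‖G y‖ ≤ L ∧
      ∀ u, m * ‖u‖ ^ 2 ≤ G y u u) {c : ℝ → E} {v : E} {T : ℝ} (hT : 0 ≤ T) (hT1 : T ≤ 1)
    (hv : deriv c 0 = v)
    (hc : ∀ t ∈ Icc 0 T, c t ∈ S ∧ ContDiffAt ℝ 2 c t ∧ ∀ w,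
      G (c t) (deriv (deriv c) t) w + fderiv ℝ G (c t) (deriv c t) (deriv c t) w
        - 1 / 2 * fderiv ℝ G (c t) w (deriv c t) (deriv c t) = 0) :
    ‖c T - c 0‖ ≤ √(L / m) * ‖v‖ ∧
      ‖c T - c 0 - T • v‖ ≤ 3 / 2 * M / m * (L / m) * ‖v‖ ^ 2 := by
  have henergy : ∀ t ∈ Icc 0 T, HasDerivAt (fun t => G (c t) (deriv c t) (deriv c t)) 0 t :=
    fun t ht => hasDerivAt_energy (hG _ (hc t ht).1).1 (hsymm _) (hc t ht).2.1 ((hc t ht).2.2 _)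
  have hconst : ∀ t ∈ Icc 0 T, G (c t) (deriv c t) (deriv c t) = G (c 0) v v := fun t ht => by
    rw [constant_of_has_deriv_right_zero
      (fun t ht => (henergy t ht).continuousAt.continuousWithinAt)
      (fun t ht => (henergy t ⟨ht.1, ht.2.le⟩).hasDerivWithinAt) t ht, hv]
  have hspeed : ∀ t ∈ Icc 0 T, ‖deriv c t‖ ^ 2 ≤ L / m * ‖v‖ ^ 2 := fun t ht =>
    sq_norm_le_of_apply_self_eq hm (hG _ (hc t ht).1).2.2.2
      (hG _ (hc 0 ⟨le_rfl, hT⟩).1).2.2.1 (hconst t ht)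
  constructor
  · refine (norm_image_sub_le_of_norm_deriv_le_segment'
      (fun t ht => ((hc t ht).2.1.differentiableAt two_ne_zero).hasDerivAt.hasDerivWithinAt)
      (fun t ht => ?_) T ⟨hT, le_rfl⟩).trans (mul_le_of_le_one_right (by positivity) (by linarith))
    refine le_of_sq_le_sq ?_ (by positivity)
    rw [mul_pow, Real.sq_sqrt (by positivity)]
    exact hspeed t ⟨ht.1, ht.2.le⟩
  · refine norm_sub_sub_smul_le hT hT1 (by positivity) hv fun t ht => ⟨(hc t ht).2.1, ?_⟩
    obtain ⟨-, hfderiv, -, hpos⟩ := hG _ (hc t ht).1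
    calc ‖deriv (deriv c) t‖ ≤ 3 / 2 * M / m * ‖deriv c t‖ ^ 2 :=
          norm_acceleration_le hm hpos hfderiv ((hc t ht).2.2 _)
      _ ≤ 3 / 2 * M / m * (L / m * ‖v‖ ^ 2) := by gcongr; exact hspeed t ht
      _ = 3 / 2 * M / m * (L / m) * ‖v‖ ^ 2 := by ring

end GeodesicEstimate

theorem forall_mem_of_forall_mem_isClosed {Y : Type*} [TopologicalSpace Y] {γ : ℝ → Y}
    {U K : Set Y} (hγ : ContinuousOn γ (Icc 0 1)) (hU : IsOpen U) (hK : IsClosed K) (hKU : K ⊆ U)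
    (h0 : γ 0 ∈ U) (h : ∀ T ∈ Icc (0 : ℝ) 1, (∀ t ∈ Icc 0 T, γ t ∈ U) → γ T ∈ K) :
    ∀ t ∈ Icc (0 : ℝ) 1, γ t ∈ U := by
  by_contra! hne
  obtain ⟨t₀, ht₀, ht₀U⟩ := hne
  have hexit : IsCompact (Icc (0 : ℝ) 1 ∩ γ ⁻¹' Uᶜ) :=
    isCompact_Icc.of_isClosed_subset
      (hγ.preimage_isClosed_of_isClosed isClosed_Icc hU.isClosed_compl) inter_subset_left
  obtain ⟨t₁, ⟨ht₁, ht₁U⟩, hmin⟩ := hexit.exists_isLeast ⟨t₀, ht₀, ht₀U⟩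
  have ht₁0 : 0 < t₁ := lt_of_le_of_ne ht₁.1 fun h => ht₁U (h ▸ h0)
  have hbefore : ∀ t ∈ Ico 0 t₁, γ t ∈ U := fun t ht => by
    by_contra h
    exact (hmin ⟨⟨ht.1, ht.2.le.trans ht₁.2⟩, h⟩).not_gt ht.2
  have hmem : ∀ t ∈ Ico 0 t₁, γ t ∈ K := fun t ht =>
    h t ⟨ht.1, ht.2.le.trans ht₁.2⟩ fun s hs => hbefore s ⟨hs.1, hs.2.trans_lt ht.2⟩
  have hlim : Filter.Tendsto γ (𝓝[Ico 0 t₁] t₁) (𝓝 (γ t₁)) :=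
    (hγ t₁ ht₁).mono_left (nhdsWithin_mono _ fun s hs => ⟨hs.1, hs.2.le.trans ht₁.2⟩)
  have : (𝓝[Ico 0 t₁] t₁).NeBot := by
    rw [← mem_closure_iff_nhdsWithin_neBot, closure_Ico ht₁0.ne]
    exact ⟨ht₁0.le, le_rfl⟩
  exact ht₁U (hKU (hK.mem_of_tendsto hlim (Filter.eventually_of_mem self_mem_nhdsWithin hmem)))

section Exponential

variable {X : Type*} [TopologicalSpace X] [ChartedSpace E4 X] [IsManifold (𝓡 4) ∞ X]
  {g : Metric4 X}

theorem metricInChart_pos {p : X} {y : E4} (hy : y ∈ (extChartAt (𝓡 4) p).target) (u : E4)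
    (hu : u ≠ 0) : 0 < metricInChart g p y u u := by
  have hsource := (extChartAt (𝓡 4) p).map_target hy
  rw [extChartAt_source] at hsource
  have h := metricInChart_extChartAt_pos (g := g) hsource u hu
  rwa [(extChartAt (𝓡 4) p).right_inv hy] at h

variable (g) in
theorem metricInChart_symm (p : X) (y u w : E4) :
    metricInChart g p y u w = metricInChart g p y w u := g.symm _ _ _

variable (g) in
theorem exists_geodesic_estimate (p : X) : ∃ R > 0, ∃ κ > 0, ∃ C,
    Metric.closedBall (extChartAt (𝓡 4) p p) R ⊆ (extChartAt (𝓡 4) p).target ∧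
    ∀ γ : ℝ → X, ∀ v : E4, HasVelocityAt γ 0 p v → ∀ T ∈ Icc (0 : ℝ) 1,
      IsGeodesicOn g γ (Icc 0 T) →
      (∀ t ∈ Icc 0 T, γ t ∈ (extChartAt (𝓡 4) p).source ∩
        extChartAt (𝓡 4) p ⁻¹' Metric.ball (extChartAt (𝓡 4) p p) R) →
      ‖extChartAt (𝓡 4) p (γ T) - extChartAt (𝓡 4) p p‖ ≤ κ * ‖v‖ ∧
      ‖extChartAt (𝓡 4) p (γ T) - extChartAt (𝓡 4) p p - T • v‖ ≤ C * ‖v‖ ^ 2 := by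
  obtain ⟨R, hR, m, hm, L, hL, M, hM, hsub, hG⟩ := exists_metric_bounds
    (extChartAt_target_mem_nhds (I := 𝓡 4) p) ((contDiffAt_metricInChart g p).of_le (by simp))
    (fun y hy => metricInChart_pos (g := g) hy)
  refine ⟨R, hR, √(L / m), by positivity, 3 / 2 * M / m * (L / m), hsub, ?_⟩
  rintro γ v ⟨h0, -, hder⟩ T hT hγ hU
  have h := norm_geodesic_sub_le (S := Metric.closedBall (extChartAt (𝓡 4) p p) R) hm hL hM
    (metricInChart_symm g p) hG (c := fun t => extChartAt (𝓡 4) p (γ t)) (v := v) hT.1 hT.2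
    hder.deriv fun t ht =>
      ⟨Metric.ball_subset_closedBall (hU t ht).2, (hγ t ht).2 p (hU t ht).1⟩
  rwa [h0] at h

variable (g) in
theorem exists_exp_estimate [T2Space X] (p : X) :
    ∃ ρ > 0, ∃ C, ∀ v : E4, ‖v‖ ≤ ρ → ∀ q, IsExp g p v q →
      q ∈ (extChartAt (𝓡 4) p).source ∧
      ‖extChartAt (𝓡 4) p q - extChartAt (𝓡 4) p p - v‖ ≤ C * ‖v‖ ^ 2 := by
  obtain ⟨R, hR, κ, hκ, C, hsub, hest⟩ := exists_geodesic_estimate g p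
  refine ⟨R / 2 / κ, by positivity, C, ?_⟩
  rintro v hv q ⟨γ, δ, hδ, hγ, hγ0, rfl⟩
  have hv' : κ * ‖v‖ ≤ R / 2 := by rwa [le_div_iff₀ hκ, mul_comm] at hv
  have hgeo : ∀ T ∈ Icc (0 : ℝ) 1, IsGeodesicOn g γ (Icc 0 T) := fun T hT t ht =>
    hγ t ⟨by linarith [ht.1], by linarith [ht.2, hT.2]⟩
  have hmem1 : (1 : ℝ) ∈ Icc (0 : ℝ) 1 := ⟨zero_le_one, le_rfl⟩
  set φ := extChartAt (𝓡 4) p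
  have hball : Metric.closedBall (φ p) (R / 2) ⊆ φ.target :=
    (Metric.closedBall_subset_closedBall (by linarith)).trans hsub
  have hstart : γ 0 ∈ φ.source ∩ φ ⁻¹' Metric.ball (φ p) R := by
    rw [hγ0.1]
    exact ⟨mem_extChartAt_source p, Metric.mem_ball_self hR⟩
  have hall : ∀ t ∈ Icc (0 : ℝ) 1, γ t ∈ φ.source ∩ φ ⁻¹' Metric.ball (φ p) R := by
    refine forall_mem_of_forall_mem_isClosed (K := φ.symm '' Metric.closedBall (φ p) (R / 2))
      (fun t ht => (hgeo 1 hmem1 t ht).1.continuousWithinAt)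
      ((continuousOn_extChartAt p).isOpen_inter_preimage (isOpen_extChartAt_source p)
        Metric.isOpen_ball)
      ((isCompact_closedBall _ _).image_of_continuousOn
        ((continuousOn_extChartAt_symm p).mono hball)).isClosed ?_ hstart fun T hT hU =>
        ⟨φ (γ T), mem_closedBall_iff_norm.2 ((hest γ v hγ0 T hT (hgeo T hT) hU).1.trans hv'),
          φ.left_inv (hU T ⟨hT.1, le_rfl⟩).1⟩
    rintro _ ⟨y, hy, rfl⟩
    refine ⟨φ.map_target (hball hy), ?_⟩
    rw [mem_preimage, φ.right_inv (hball hy)]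
    exact Metric.closedBall_subset_ball (by linarith) hy
  have h := (hest γ v hγ0 1 hmem1 (hgeo 1 hmem1) hall).2
  rw [one_smul] at h
  exact ⟨(hall 1 hmem1).1, h⟩

theorem isExp_riemExp {u : TangentBundle (𝓡 4) X} (h : ∃ q, IsExp g u.1 u.2 q) :
    IsExp g u.1 u.2 (riemExp g u) := by
  rw [riemExp, dif_pos h]
  exact h.choose_spec

theorem IsExp.eq_of_zero [T2Space X] {p q : X} (h : IsExp g p 0 q) : q = p := by
  obtain ⟨ρ, hρ, C, hC⟩ := exists_exp_estimate g p
  obtain ⟨hq, hle⟩ := hC 0 (by simpa only [norm_zero] using hρ.le) q h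
  refine (extChartAt (𝓡 4) p).injOn hq (mem_extChartAt_source p) (sub_eq_zero.1 ?_)
  simpa using hle

end Exponential

/-! ### Normal spheres -/

section Spheres

variable {X : Type*} [TopologicalSpace X] [ChartedSpace E4 X] [IsManifold (𝓡 4) ∞ X]
  {g : Metric4 X} {o : Orientation4 X} {Ω : TwoForm X} {p : X}
  {n : Fin 3 → TangentSpace (𝓡 4) p} {ε : X → ℝ} {r : ℝ}

/-- The point of the unit sphere in the span of `n` with coordinates `y`. -/
noncomputable def normalVector (n : Fin 3 → TangentSpace (𝓡 4) p) (y : S2) :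
    TangentSpace (𝓡 4) p := ∑ i, y.1 i • n i

omit [IsManifold (𝓡 4) ∞ X] in
theorem continuous_normalVector (n : Fin 3 → TangentSpace (𝓡 4) p) :
    Continuous (normalVector n) := by
  unfold normalVector
  fun_prop

theorem smul_normalVector_mem {Z : Set X} (hn : ∀ i, n i ∈ normalSpace g Z p) (a : ℝ) (y : S2) :
    a • normalVector n y ∈ normalSpace g Z p := fun v hv => by
  simp only [normalVector, map_smul, map_sum, smul_apply, sum_apply, hn _ v hv, smul_zero,
    Finset.sum_const_zero]

theorem inner_smul_normalVector (hn : ∀ i j, g.inner p (n i) (n j) = if i = j then 1 else 0)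
    (a : ℝ) (y : S2) : g.inner p (a • normalVector n y) (a • normalVector n y) = a ^ 2 := by
  simp only [normalVector, Fin.sum_univ_three, map_smul, map_add, smul_apply, add_apply, hn,
    smul_eq_mul, Fin.isValue, Fin.reduceEq, if_true, if_false]
  linear_combination a ^ 2 * sum_sq_eq_one y

theorem sdCoeff_nablaAtZero_normalVector (n : Fin 3 → TangentSpace (𝓡 4) p) (a : ℝ)
    (e : Module.Basis (Fin 4) ℝ (TangentSpace (𝓡 4) p)) (y : S2) :
    sdCoeff e (nablaAtZero Ω p (a • normalVector n y)) =
      (a • (Matrix.of fun i j => nablaAtZero Ω p (n i) ![e 0, e j.succ]).transpose).mulVec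
        y.1.ofLp := by
  have h : nablaAtZero Ω p (a • normalVector n y) = a • ∑ i, y.1 i • nablaAtZero Ω p (n i) := by
    refine ((fderiv ℝ (formInChart Ω p) (extChartAt (𝓡 4) p p)).map_smul a _).trans ?_
    congr 1
    exact (map_sum _ _ _).trans (Finset.sum_congr rfl fun i _ => map_smul _ _ _)
  ext j
  rw [h, Fin.sum_univ_three]
  change a * (y.1 0 * nablaAtZero Ω p (n 0) ![e 0, e j.succ] +
    y.1 1 * nablaAtZero Ω p (n 1) ![e 0, e j.succ] +
    y.1 2 * nablaAtZero Ω p (n 2) ![e 0, e j.succ]) = _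
  simp only [Matrix.mulVec, dotProduct, Matrix.smul_apply, Matrix.transpose_apply, Matrix.of_apply,
    Fin.sum_univ_three, smul_eq_mul]
  ring

theorem zero_mem_normalBall (hε : ∀ z ∈ zeroSet Ω, 0 < ε z) (hp : p ∈ zeroSet Ω) :
    (⟨p, 0⟩ : TangentBundle (𝓡 4) X) ∈ normalBall g (zeroSet Ω) ε :=
  ⟨hp, fun v _ => by simp, by simpa using hε p hp⟩

theorem smul_normalVector_mem_normalBall (hp : p ∈ zeroSet Ω) (hn : IsOrientedNormalONB g o Ω p n)
    {a : ℝ} (ha : 0 ≤ a) (haε : a < ε p) (y : S2) :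
    (⟨p, a • normalVector n y⟩ : TangentBundle (𝓡 4) X) ∈ normalBall g (zeroSet Ω) ε := by
  refine ⟨hp, smul_normalVector_mem hn.mem a y, ?_⟩
  rw [inner_smul_normalVector hn.orthonormal, Real.sqrt_sq ha]
  exact haε

theorem riemExp_zero [T2Space X] {N₀ : Set (TangentBundle (𝓡 4) X)} (h : ExpEmbeds g N₀)
    (hp : (⟨p, 0⟩ : TangentBundle (𝓡 4) X) ∈ N₀) : riemExp g ⟨p, 0⟩ = p :=
  (isExp_riemExp (h.1 _ hp)).eq_of_zero

theorem riemExp_notMem_zeroSet [T2Space X] (hε : ∀ z ∈ zeroSet Ω, 0 < ε z)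
    (hexp : ExpEmbeds g (normalBall g (zeroSet Ω) ε)) {u : TangentBundle (𝓡 4) X}
    (hu : u ∈ normalBall g (zeroSet Ω) ε) (hu0 : g.inner u.1 u.2 u.2 ≠ 0) :
    riemExp g u ∉ zeroSet Ω := fun hz => by
  have h0 := zero_mem_normalBall (g := g) hε hz
  have hu_eq : u = ⟨riemExp g u, 0⟩ := congrArg Subtype.val <|
    hexp.2.injective (a₁ := ⟨u, hu⟩) (a₂ := ⟨_, h0⟩) (riemExp_zero hexp h0).symm
  rw [hu_eq] at hu0
  simp at hu0

end Spheres

section Contraction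

variable {X : Type*} [TopologicalSpace X] [ChartedSpace E4 X] [IsManifold (𝓡 4) ∞ X]
  {g : Metric4 X} {o : Orientation4 X} {Ω : TwoForm X} {p : X}
  {n : Fin 3 → TangentSpace (𝓡 4) p} {ε : X → ℝ} {r : ℝ}

/-- The contraction of the normal sphere of radius `r` to its centre, along geodesics. -/
noncomputable def sphereContraction (g : Metric4 X) (p : X) (n : Fin 3 → TangentSpace (𝓡 4) p)
    (r : ℝ) (q : S2 × unitInterval) : X :=
  riemExp g ⟨p, ((q.2 : ℝ) * r) • normalVector n q.1⟩

theorem sphereContraction_one (p : X) (n : Fin 3 → TangentSpace (𝓡 4) p) (r : ℝ) (y : S2) :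
    sphereContraction g p n r (y, 1) = normalSphere g p n r y := by
  simp only [sphereContraction, normalSphere, normalVector, Icc.coe_one, one_mul]

theorem sphereContraction_zero [T2Space X] (hε : ∀ z ∈ zeroSet Ω, 0 < ε z)
    (hexp : ExpEmbeds g (normalBall g (zeroSet Ω) ε)) (hp : p ∈ zeroSet Ω)
    (n : Fin 3 → TangentSpace (𝓡 4) p) (r : ℝ) (y : S2) :
    sphereContraction g p n r (y, 0) = p := by
  simp only [sphereContraction, Icc.coe_zero, zero_mul, zero_smul,
    riemExp_zero hexp (zero_mem_normalBall hε hp)]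

variable (hexp : ExpEmbeds g (normalBall g (zeroSet Ω) ε)) (hp : p ∈ zeroSet Ω)
  (hn : IsOrientedNormalONB g o Ω p n) (hr : 0 < r) (hrε : r < ε p)

include hp hn hr hrε

theorem mem_normalBall_of_unitInterval (q : S2 × unitInterval) :
    (⟨p, ((q.2 : ℝ) * r) • normalVector n q.1⟩ : TangentBundle (𝓡 4) X) ∈
      normalBall g (zeroSet Ω) ε :=
  smul_normalVector_mem_normalBall hp hn (mul_nonneg q.2.2.1 hr.le)
    ((mul_le_of_le_one_left hr.le q.2.2.2).trans_lt hrε) q.1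

include hexp

theorem continuous_sphereContraction : Continuous (sphereContraction g p n r) := by
  have hvec : Continuous fun q : S2 × unitInterval => ((q.2 : ℝ) * r) • normalVector n q.1 :=
    (show Continuous fun q : S2 × unitInterval => (q.2 : ℝ) * r by fun_prop).smul
      ((continuous_normalVector n).comp continuous_fst)
  exact hexp.2.continuous.comp (((FiberBundle.continuous_totalSpaceMk E4
    (TangentSpace (𝓡 4) : X → Type _) p).comp hvec).subtype_mk
      (mem_normalBall_of_unitInterval hp hn hr hrε))

theorem sphereContraction_notMem_zeroSet [T2Space X] (hε : ∀ z ∈ zeroSet Ω, 0 < ε z)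
    {q : S2 × unitInterval} (hq : q.2 ≠ 0) : sphereContraction g p n r q ∉ zeroSet Ω := by
  refine riemExp_notMem_zeroSet hε hexp (mem_normalBall_of_unitInterval hp hn hr hrε q) ?_
  rw [inner_smul_normalVector hn.orthonormal]
  exact pow_ne_zero 2 (mul_ne_zero (fun h => hq (Subtype.ext h)) hr.ne')

theorem exists_norm_sphereContraction_sub_le [T2Space X] :
    ∃ ρ > 0, ∃ C, ∀ q : S2 × unitInterval, q.2 ≠ 0 →
      ∀ w : E4, w = r • normalVector n q.1 → ‖(q.2 : ℝ) • w‖ ≤ ρ →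
      ‖(q.2 : ℝ)⁻¹ • (extChartAt (𝓡 4) p (sphereContraction g p n r q) - extChartAt (𝓡 4) p p) -
        w‖ ≤ C * q.2 * ‖w‖ ^ 2 := by
  obtain ⟨ρ, hρ, C, hC⟩ := exists_exp_estimate g p
  refine ⟨ρ, hρ, C, ?_⟩
  intro q hq0 w hw hq
  have hne : (q.2 : ℝ) ≠ 0 := fun h => hq0 (Subtype.ext h)
  have hpos : (0 : ℝ) < q.2 := lt_of_le_of_ne q.2.2.1 hne.symm
  have hvec : (((q.2 : ℝ) * r) • normalVector n q.1 : TangentSpace (𝓡 4) p) = (q.2 : ℝ) • w :=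
    hw ▸ mul_smul (q.2 : ℝ) r (normalVector n q.1)
  have hexp_q : IsExp g p ((q.2 : ℝ) • w) (sphereContraction g p n r q) :=
    hvec ▸ isExp_riemExp (hexp.1 _ (mem_normalBall_of_unitInterval hp hn hr hrε q))
  have hle := (hC _ hq _ hexp_q).2
  rw [norm_smul, Real.norm_of_nonneg hpos.le] at hle
  have hfactor : ∀ u : E4, (q.2 : ℝ)⁻¹ • u - w = (q.2 : ℝ)⁻¹ • (u - (q.2 : ℝ) • w) := fun u => by
    rw [smul_sub, inv_smul_smul₀ hne]
  rw [hfactor, norm_smul, norm_inv, Real.norm_of_nonneg hpos.le, inv_mul_le_iff₀ hpos]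
  exact hle.trans_eq (by ring)

theorem tendsto_sphereContraction_sub [T2Space X] (y₀ : S2) :
    Filter.Tendsto (fun q : S2 × unitInterval => (q.2 : ℝ)⁻¹ •
      (extChartAt (𝓡 4) p (sphereContraction g p n r q) - extChartAt (𝓡 4) p p))
      (𝓝[{q | q.2 = 0}ᶜ] (y₀, 0)) (𝓝 (r • normalVector n y₀ : TangentSpace (𝓡 4) p)) := by
  obtain ⟨ρ, hρ, C, hC⟩ := exists_norm_sphereContraction_sub_le hexp hp hn hr hrε
  let w : S2 × unitInterval → E4 := fun q => r • normalVector n q.1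
  have hw : Continuous w := ((continuous_normalVector n).comp continuous_fst).const_smul r
  have hsmall : Filter.Tendsto (fun q => ‖(q.2 : ℝ) • w q‖) (𝓝 (y₀, 0)) (𝓝 0) := by
    simpa using ((show Continuous fun q => (q.2 : ℝ) • w q by fun_prop).norm.tendsto (y₀, 0))
  have herr : Filter.Tendsto (fun q => C * (q.2 : ℝ) * ‖w q‖ ^ 2) (𝓝 (y₀, 0)) (𝓝 0) := by
    simpa using (show Continuous fun q => C * (q.2 : ℝ) * ‖w q‖ ^ 2 by fun_prop).tendsto (y₀, 0)
  have hdiff : Filter.Tendsto (fun q : S2 × unitInterval => (q.2 : ℝ)⁻¹ •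
      (extChartAt (𝓡 4) p (sphereContraction g p n r q) - extChartAt (𝓡 4) p p) - w q)
      (𝓝[{q | q.2 = 0}ᶜ] (y₀, 0)) (𝓝 0) := by
    refine squeeze_zero_norm' ?_ (herr.mono_left nhdsWithin_le_nhds)
    filter_upwards [self_mem_nhdsWithin,
      nhdsWithin_le_nhds (hsmall.eventually (gt_mem_nhds hρ))] with q hq0 hq
    exact hC q hq0 (w q) rfl hq.le
  have hsum := hdiff.add ((hw.tendsto (y₀, 0)).mono_left nhdsWithin_le_nhds)
  simp only [sub_add_cancel, zero_add] at hsum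
  exact hsum

end Contraction

section LimitStructure

variable {X : Type*} [TopologicalSpace X] [ChartedSpace E4 X] [IsManifold (𝓡 4) ∞ X]
  {g : Metric4 X} {o : Orientation4 X} {Ω : TwoForm X} {p : X}
  {W : Type*} [NormedAddCommGroup W] [NormedSpace ℝ W]
  (S : SummandOfTrivial E4 (TangentSpace (𝓡 4) : X → Type _) W)

theorem tendsto_extendEnd_acsAt {ι : Type*} {l : Filter ι} {f : ι → X}
    {α : ∀ i, TangentSpace (𝓡 4) (f i) [⋀^Fin 2]→L[ℝ] ℝ}
    {β : TangentSpace (𝓡 4) p [⋀^Fin 2]→L[ℝ] ℝ} (hf : Filter.Tendsto f l (𝓝 p))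
    (h : Filter.Tendsto (fun i => acsInChart g p (f i) (α i)) l (𝓝 (acsInChart g p p β))) :
    Filter.Tendsto (fun i => S.extendEnd (f i) (acsAt g (f i) (α i))) l
      (𝓝 (S.extendEnd p (acsAt g p β))) :=
  S.tendsto_extendEnd hf h

theorem continuousAt_extendEnd_acs (hsd : IsSelfDualForm g o Ω) (hΩ : IsSmoothForm Ω)
    (hp : p ∉ zeroSet Ω) : ContinuousAt (fun x => S.extendEnd x (acs g Ω x)) p := by
  refine tendsto_extendEnd_acsAt S Filter.tendsto_id
    (tendsto_acsInChart Filter.tendsto_id ?_ (hsd p) hp)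
  have h := (hΩ.contDiffAt p).continuousAt.tendsto.comp (continuousAt_extChartAt p).tendsto
  rw [formInChart_extChartAt (mem_chart_source E4 p), compContinuousLinearMap_coordFrame_self] at h
  refine h.congr' ?_
  filter_upwards [(chartAt E4 p).open_source.mem_nhds (mem_chart_source E4 p)] with x hx
  exact formInChart_extChartAt hx

theorem continuousAt_extendEnd_acsAt {Y : Type*} [TopologicalSpace Y]
    {α : Y → TangentSpace (𝓡 4) p [⋀^Fin 2]→L[ℝ] ℝ} {y : Y} (hα : ContinuousAt α y)
    (hsd : IsSelfDualAt g o p (α y)) (h0 : α y ≠ 0) :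
    ContinuousAt (fun y => S.extendEnd p (acsAt g p (α y))) y :=
  tendsto_extendEnd_acsAt S tendsto_const_nhds <| tendsto_acsInChart tendsto_const_nhds
    (hα.tendsto.congr fun y => (compContinuousLinearMap_coordFrame_self (α y)).symm) hsd h0

theorem hasClutchingNumber_extendEnd_acsAt {e : Module.Basis (Fin 4) ℝ (TangentSpace (𝓡 4) p)}
    (he : IsOrientedONB g o p e) {α : S2 → TangentSpace (𝓡 4) p [⋀^Fin 2]→L[ℝ] ℝ}
    (hα : ∀ y, IsSelfDualAt g o p (α y)) (h0 : ∀ y, α y ≠ 0) {c : ℤ}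
    (h : HasClutchingNumber (fun y => typeTwoZero (unitQuat (sdCoeff e (α y)))) c) :
    HasClutchingNumber (fun y => typeTwoZero (S.extendEnd p (acsAt g p (α y)))) c := by
  let A : W →L[ℝ] E4 := ((basisFrame e).symm : TangentSpace (𝓡 4) p →L[ℝ] E4).comp (S.proj p)
  have hA : Function.Surjective A := fun u =>
    ⟨S.incl p (basisFrame e u), by
      simp only [A, ContinuousLinearMap.comp_apply, S.proj_incl, ContinuousLinearEquiv.coe_coe,
        ContinuousLinearEquiv.symm_apply_apply]⟩
  have hconj : ∀ y w, A (S.extendEnd p (acsAt g p (α y)) w) = unitQuat (sdCoeff e (α y)) (A w) :=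
    fun y w => by
      have h := acsAt_basisFrame he.1 ((hα y).dualCoeff_eq he) (A w)
      simp only [A, ContinuousLinearMap.comp_apply, ContinuousLinearEquiv.coe_coe,
        ContinuousLinearEquiv.apply_symm_apply, SummandOfTrivial.extendEnd, S.proj_incl] at h ⊢
      rw [h, ContinuousLinearEquiv.symm_apply_apply]
  let T : (E4 [⋀^Fin 2]→L[ℝ] ℂ) →ₗ[ℂ] (W [⋀^Fin 2]→L[ℝ] ℂ) :=
    { toFun θ := θ.compContinuousLinearMap A
      map_add' _ _ := rfl
      map_smul' _ _ := rfl }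
  refine h.map (fun _ => T)
    ((ContinuousAlternatingMap.compContinuousLinearMapCLM A).continuous.comp continuous_snd)
    (fun y θ hθ => comp_mem_typeTwoZero (hconj y) hθ) (fun y θ _ hθ => twoForm_ext fun u v => ?_)
    fun y θ => span_eq_typeTwoZero_extendEnd S ((hα y).acsAt_acsAt (h0 y))
  obtain ⟨u, rfl⟩ := hA u
  obtain ⟨v, rfl⟩ := hA v
  rw [← compContinuousLinearMap_apply_vec2]
  exact congrArg (fun η : W [⋀^Fin 2]→L[ℝ] ℂ => η ![u, v]) hθ

end LimitStructure

section Homotopy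

variable {X : Type*} [TopologicalSpace X] [ChartedSpace E4 X] [IsManifold (𝓡 4) ∞ X]
  {g : Metric4 X} {o : Orientation4 X} {Ω : TwoForm X} {p : X}
  {n : Fin 3 → TangentSpace (𝓡 4) p} {ε : X → ℝ} {r : ℝ}
  {W : Type*} [NormedAddCommGroup W] [NormedSpace ℝ W]
  (S : SummandOfTrivial E4 (TangentSpace (𝓡 4) : X → Type _) W)

variable (g Ω n r) in
open Classical in
/-- The almost complex structure of `Ω` along the contraction of a normal sphere, extended to the
trivial bundle. At the centre of the sphere, where `Ω` vanishes, it is replaced by the structure of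
the derivative of `Ω` in the direction of the normal vector. -/
noncomputable def contractedAcs (q : S2 × unitInterval) : W →L[ℝ] W :=
  if q.2 = 0 then S.extendEnd p (acsAt g p (nablaAtZero Ω p (r • normalVector n q.1)))
  else S.extendEnd (sphereContraction g p n r q) (acs g Ω (sphereContraction g p n r q))

theorem contractedAcs_zero (y : S2) : contractedAcs g Ω n r S (y, 0) =
    S.extendEnd p (acsAt g p (nablaAtZero Ω p (r • normalVector n y))) :=
  if_pos rfl

theorem contractedAcs_one (y : S2) : contractedAcs g Ω n r S (y, 1) =
    S.extendEnd (normalSphere g p n r y) (acs g Ω (normalSphere g p n r y)) := by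
  rw [← sphereContraction_one]
  exact if_neg one_ne_zero

theorem nablaAtZero_normalVector_ne_zero (hn : IsOrientedNormalONB g o Ω p n) (hr : 0 < r)
    (y : S2) : nablaAtZero Ω p (r • normalVector n y) ≠ 0 := fun h => by
  obtain ⟨e, he⟩ := exists_isOrientedONB g o p
  have hcoeff := sdCoeff_nablaAtZero_normalVector (Ω := Ω) n r e y
  rw [h, Matrix.smul_mulVec] at hcoeff
  have hdet := hn.reversing e he
  rw [← Matrix.det_transpose] at hdet
  exact hdet.ne (Matrix.exists_mulVec_eq_zero_iff.1 ⟨_, coe_sphere_ne_zero y,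
    (smul_eq_zero.1 hcoeff.symm).resolve_left hr.ne'⟩)

variable (hsd : IsSelfDualForm g o Ω) (hΩ : IsSmoothForm Ω) (htrans : VanishesTransversely g o Ω)
  (hp : p ∈ zeroSet Ω) (hn : IsOrientedNormalONB g o Ω p n) (hr : 0 < r)

include hsd hΩ htrans hp hn hr

theorem hasClutchingNumber_contractedAcs_zero :
    HasClutchingNumber (fun y => typeTwoZero (contractedAcs g Ω n r S (y, 0))) 2 := by
  obtain ⟨e, he⟩ := exists_isOrientedONB g o p
  simp only [contractedAcs_zero]
  refine hasClutchingNumber_extendEnd_acsAt S he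
    (fun y => isSelfDualAt_nablaAtZero hsd hΩ hp htrans _)
    (nablaAtZero_normalVector_ne_zero hn hr) ?_
  simp only [sdCoeff_nablaAtZero_normalVector]
  refine hasClutchingNumber_unitQuat_mulVec ?_
  rw [Matrix.det_smul, Matrix.det_transpose]
  exact mul_neg_of_pos_of_neg (by positivity) (hn.reversing e he)

variable [T2Space X] (hε : ∀ z ∈ zeroSet Ω, 0 < ε z)
  (hexp : ExpEmbeds g (normalBall g (zeroSet Ω) ε)) (hrε : r < ε p)

include hε hexp hrε

theorem exists_contractedAcs_eq_extendEnd (q : S2 × unitInterval) :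
    ∃ (x : X) (J : TangentSpace (𝓡 4) x →L[ℝ] TangentSpace (𝓡 4) x),
      (∀ v, J (J v) = -v) ∧ contractedAcs g Ω n r S q = S.extendEnd x J := by
  by_cases hq : q.2 = 0
  · exact ⟨p, _, (isSelfDualAt_nablaAtZero hsd hΩ hp htrans _).acsAt_acsAt
      (nablaAtZero_normalVector_ne_zero hn hr q.1), if_pos hq⟩
  · exact ⟨_, _, (hsd _).acsAt_acsAt
      (sphereContraction_notMem_zeroSet hexp hp hn hr hrε hε hq), if_neg hq⟩

theorem continuousAt_contractedAcs_zero (y : S2) :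
    ContinuousAt (contractedAcs g Ω n r S) (y, 0) := by
  have hzero := sphereContraction_zero hε hexp hp n r y
  have h0 := nablaAtZero_normalVector_ne_zero hn hr y
  rw [← continuousWithinAt_univ, ← union_compl_self {q : S2 × unitInterval | q.2 = 0},
    continuousWithinAt_union]
  constructor
  · have hnabla : ContinuousAt (fun q : S2 × unitInterval =>
        nablaAtZero Ω p (r • normalVector n q.1)) (y, 0) :=
      ((fderiv ℝ (formInChart Ω p) (extChartAt (𝓡 4) p p)).continuous.comp
        (((continuous_normalVector n).comp continuous_fst).const_smul r)).continuousAt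
    exact (continuousAt_extendEnd_acsAt S hnabla
      (isSelfDualAt_nablaAtZero hsd hΩ hp htrans _) h0).continuousWithinAt.congr
      (fun q hq => if_pos hq) (if_pos rfl)
  · have hH : Filter.Tendsto (sphereContraction g p n r) (𝓝[{q | q.2 = 0}ᶜ] (y, 0)) (𝓝 p) := by
      have h := (continuous_sphereContraction hexp hp hn hr hrε).tendsto (y, 0)
      rw [hzero] at h
      exact h.mono_left nhdsWithin_le_nhds
    have hpos : ∀ᶠ q : S2 × unitInterval in 𝓝[{q | q.2 = 0}ᶜ] (y, 0), 0 < (q.2 : ℝ) := by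
      filter_upwards [self_mem_nhdsWithin] with q hq
      exact lt_of_le_of_ne q.2.2.1 fun h => hq (Subtype.ext h.symm)
    have hlim := tendsto_extendEnd_acsAt S hH (tendsto_acsInChart_blowUp hsd hΩ hp htrans hH hpos
      (tendsto_sphereContraction_sub hexp hp hn hr hrε y) h0)
    rw [← contractedAcs_zero] at hlim
    refine hlim.congr' ?_
    filter_upwards [self_mem_nhdsWithin] with q hq
    exact (if_neg hq).symm

theorem continuous_contractedAcs : Continuous (contractedAcs g Ω n r S) := by
  refine continuous_iff_continuousAt.2 fun q => ?_
  by_cases hq : q.2 = 0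
  · obtain ⟨y, t⟩ := q
    obtain rfl : t = 0 := hq
    exact continuousAt_contractedAcs_zero S hsd hΩ htrans hp hn hr hε hexp hrε y
  · have hx := sphereContraction_notMem_zeroSet hexp hp hn hr hrε hε hq
    refine ((continuousAt_extendEnd_acs S hsd hΩ hx).comp
      (continuous_sphereContraction hexp hp hn hr hrε).continuousAt).congr ?_
    filter_upwards [(isOpen_ne.preimage continuous_snd).mem_nhds hq] with q' hq'
    exact (if_neg hq').symm

theorem hasClutchingNumber_normalSphere :
    HasClutchingNumber (fun y => typeTwoZero
      (S.extendEnd (normalSphere g p n r y) (acs g Ω (normalSphere g p n r y)))) 2 := by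
  have hJ := exists_contractedAcs_eq_extendEnd S hsd hΩ htrans hp hn hr hε hexp hrε
  have h := HasClutchingNumber.homotopy_typeTwoZero
    (continuous_contractedAcs S hsd hΩ htrans hp hn hr hε hexp hrε)
    (fun q => by
      obtain ⟨x, J, hJJ, hq⟩ := hJ q
      rw [hq]
      exact S.extendEnd_pow_three hJJ)
    (fun q => by
      obtain ⟨x, J, hJJ, hq⟩ := hJ q
      rw [hq]
      exact fun θ => span_eq_typeTwoZero_extendEnd S hJJ)
    (hasClutchingNumber_contractedAcs_zero S hsd hΩ htrans hp hn hr)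
  simpa only [contractedAcs_one] using h

end Homotopy

theorem lemma2p1_general {X : Type*} [TopologicalSpace X] [ChartedSpace E4 X]
    [IsManifold (𝓡 4) ∞ X] [T2Space X] [CompactSpace X] {g : Metric4 X} {o : Orientation4 X}
    {Ω : TwoForm X} (hsd : IsSelfDualForm g o Ω) (hΩ : IsSmoothForm Ω)
    (htrans : VanishesTransversely g o Ω) :
    (∀ ε : X → ℝ, (∀ z ∈ zeroSet Ω, 0 < ε z) → ExpEmbeds g (normalBall g (zeroSet Ω) ε) →
      ∀ p ∈ zeroSet Ω, ∀ n : Fin 3 → TangentSpace (𝓡 4) p, IsOrientedNormalONB g o Ω p n →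
        ∀ r : ℝ, 0 < r → r < ε p →
          (∀ y, normalSphere g p n r y ∉ zeroSet Ω) ∧
          HasFirstChernNumber ComplexForms (normalSphere g p n r) (canonicalBundle g Ω) 2 ∧
          ¬ IsTrivialLineBundle ComplexForms (normalSphere g p n r) (canonicalBundle g Ω)) ∧
    ∀ p ∈ zeroSet Ω, ∀ U ∈ 𝓝 p, ¬ ExtendsOver g Ω U := by
  refine ⟨fun ε hε hexp p hp n hn r hr hrε => ?_,
    fun p hp U hU => not_extendsOver hsd hΩ hp htrans hU⟩
  have hcont : Continuous (normalSphere g p n r) := by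
    simpa only [Function.comp_def, sphereContraction_one] using
      (continuous_sphereContraction hexp hp hn hr hrε).comp (Continuous.prodMk_left 1)
  have hzero : ∀ y, normalSphere g p n r y ∉ zeroSet Ω := fun y => by
    rw [← sphereContraction_one]
    exact sphereContraction_notMem_zeroSet hexp hp hn hr hrε hε one_ne_zero
  have hJ : ∀ y v, acs g Ω (normalSphere g p n r y) (acs g Ω (normalSphere g p n r y) v) = -v :=
    fun y => (hsd _).acsAt_acsAt (hzero y)
  obtain ⟨t, ⟨S⟩⟩ := exists_summandOfTrivial E4 (TangentSpace (𝓡 4) : X → Type _)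
  have hdeg := hasClutchingNumber_normalSphere S hsd hΩ htrans hp hn hr hε hexp hrε
  exact ⟨hzero, hasFirstChernNumber_of_hasClutchingNumber S hcont hJ hdeg,
    not_isTrivialLineBundle_of_hasClutchingNumber S hcont hJ two_ne_zero hdeg⟩

end NearSymplectic

theorem lemma2p1 {X : Type*} [TopologicalSpace X] [ChartedSpace E4 X]
    [IsManifold (𝓡 4) ∞ X] [T2Space X] [CompactSpace X]
    (g : Metric4 X) (o : Orientation4 X)
    (Ω : TwoForm X)
    (hsd : IsSelfDualForm g o Ω)
    (hharm : IsHarmonicForm g o Ω)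
    (htrans : VanishesTransversely g o Ω) :
    (∀ ε : X → ℝ, ContinuousOn ε (zeroSet Ω) →
      (∀ z ∈ zeroSet Ω, 0 < ε z) →
      ExpEmbeds g (normalBall g (zeroSet Ω) ε) →
      ∀ p ∈ zeroSet Ω, ∀ n : Fin 3 → TangentSpace (𝓡 4) p,
        IsOrientedNormalONB g o Ω p n →
        ∀ r : ℝ, 0 < r → r < ε p →
          (∀ y, normalSphere g p n r y ∉ zeroSet Ω) ∧
          HasFirstChernNumber ComplexForms
            (normalSphere g p n r) (canonicalBundle g Ω) 2 ∧
          ¬ IsTrivialLineBundle ComplexForms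
            (normalSphere g p n r) (canonicalBundle g Ω)) ∧
    (∀ p ∈ zeroSet Ω, ∀ U ∈ 𝓝 p, ¬ ExtendsOver g Ω U) :=
  have h := lemma2p1_general hsd hharm.1 htrans
  ⟨fun ε _ => h.1 ε, h.2⟩
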